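/- **Setting.** Let $X$ be a connected compact $C^\infty$ manifold with a strictly positive smooth density $\mu$. Let $W_1,\dots,W_\nu$ be smooth vector fields on $X$ satisfying Hörmander's condition (the Lie algebra they generate spans the tangent space at every point), with formal degrees $d_i\in\{1,2,\dots\}$. For an ordered multi-index $\alpha=(\alpha_1,\dots,\alpha_M)\in\{1,\dots,\nu\}^M$ put $W^\alpha=W_{\alpha_1}\cdots W_{\alpha_M}$ and $\deg\alpha=d_{\alpha_1}+\dots+d_{\alpha_M}$. Let $\kappa\ge 1$ be an integer divisible by every $d_i$, and let $$L_0=\sum_{\deg\alpha\le\kappa,\ \deg\beta\le\kappa} b_{\alpha,\beta}\,W^\alpha W^\beta,\qquad b_{\alpha,\beta}\in C^\infty(X),$$ with domain $C^\infty(X)\subset L^2(X,\mu)$, be symmetric, non-negative and maximally subelliptic: for some constant $c$, $$\sum_{i=1}^\nu\|W_i^{\kappa/d_i}f\|_{L^2(X)}^2\le c\,\big(\langle L_0f,f\rangle_{L^2(X)}+\|f\|_{L^2(X)}^2\big)\quad\text{for all } f\in C^\infty(X).$$ Let $L$ be a non-negative self-adjoint extension of $L_0$ on $L^2(X,\mu)$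 with spectral resolution $E_L$, and let $m(L)=\int m\,dE_L$ for functions $m$ on $[0,\infty)$; $\|m(L)\|_{L^p(X)\to L^p(X)}$ denotes the least $K$ with $\|m(L)f\|_{L^p}\le K\|f\|_{L^p}$ for all $f\in L^2(X)\cap L^p(X)$ ($\infty$ if there is none). Fix a nonzero $\varphi\in C_c^\infty(0,\infty)$. For $1<r\le\infty$ and $0<s<\infty$ put $$\|m\|_{L^r_{s,\mathrm{sloc}}}=\sup_{R>0}\big\|\varphi(\cdot)\,m(R\,\cdot)\big\|_{L^r_s(\mathbb R)},\qquad \|f\|_{L^r_s(\mathbb R)}=\big\|\mathcal F^{-1}\big((1+4\pi^2|\xi|^2)^{s/2}\hat f(\xi)\big)\big\|_{L^r(\mathbb R)}.$$ Let $\mathcal M$ be the set of continuous functions $m:[0,\infty)\to\mathbb C$ that vanish in a neighbourhood of $0$. For $1<p<\infty$, $1<r\le\infty$, $s>0$ and $C\ge 0$, say that the estimate $\mathcal E(p,r,s;C)$ holds if for every $m\in\mathcal M$ with $\|m\|_{L^r_{s,\mathrm{sloc}}}<\infty$, $m(L)$ is a bounded operator on $L^2(X)$ and $$\|m(L)\|_{L^p(X)\to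 L^p(X)}\le C\,\|m\|_{L^r_{s,\mathrm{sloc}}}.$$ **Proposition.** Let $0<\theta<1$, $0<s_0,s_1<\infty$, $s>(1-\theta)s_0+\theta s_1$ and $C_0,C_1\ge 0$. There is a constant $C$, depending only on $X,\mu,W,L,\varphi$ and on $\theta,s_0,s_1,s,C_0,C_1$, such that the following holds for all $1<p_0,p_1<\infty$ and $1<r_0,r_1\le\infty$ with $r_0s_0>1$ and $r_1s_1>1$. Let $$\frac1p=\frac{1-\theta}{p_0}+\frac{\theta}{p_1},\qquad \frac1r=\frac{1-\theta}{r_0}+\frac{\theta}{r_1}.$$ If $\mathcal E(p_0,r_0,s_0;C_0)$ and $\mathcal E(p_1,r_1,s_1;C_1)$ hold, then $\mathcal E(p,r,s;C)$ holds. -/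

import Mathlib

open MeasureTheory Set
open scoped ENNReal NNReal ContDiff Manifold SchwartzMap InnerProductSpace

/-! ### Sobolev norms on the real line -/

/-- The symbol `(1 + 4π²|ξ|²)^{s/2}` of the Bessel potential operator `(I + Δ)^{s/2}`. -/
noncomputable def besselSymbol (s : ℝ) (ξ : ℝ) : ℝ :=
  (1 + 4 * Real.pi ^ 2 * ξ ^ 2) ^ (s / 2)

theorem besselSymbol_hasTemperateGrowth (s : ℝ) :
    (besselSymbol s).HasTemperateGrowth := by
  have e : besselSymbol s = (fun x : ℝ => (1 + ‖x‖ ^ 2) ^ (s / 2)) ∘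
      ⇑((2 * Real.pi) • ContinuousLinearMap.id ℝ ℝ) := by
    funext ξ
    have e : (2 * Real.pi * ξ) ^ 2 = 4 * Real.pi ^ 2 * ξ ^ 2 := by ring
    simp only [besselSymbol, Function.comp_def, smul_apply,
      ContinuousLinearMap.id_apply, smul_eq_mul, Real.norm_eq_abs, sq_abs, e]
  rw [e]
  exact (Function.hasTemperateGrowth_one_add_norm_sq_rpow ℝ (s / 2)).comp
    (((2 * Real.pi) • ContinuousLinearMap.id ℝ ℝ).hasTemperateGrowth)

/-- `IsBesselPotential s f g` says that `g = 𝓕⁻¹((1 + 4π²|ξ|²)^{s/2} 𝓕 f)` as tempered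
distributions, where `f` and `g` are functions defining tempered distributions. Since the symbol is
even, the transpose of the Fourier multiplier is the same Fourier multiplier on Schwartz functions,
which is how the operator acts on tempered distributions. -/
def IsBesselPotential (s : ℝ) (f g : ℝ → ℂ) : Prop :=
  ∀ ψ : 𝓢(ℝ, ℂ),
    ∫ x, f x * (SchwartzMap.fourierMultiplierCLM ℂ (besselSymbol s) ψ) x = ∫ x, g x * ψ x

/-- The Sobolev norm `‖f‖_{L^r_s(ℝ)} = ‖𝓕⁻¹((1 + 4π²|ξ|²)^{s/2} 𝓕 f)‖_{L^r(ℝ)}` of an integrable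
function `f`; it is `∞` when the distribution inside is not a function in `L^r`. (That function is
unique up to null sets, so the infimum is over at most one value.) -/
noncomputable def sobolevNorm (r : ℝ≥0∞) (s : ℝ) (f : ℝ → ℂ) : ℝ≥0∞ :=
  ⨅ (g : ℝ → ℂ) (_ : MemLp g r volume) (_ : IsBesselPotential s f g), eLpNorm g r volume

/-- The norm `‖m‖_{L^r_{s,sloc}} = sup_{R > 0} ‖φ(·) m(R ·)‖_{L^r_s(ℝ)}`. -/
noncomputable def slocNorm (φ : ℝ → ℂ) (r : ℝ≥0∞) (s : ℝ) (m : ℝ → ℂ) : ℝ≥0∞ :=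
  ⨆ (R : ℝ) (_ : 0 < R), sobolevNorm r s (fun x => φ x * m (R * x))

/-- Nonzero elements of `C_c^∞(0,∞)`. -/
structure IsSlocBump (φ : ℝ → ℂ) : Prop where
  smooth : ContDiff ℝ ∞ φ
  hasCompactSupport : HasCompactSupport φ
  tsupport_subset : tsupport φ ⊆ Ioi 0
  ne_zero : φ ≠ 0

/-- Continuous functions on `[0,∞)` that are supported away from `0` (extended by zero to the
negative half-line). -/
structure IsMultiplierAwayFromZero (m : ℝ → ℂ) : Prop where
  continuous : Continuous m
  eq_zero : ∃ ε > 0, ∀ x < ε, m x = 0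

/-! ### Spectral resolutions and spectral multipliers -/

section Spectral

variable {H : Type*} [NormedAddCommGroup H] [InnerProductSpace ℂ H] [CompleteSpace H]

/-- A resolution of the identity on `H`: a projection-valued measure on the Borel sets of `ℝ`,
countably additive in the strong operator topology. -/
structure ResolutionOfIdentity (H : Type*) [NormedAddCommGroup H] [InnerProductSpace ℂ H]
    [CompleteSpace H] where
  proj : Set ℝ → H →L[ℂ] H
  isStarProjection : ∀ B, MeasurableSet B → IsStarProjection (proj B)
  proj_univ : proj univ = 1
  proj_inter : ∀ A B, MeasurableSet A → MeasurableSet B → proj (A ∩ B) = proj A * proj B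
  hasSum_iUnion : ∀ B : ℕ → Set ℝ, (∀ i, MeasurableSet (B i)) →
    Pairwise (Function.onFun Disjoint B) → ∀ f : H, HasSum (fun i => proj (B i) f) (proj (⋃ i, B i) f)

namespace ResolutionOfIdentity

theorem proj_empty (E : ResolutionOfIdentity H) : E.proj ∅ = 0 := by
  ext f
  have h := E.hasSum_iUnion (fun _ => ∅) (fun _ => MeasurableSet.empty)
    (fun _ _ _ => disjoint_bot_left) f
  have h0 := tendsto_nhds_unique h.summable.tendsto_atTop_zero tendsto_const_nhds
  simpa using h0.symm

theorem re_inner_nonneg (E : ResolutionOfIdentity H) {B : Set ℝ} (hB : MeasurableSet B) (f : H) :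
    0 ≤ (⟪f, E.proj B f⟫_ℂ).re := by
  have hp := E.isStarProjection B hB
  have h1 : E.proj B f = E.proj B (E.proj B f) := by
    conv_lhs => rw [← hp.isIdempotentElem.eq]
    rfl
  have h2 : ⟪f, E.proj B f⟫_ℂ = ⟪E.proj B f, E.proj B f⟫_ℂ := by
    have h3 := ContinuousLinearMap.adjoint_inner_left (E.proj B) (E.proj B f) f
    rw [← ContinuousLinearMap.star_eq_adjoint, hp.isSelfAdjoint.star_eq, ← h1] at h3
    exact h3.symm
  rw [h2]
  exact inner_self_nonneg (𝕜 := ℂ)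

/-- The spectral measure `B ↦ ⟨E(B) f, f⟩` of a vector `f`. -/
noncomputable def spectralMeasure (E : ResolutionOfIdentity H) (f : H) : Measure ℝ :=
  Measure.ofMeasurable (fun B _ => ENNReal.ofReal (⟪f, E.proj B f⟫_ℂ).re)
    (by simp [E.proj_empty])
    (by
      intro B hB hd
      have h := E.hasSum_iUnion B hB hd f
      have h2 : HasSum (fun i => (⟪f, E.proj (B i) f⟫_ℂ).re) (⟪f, E.proj (⋃ i, B i) f⟫_ℂ).re :=
        Complex.reCLM.hasSum ((innerSL ℂ f).hasSum h)
      rw [← h2.tsum_eq]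
      exact ENNReal.ofReal_tsum_of_nonneg (fun i => E.re_inner_nonneg (hB i) f) h2.summable)

theorem spectralMeasure_apply (E : ResolutionOfIdentity H) (f : H) {B : Set ℝ}
    (hB : MeasurableSet B) :
    E.spectralMeasure f B = ENNReal.ofReal (⟪f, E.proj B f⟫_ℂ).re :=
  Measure.ofMeasurable_apply B hB

/-- `E` is the spectral resolution of the (unbounded) operator `L`, i.e. `L = ∫ λ dE(λ)`: the domain
of `L` consists of the `f` with `∫ λ² d⟨E(λ)f, f⟩ < ∞`, and `⟨Lf, f⟩ = ∫ λ d⟨E(λ)f, f⟩` there.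
(By polarization the quadratic form determines the operator.) -/
def IsResolutionOf (E : ResolutionOfIdentity H) (L : H →ₗ.[ℂ] H) : Prop :=
  (∀ f : H, f ∈ L.domain ↔ Integrable (fun x : ℝ => x ^ 2) (E.spectralMeasure f)) ∧
  ∀ f : L.domain, ⟪(f : H), L f⟫_ℂ = ((∫ x, x ∂(E.spectralMeasure (f : H)) : ℝ) : ℂ)

/-- `T` is the bounded operator `∫ m(λ) dE(λ)`. If `E` is the spectral resolution of `L`, this says
`T = m(L)`. -/
def IsIntegral (E : ResolutionOfIdentity H) (m : ℝ → ℂ) (T : H →L[ℂ] H) : Prop :=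
  ∀ f : H, Integrable m (E.spectralMeasure f) ∧ ⟪f, T f⟫_ℂ = ∫ x, m x ∂(E.spectralMeasure f)

end ResolutionOfIdentity

end Spectral

/-! ### `L^p` operator norms and multiplier estimates -/

section Multiplier

variable {X : Type*} [MeasurableSpace X]

/-- The norm `‖T‖_{L^p → L^p}` of an operator `T` on `L²`: the least `K` with
`‖Tf‖_p ≤ K ‖f‖_p` for all `f ∈ L² ∩ L^p` (`∞` if there is none). -/
noncomputable def lpOpNorm (μ : Measure X) (p : ℝ≥0∞) (T : Lp ℂ 2 μ →L[ℂ] Lp ℂ 2 μ) : ℝ≥0∞ :=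
  ⨅ (K : ℝ≥0) (_ : ∀ f : Lp ℂ 2 μ, MemLp f p μ → eLpNorm (T f) p μ ≤ K * eLpNorm f p μ), (K : ℝ≥0∞)

/-- For all `m` on `[0,∞)` supported away from `0` with `‖m‖_{L^r_{s,sloc}} < ∞`, the bounded
operator `m(L)` on `L²` exists and `‖m(L)‖_{L^p → L^p} ≤ C ‖m‖_{L^r_{s,sloc}}`.
Here `m(L) = ∫ m dE` for the spectral resolution `E` of `L`. -/
def MultiplierEstimate {μ : Measure X} (L : Lp ℂ 2 μ →ₗ.[ℂ] Lp ℂ 2 μ) (φ : ℝ → ℂ)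
    (p r : ℝ≥0∞) (s : ℝ) (C : ℝ≥0) : Prop :=
  ∀ m : ℝ → ℂ, IsMultiplierAwayFromZero m → slocNorm φ r s m < ⊤ →
    ∀ E : ResolutionOfIdentity (Lp ℂ 2 μ), E.IsResolutionOf L →
      ∃ T : Lp ℂ 2 μ →L[ℂ] Lp ℂ 2 μ, E.IsIntegral m T ∧ lpOpNorm μ p T ≤ C * slocNorm φ r s m

end Multiplier

/-! ### Maximally subelliptic operators on a compact manifold -/

section Subelliptic

variable {n : ℕ} {X : Type*} [TopologicalSpace X] [ChartedSpace (EuclideanSpace ℝ (Fin n)) X]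

/-- A smooth complex-valued function on `X`. -/
def IsSmoothFun (n : ℕ) {X : Type*} [TopologicalSpace X]
    [ChartedSpace (EuclideanSpace ℝ (Fin n)) X] (f : X → ℂ) : Prop :=
  ContMDiff 𝓘(ℝ, EuclideanSpace ℝ (Fin n)) 𝓘(ℝ, ℂ) ∞ f

/-- `μ` is given by a strictly positive smooth density: in each chart of the atlas it has a smooth
positive density with respect to Lebesgue measure. -/
def IsSmoothPositiveDensity (n : ℕ) {X : Type*} [TopologicalSpace X]
    [ChartedSpace (EuclideanSpace ℝ (Fin n)) X] [MeasurableSpace X] (μ : Measure X) : Prop :=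
  ∀ e ∈ atlas (EuclideanSpace ℝ (Fin n)) X, ∃ w : EuclideanSpace ℝ (Fin n) → ℝ,
    ContDiffOn ℝ ∞ w e.target ∧ (∀ y ∈ e.target, 0 < w y) ∧
    ∀ B ⊆ e.source, MeasurableSet B → μ B = ∫⁻ y in e '' B, ENNReal.ofReal (w y)

/-- A vector field on `X`. -/
abbrev VField (n : ℕ) (X : Type*) [TopologicalSpace X]
    [ChartedSpace (EuclideanSpace ℝ (Fin n)) X] : Type _ :=
  (x : X) → TangentSpace 𝓘(ℝ, EuclideanSpace ℝ (Fin n)) x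

/-- A smooth vector field: a smooth section of the tangent bundle. -/
def IsSmoothVField [IsManifold 𝓘(ℝ, EuclideanSpace ℝ (Fin n)) ∞ X] (V : VField n X) : Prop :=
  haveI : IsManifold 𝓘(ℝ, EuclideanSpace ℝ (Fin n)) 1 X := .of_le (n := ∞) (by simp)
  ContMDiff 𝓘(ℝ, EuclideanSpace ℝ (Fin n)) 𝓘(ℝ, EuclideanSpace ℝ (Fin n)).tangent ∞
    (fun x => (⟨x, V x⟩ : TangentBundle 𝓘(ℝ, EuclideanSpace ℝ (Fin n)) X))

/-- Iterated Lie brackets of the fields `W i`. Their linear span is the Lie algebra generated by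
the `W i`. -/
inductive IteratedBracket {ν : ℕ} (W : Fin ν → VField n X) : VField n X → Prop
  | of (i : Fin ν) : IteratedBracket W (W i)
  | bracket {V V' : VField n X} : IteratedBracket W V → IteratedBracket W V' →
      IteratedBracket W (VectorField.mlieBracket 𝓘(ℝ, EuclideanSpace ℝ (Fin n)) V V')

/-- Hörmander's condition: the Lie algebra generated by the `W i` spans every tangent space. -/
def HormanderCondition {ν : ℕ} (W : Fin ν → VField n X) : Prop :=
  ∀ x : X, Submodule.span ℝ {v | ∃ V : VField n X, IteratedBracket W V ∧ V x = v} = ⊤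

/-- The action `f ↦ V f` of a vector field on complex-valued functions. -/
noncomputable def VField.deriv (V : VField n X) (f : X → ℂ) : X → ℂ :=
  fun x => (mfderiv 𝓘(ℝ, EuclideanSpace ℝ (Fin n)) 𝓘(ℝ, ℂ) f x (V x) : ℂ)

/-- `W^α f = W_{α₁} ⋯ W_{α_M} f` for an ordered multi-index `α`. -/
noncomputable def multiDeriv {ν : ℕ} (W : Fin ν → VField n X) (α : List (Fin ν)) (f : X → ℂ) :
    X → ℂ :=
  α.foldr (fun i g => (W i).deriv g) f

/-- `deg α = d_{α₁} + ⋯ + d_{α_M}`. -/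
def multiDeg {ν : ℕ} (d : Fin ν → ℕ) (α : List (Fin ν)) : ℕ := (α.map d).sum

/-- The data of a differential operator `∑ b_{α,β} W^α W^β` over finitely many pairs of ordered
multi-indices. -/
structure OperatorData (ν : ℕ) (X : Type*) where
  pairs : Finset (List (Fin ν) × List (Fin ν))
  coeff : List (Fin ν) → List (Fin ν) → X → ℂ

/-- The differential operator `L₀ f = ∑ b_{α,β} W^α W^β f`. -/
noncomputable def OperatorData.apply {ν : ℕ} (A : OperatorData ν X) (W : Fin ν → VField n X)
    (f : X → ℂ) : X → ℂ :=
  fun x => ∑ q ∈ A.pairs, A.coeff q.1 q.2 x * multiDeriv W q.1 (multiDeriv W q.2 f) x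

/-- `L₀ = ∑_{deg α, deg β ≤ κ} b_{α,β} W^α W^β` has smooth coefficients and is symmetric,
non-negative, and maximally subelliptic on `C^∞(X) ⊆ L²(X, μ)`. -/
structure IsMaximallySubelliptic [MeasurableSpace X] (μ : Measure X) {ν : ℕ}
    (W : Fin ν → VField n X) (d : Fin ν → ℕ) (κ : ℕ) (A : OperatorData ν X) : Prop where
  deg_le : ∀ q ∈ A.pairs, multiDeg d q.1 ≤ κ ∧ multiDeg d q.2 ≤ κ
  smooth_coeff : ∀ q ∈ A.pairs, IsSmoothFun n (A.coeff q.1 q.2)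
  symmetric : ∀ f g : X → ℂ, IsSmoothFun n f → IsSmoothFun n g →
    ∫ x, A.apply W f x * star (g x) ∂μ = ∫ x, f x * star (A.apply W g x) ∂μ
  nonneg : ∀ f : X → ℂ, IsSmoothFun n f → 0 ≤ (∫ x, A.apply W f x * star (f x) ∂μ).re
  subelliptic : ∃ C : ℝ, ∀ f : X → ℂ, IsSmoothFun n f →
    ∑ i, ∫ x, ‖((W i).deriv)^[κ / d i] f x‖ ^ 2 ∂μ ≤
      C * ((∫ x, A.apply W f x * star (f x) ∂μ).re + ∫ x, ‖f x‖ ^ 2 ∂μ)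

/-- `L` is a non-negative self-adjoint extension to `L²(X, μ)` of the operator `L₀` given by `A`,
whose domain is `C^∞(X)`. -/
structure IsNonnegSelfAdjointExtension [MeasurableSpace X] {μ : Measure X} {ν : ℕ}
    (W : Fin ν → VField n X) (A : OperatorData ν X) (L : Lp ℂ 2 μ →ₗ.[ℂ] Lp ℂ 2 μ) : Prop where
  isSelfAdjoint : IsSelfAdjoint L
  nonneg : ∀ u : L.domain, 0 ≤ (⟪(u : Lp ℂ 2 μ), L u⟫_ℂ).re
  extends_op : ∀ f : X → ℂ, IsSmoothFun n f → ∀ u : Lp ℂ 2 μ, u =ᵐ[μ] f →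
    ∃ hu : u ∈ L.domain, L ⟨u, hu⟩ =ᵐ[μ] A.apply W f

end Subelliptic

section LpTools

/-- A form of Minkowski's integral inequality: a superposition, with weight `w`, of functions whose
`L^r` norms are at most `B` has `L^r` norm at most `(∫ w) B`. -/
theorem eLpNorm_le_lintegral_mul_of_enorm_le {α β E : Type*} [MeasurableSpace α]
    [MeasurableSpace β] [NormedAddCommGroup E] {μ : Measure α} [SFinite μ] {ν : Measure β}
    [SFinite ν] {r : ℝ≥0∞} (hr : 1 ≤ r) {G : α → E} {w : β → ℝ≥0∞} (hw : Measurable w)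
    (hw' : ∫⁻ y, w y ∂ν ≠ ⊤) {H : α → β → ℝ≥0∞} (hH : Measurable (Function.uncurry H))
    {B : ℝ≥0∞} (hB : ∀ y, eLpNorm (fun x => H x y) r μ ≤ B)
    (hG : ∀ᵐ x ∂μ, ‖G x‖ₑ ≤ ∫⁻ y, w y * H x y ∂ν) :
    eLpNorm G r μ ≤ (∫⁻ y, w y ∂ν) * B := by
  set ρ := ν.withDensity w with hρ
  have hρu : ρ univ = ∫⁻ y, w y ∂ν := by simp [hρ]
  have : IsFiniteMeasure ρ := ⟨by rw [hρu]; exact hw'.lt_top⟩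
  have hHx : ∀ x, Measurable (H x) := fun x => hH.comp measurable_prodMk_left
  have hG' : ∀ᵐ x ∂μ, ‖G x‖ₑ ≤ ∫⁻ y, H x y ∂ρ := by
    filter_upwards [hG] with x hx
    rwa [hρ, lintegral_withDensity_eq_lintegral_mul _ hw (hHx x)]
  rw [← hρu]
  rcases eq_or_ne r ⊤ with rfl | hrt
  · have h1 : ∀ᵐ y ∂ρ, ∀ᵐ x ∂μ, H x y ≤ B := by
      refine .of_forall fun y => ?_
      have := hB y
      rw [eLpNorm_exponent_top] at this
      filter_upwards [ae_le_eLpNormEssSup (f := fun x => H x y) (μ := μ)] with x hx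
      exact hx.trans this
    have h2 : ∀ᵐ x ∂μ, ∀ᵐ y ∂ρ, H x y ≤ B := by
      rw [← Measure.ae_prod_iff_ae_ae (p := fun z : β × α => H z.2 z.1 ≤ B)] at h1
      · have h4 := Measure.measurePreserving_swap (μ := μ) (ν := ρ) |>.quasiMeasurePreserving.ae h1
        exact Measure.ae_ae_of_ae_prod h4
      · exact measurableSet_le (hH.comp measurable_swap) measurable_const
    rw [eLpNorm_exponent_top]
    refine essSup_le_of_ae_le _ ?_
    filter_upwards [hG', h2] with x hx hx2
    refine hx.trans ((lintegral_mono_ae hx2).trans ?_)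
    simp [mul_comm]
  · have hr0 : r ≠ 0 := (zero_lt_one.trans_le hr).ne'
    have hrr : 1 ≤ r.toReal := by
      rw [← ENNReal.toReal_one]; exact ENNReal.toReal_mono hrt hr
    have hrp : 0 < r.toReal := by linarith
    have hBr : ∀ y, ∫⁻ x, H x y ^ r.toReal ∂μ ≤ B ^ r.toReal := by
      intro y
      have := hB y
      rw [eLpNorm_eq_lintegral_rpow_enorm_toReal hr0 hrt, one_div,
        ENNReal.rpow_inv_le_iff hrp] at this
      simpa using this
    rw [eLpNorm_eq_lintegral_rpow_enorm_toReal hr0 hrt, one_div, ENNReal.rpow_inv_le_iff hrp,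
      ENNReal.mul_rpow_of_nonneg _ _ hrp.le]
    have hJ : ∀ x, (∫⁻ y, H x y ∂ρ) ^ r.toReal ≤
        (∫⁻ y, H x y ^ r.toReal ∂ρ) * ρ univ ^ (r.toReal - 1) := by
      intro x
      have h := eLpNorm_le_eLpNorm_mul_rpow_measure_univ (μ := ρ) hr
        (hHx x).aestronglyMeasurable
      rw [eLpNorm_one_eq_lintegral_enorm, eLpNorm_eq_lintegral_rpow_enorm_toReal hr0 hrt] at h
      have h' := ENNReal.rpow_le_rpow h hrp.le
      rw [ENNReal.mul_rpow_of_nonneg _ _ hrp.le, ← ENNReal.rpow_mul, ← ENNReal.rpow_mul] at h'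
      have e1 : 1 / r.toReal * r.toReal = 1 := by field_simp
      have e2 : (1 / (1 : ℝ≥0∞).toReal - 1 / r.toReal) * r.toReal = r.toReal - 1 := by
        simp only [ENNReal.toReal_one]; field_simp
      rw [e1, e2, ENNReal.rpow_one] at h'
      simpa using h'
    calc ∫⁻ x, ‖G x‖ₑ ^ r.toReal ∂μ
        ≤ ∫⁻ x, (∫⁻ y, H x y ^ r.toReal ∂ρ) * ρ univ ^ (r.toReal - 1) ∂μ := by
          refine lintegral_mono_ae ?_
          filter_upwards [hG'] with x hx
          exact (ENNReal.rpow_le_rpow hx hrp.le).trans (hJ x)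
      _ = (∫⁻ x, ∫⁻ y, H x y ^ r.toReal ∂ρ ∂μ) * ρ univ ^ (r.toReal - 1) := by
          rw [lintegral_mul_const]
          exact (hH.pow_const _).lintegral_prod_right
      _ = (∫⁻ y, ∫⁻ x, H x y ^ r.toReal ∂μ ∂ρ) * ρ univ ^ (r.toReal - 1) := by
          rw [lintegral_lintegral_swap (hH.pow_const _).aemeasurable]
      _ ≤ (∫⁻ y, B ^ r.toReal ∂ρ) * ρ univ ^ (r.toReal - 1) := by
          gcongr with y
          exact hBr y
      _ = ρ univ ^ r.toReal * B ^ r.toReal := by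
          rw [lintegral_const, mul_assoc, mul_comm]
          congr 1
          have h1 : ρ univ = ρ univ ^ (1 : ℝ) := by simp
          nth_rw 1 [h1]
          rw [← ENNReal.rpow_add_of_nonneg _ _ zero_le_one (by linarith)]
          congr 1; ring

/-- Young's convolution inequality `L¹ * L^r ⊆ L^r`. -/
theorem eLpNorm_integral_mul_sub_le {r : ℝ≥0∞} (hr : 1 ≤ r) {k g : ℝ → ℂ} (hk : Measurable k)
    (hk' : Integrable k) (hg : Measurable g) :
    eLpNorm (fun x => ∫ y, k (x - y) * g y) r volume ≤ eLpNorm k 1 volume * eLpNorm g r volume := by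
  rw [eLpNorm_one_eq_lintegral_enorm]
  refine eLpNorm_le_lintegral_mul_of_enorm_le (ν := volume) hr (w := fun y => ‖k y‖ₑ)
    (H := fun x y => ‖g (x - y)‖ₑ) hk.enorm hk'.2.ne ?_ ?_ ?_
  · exact (hg.comp (measurable_fst.sub measurable_snd)).enorm
  · intro y
    rw [eLpNorm_enorm]
    exact (eLpNorm_comp_measurePreserving hg.aestronglyMeasurable
      (measurePreserving_sub_right volume y)).le
  · refine .of_forall fun x => ?_
    refine (enorm_integral_le_lintegral_enorm _).trans ?_
    rw [← lintegral_sub_left_eq_self _ x]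
    simp [enorm_mul]

theorem eLpNorm_le_one_of_norm_le_rpow {α : Type*} [MeasurableSpace α] {μ : Measure α}
    {q q₀ : ℝ≥0∞} (hq : q ≠ 0) (hq₀ : q₀ ≠ 0) {a : ℝ} (ha : 0 ≤ a)
    (h : q₀⁻¹ = ENNReal.ofReal a * q⁻¹) {f F : α → ℂ} (hf : eLpNorm f q μ ≤ 1)
    (hF : ∀ x, ‖F x‖ ≤ ‖f x‖ ^ a) :
    eLpNorm F q₀ μ ≤ 1 := by
  rcases eq_or_ne q₀ ⊤ with rfl | hq₀t
  · have hqa : q = ⊤ ∨ a = 0 := by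
      rw [ENNReal.inv_top, eq_comm, mul_eq_zero] at h
      rcases h with h | h
      · right; exact le_antisymm (ENNReal.ofReal_eq_zero.1 h) ha
      · left; simpa using h
    rw [eLpNorm_exponent_top]
    refine essSup_le_of_ae_le _ ?_
    rcases hqa with rfl | rfl
    · rw [eLpNorm_exponent_top] at hf
      filter_upwards [ae_le_eLpNormEssSup (f := f) (μ := μ)] with x hx
      have h1 : ‖f x‖ₑ ≤ 1 := hx.trans hf
      have h2 : ‖f x‖ ≤ 1 := by
        rw [← ofReal_norm, ENNReal.ofReal_le_one] at h1; exact h1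
      have h3 := (hF x).trans (Real.rpow_le_one (norm_nonneg _) h2 ha)
      change ‖F x‖ₑ ≤ 1
      rw [← ofReal_norm, ENNReal.ofReal_le_one]; exact h3
    · refine .of_forall fun x => ?_
      have h3 := hF x
      rw [Real.rpow_zero] at h3
      change ‖F x‖ₑ ≤ 1
      rw [← ofReal_norm, ENNReal.ofReal_le_one]; exact h3
  · have hqt : q ≠ ⊤ := by
      rintro rfl
      simp at h
      exact hq₀t h
    have hr : q₀.toReal⁻¹ = a * q.toReal⁻¹ := by
      have := congrArg ENNReal.toReal h
      rwa [ENNReal.toReal_mul, ENNReal.toReal_inv, ENNReal.toReal_inv, ENNReal.toReal_ofReal ha]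
        at this
    have hp : 0 < q.toReal := ENNReal.toReal_pos hq hqt
    have hp₀ : 0 < q₀.toReal := ENNReal.toReal_pos hq₀ hq₀t
    have haq : a * q₀.toReal = q.toReal := by
      field_simp at hr
      linarith
    rw [eLpNorm_eq_lintegral_rpow_enorm_toReal hq hqt, one_div, ENNReal.rpow_inv_le_iff hp,
      ENNReal.one_rpow] at hf
    rw [eLpNorm_eq_lintegral_rpow_enorm_toReal hq₀ hq₀t, one_div, ENNReal.rpow_inv_le_iff hp₀,
      ENNReal.one_rpow]
    refine le_trans (lintegral_mono fun x => ?_) hf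
    rw [← haq, ENNReal.rpow_mul]
    refine ENNReal.rpow_le_rpow ?_ hp₀.le
    rw [← ofReal_norm, ← ofReal_norm, ENNReal.ofReal_rpow_of_nonneg (norm_nonneg _) ha]
    exact ENNReal.ofReal_le_ofReal (hF x)

end LpTools

section LpDuality

variable {X : Type*} [MeasurableSpace X] {μ : Measure X}

/-- A function in `L²` whose pairings with `L² ∩ L^q` are bounded by `K ‖·‖_q` belongs to the dual
space `L^p`, with norm at most `K`. -/
theorem eLpNorm_le_of_forall_enorm_inner_le {p q : ℝ≥0∞} (hp : 1 < p) (hpt : p ≠ ⊤)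
    (hpq : p⁻¹ + q⁻¹ = 1) (F : Lp ℂ 2 μ) (K : ℝ≥0)
    (hF : ∀ (h : X → ℂ) (hh : MemLp h 2 μ), MemLp h q μ →
      ‖⟪hh.toLp h, F⟫_ℂ‖ₑ ≤ K * eLpNorm h q μ) :
    eLpNorm F p μ ≤ K := by
  have hp0 : p ≠ 0 := (zero_lt_one.trans hp).ne'
  have hp1 : 1 < p.toReal := by
    rw [← ENNReal.toReal_one]; exact (ENNReal.toReal_lt_toReal ENNReal.one_ne_top hpt).2 hp
  have hpp : 0 < p.toReal := by linarith
  have hq0 : q ≠ 0 := by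
    rintro rfl; simp at hpq
  have hqt : q ≠ ⊤ := by
    rintro rfl
    simp only [ENNReal.inv_top, add_zero, ENNReal.inv_eq_one] at hpq
    exact hp.ne' hpq
  have hqp : 0 < q.toReal := ENNReal.toReal_pos hq0 hqt
  have hpqr : p.toReal⁻¹ + q.toReal⁻¹ = 1 := by
    have := congrArg ENNReal.toReal hpq
    rwa [ENNReal.toReal_add (by simp [hp0]) (by simp [hq0]), ENNReal.toReal_inv,
      ENNReal.toReal_inv, ENNReal.toReal_one] at this
  have hpq' : (p.toReal - 1) * q.toReal = p.toReal := by
    field_simp at hpqr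
    linarith
  have hFm : Measurable (F : X → ℂ) := (Lp.stronglyMeasurable F).measurable
  set S : ℕ → Set X := fun n => {x | (1 / (n + 1 : ℝ)) ≤ ‖F x‖ ∧ ‖F x‖ ≤ n + 1} with hS
  have hSm : ∀ n, MeasurableSet (S n) := fun n =>
    (measurableSet_le measurable_const hFm.norm).inter
      (measurableSet_le hFm.norm measurable_const)
  have hSf : ∀ n, μ (S n) < ⊤ := by
    intro n
    have h1 := meas_ge_le_mul_pow_eLpNorm_enorm μ (p := 2) (by simp) (by simp)
      (Lp.aestronglyMeasurable F) (ε := ENNReal.ofReal (1 / (n + 1 : ℝ)))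
      (by simpa using by positivity) (by simp)
    refine lt_of_le_of_lt (measure_mono ?_) (h1.trans_lt ?_)
    · intro x hx
      have := ENNReal.ofReal_le_ofReal hx.1
      rwa [ofReal_norm] at this
    · refine ENNReal.mul_lt_top ?_ ?_
      · refine ENNReal.rpow_lt_top_of_nonneg (by simp) ?_
        simpa using by positivity
      · exact ENNReal.rpow_lt_top_of_nonneg (by simp) (Lp.eLpNorm_ne_top F)
  have key : ∀ n, ∫⁻ x in S n, ‖F x‖ₑ ^ p.toReal ∂μ ≤ (K : ℝ≥0∞) ^ p.toReal := by
    intro n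
    set h : X → ℂ := (S n).indicator fun x => F x * ((‖F x‖ ^ (p.toReal - 2) : ℝ) : ℂ) with hh
    have hhm : Measurable h := by
      refine Measurable.indicator (hFm.mul ?_) (hSm n)
      exact Complex.measurable_ofReal.comp (hFm.norm.pow_const _)
    have hhn : ∀ x ∈ S n, ‖h x‖ = ‖F x‖ ^ (p.toReal - 1) := by
      intro x hx
      have h0 : 0 < ‖F x‖ := lt_of_lt_of_le (by positivity) hx.1
      rw [hh, indicator_of_mem hx, norm_mul, Complex.norm_real,
        Real.norm_of_nonneg (Real.rpow_nonneg (norm_nonneg _) _)]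
      nth_rw 1 [← Real.rpow_one ‖F x‖]
      rw [← Real.rpow_add h0]
      congr 1; ring
    have hmem : ∀ r : ℝ≥0∞, MemLp h r μ := by
      intro r
      rw [hh, memLp_indicator_iff_restrict (hSm n)]
      have : IsFiniteMeasure (μ.restrict (S n)) := ⟨by simpa using hSf n⟩
      refine MemLp.of_bound (C := (n + 1 : ℝ) ^ (p.toReal - 1)) ?_ ?_
      · refine (hFm.mul ?_).aestronglyMeasurable
        exact Complex.measurable_ofReal.comp (hFm.norm.pow_const _)
      · filter_upwards [ae_restrict_mem (hSm n)] with x hx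
        have h2 := hhn x hx
        rw [hh, indicator_of_mem hx] at h2
        rw [h2]
        exact Real.rpow_le_rpow (norm_nonneg _) hx.2 (by linarith)
    set I : ℝ≥0∞ := ∫⁻ x in S n, ‖F x‖ₑ ^ p.toReal ∂μ with hI
    have hIeq : I = ∫⁻ x in S n, ENNReal.ofReal (‖F x‖ ^ p.toReal) ∂μ := by
      refine lintegral_congr fun x => ?_
      rw [← ofReal_norm, ENNReal.ofReal_rpow_of_nonneg (norm_nonneg _) hpp.le]
    have hIt : I ≠ ⊤ := by
      refine (lt_of_le_of_lt (setLIntegral_mono measurable_const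
        (g := fun _ => ENNReal.ofReal ((n + 1 : ℝ) ^ p.toReal)) ?_) ?_).ne
      · intro x hx
        rw [← ofReal_norm, ENNReal.ofReal_rpow_of_nonneg (norm_nonneg _) hpp.le]
        exact ENNReal.ofReal_le_ofReal (Real.rpow_le_rpow (norm_nonneg _) hx.2 hpp.le)
      · rw [setLIntegral_const]
        exact ENNReal.mul_lt_top (by simp) (hSf n)
    have hin : ‖⟪(hmem 2).toLp h, F⟫_ℂ‖ₑ = I := by
      have h1 : ⟪(hmem 2).toLp h, F⟫_ℂ = ((∫ x in S n, ‖F x‖ ^ p.toReal ∂μ : ℝ) : ℂ) := by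
        rw [L2.inner_def, ← integral_indicator (hSm n), ← integral_complex_ofReal]
        refine integral_congr_ae ?_
        filter_upwards [(hmem 2).coeFn_toLp] with x hx
        rw [hx]
        by_cases hxs : x ∈ S n
        · have h0 : 0 < ‖F x‖ := lt_of_lt_of_le (by positivity) hxs.1
          rw [hh, indicator_of_mem hxs, indicator_of_mem hxs, RCLike.inner_apply, map_mul,
            Complex.conj_ofReal, ← mul_assoc, RCLike.mul_conj]
          have e : ‖F x‖ ^ 2 * ‖F x‖ ^ (p.toReal - 2) = ‖F x‖ ^ p.toReal := by
            rw [← Real.rpow_natCast, ← Real.rpow_add h0]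
            congr 1; push_cast; ring
          rw [← e]
          push_cast
          rfl
        · rw [hh, indicator_of_notMem hxs, indicator_of_notMem hxs]
          simp
      rw [h1, ← ofReal_norm, Complex.norm_real, Real.norm_of_nonneg
        (integral_nonneg fun x => Real.rpow_nonneg (norm_nonneg _) _),
        integral_eq_lintegral_of_nonneg_ae
          (.of_forall fun x => Real.rpow_nonneg (norm_nonneg _) _)
          (hFm.norm.pow_const _).aestronglyMeasurable, ← hIeq, ENNReal.ofReal_toReal hIt]
    have hhq : eLpNorm h q μ = I ^ (q.toReal)⁻¹ := by
      rw [eLpNorm_eq_lintegral_rpow_enorm_toReal hq0 hqt, one_div, hI,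
        ← lintegral_indicator (hSm n)]
      congr 1
      refine lintegral_congr fun x => ?_
      by_cases hxs : x ∈ S n
      · rw [indicator_of_mem hxs, ← ofReal_norm, hhn x hxs, ← ofReal_norm,
          ENNReal.ofReal_rpow_of_nonneg (Real.rpow_nonneg (norm_nonneg _) _) hqp.le,
          ENNReal.ofReal_rpow_of_nonneg (norm_nonneg _) hpp.le, ← Real.rpow_mul (norm_nonneg _),
          hpq']
      · rw [indicator_of_notMem hxs, hh, indicator_of_notMem hxs]
        simp [hqp]
    have hfin := hF h (hmem 2) (hmem q)
    rw [hin, hhq] at hfin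
    rcases eq_or_ne I 0 with h0 | h0
    · rw [h0]; simp
    · have e : I = I ^ (p.toReal)⁻¹ * I ^ (q.toReal)⁻¹ := by
        rw [← ENNReal.rpow_add _ _ h0 hIt, hpqr, ENNReal.rpow_one]
      have h5 : I ^ (p.toReal)⁻¹ ≤ K := by
        have hq' : I ^ (q.toReal)⁻¹ ≠ 0 := by simp [ENNReal.rpow_eq_zero_iff, h0, hIt]
        have hq'' : I ^ (q.toReal)⁻¹ ≠ ⊤ :=
          ENNReal.rpow_ne_top_of_nonneg (by positivity) hIt
        exact (ENNReal.mul_le_mul_iff_left hq' hq'').1 (e.symm.trans_le hfin)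
      have := ENNReal.rpow_le_rpow h5 hpp.le
      rwa [← ENNReal.rpow_mul, inv_mul_cancel₀ hpp.ne', ENNReal.rpow_one] at this
  have hmono : Monotone S := by
    intro m n hmn x hx
    have hmn' : (m : ℝ) ≤ n := by exact_mod_cast hmn
    refine ⟨le_trans ?_ hx.1, hx.2.trans (by linarith)⟩
    exact one_div_le_one_div_of_le (by positivity) (by linarith)
  rw [eLpNorm_eq_lintegral_rpow_enorm_toReal hp0 hpt, one_div, ENNReal.rpow_inv_le_iff hpp]
  have hU : ∫⁻ x, ‖F x‖ₑ ^ p.toReal ∂μ = ∫⁻ x in ⋃ n, S n, ‖F x‖ₑ ^ p.toReal ∂μ := by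
    rw [← lintegral_indicator (MeasurableSet.iUnion hSm)]
    refine lintegral_congr fun x => ?_
    by_cases hx : x ∈ ⋃ n, S n
    · rw [indicator_of_mem hx]
    · rw [indicator_of_notMem hx]
      have : F x = 0 := by
        by_contra hne
        apply hx
        obtain ⟨n, hn⟩ := exists_nat_one_div_lt (norm_pos_iff.2 hne)
        obtain ⟨m, hm⟩ := exists_nat_ge ‖F x‖
        refine mem_iUnion.2 ⟨max m n, ⟨le_trans ?_ hn.le, hm.trans ?_⟩⟩
        · refine one_div_le_one_div_of_le (by positivity) ?_
          gcongr
          exact le_max_right _ _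
        · have : (m : ℝ) ≤ ((max m n : ℕ) : ℝ) := by exact_mod_cast le_max_left _ _
          linarith
      simp [this, hpp]
  rw [hU, setLIntegral_iUnion_of_directed _ hmono.directed_le]
  exact iSup_le key

/-- It suffices to test an `L^p` operator bound on pairs of simple functions. -/
theorem lpOpNorm_le_of_simpleFunc {p q : ℝ≥0∞} (hp : 1 < p) (hpt : p ≠ ⊤)
    (hpq : p⁻¹ + q⁻¹ = 1) (T : Lp ℂ 2 μ →L[ℂ] Lp ℂ 2 μ) (K : ℝ≥0)
    (hT : ∀ (h f : SimpleFunc X ℂ) (hh : MemLp h 2 μ) (hf : MemLp f 2 μ),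
      ‖⟪hh.toLp h, T (hf.toLp f)⟫_ℂ‖ₑ ≤ K * (eLpNorm h q μ * eLpNorm f p μ)) :
    lpOpNorm μ p T ≤ K := by
  have hq1 : 1 ≤ q := by
    rw [← ENNReal.inv_le_one, ← hpq]; exact le_add_self
  have hqt : q ≠ ⊤ := by
    rintro rfl
    simp only [ENNReal.inv_top, add_zero, ENNReal.inv_eq_one] at hpq
    exact hp.ne' hpq
  have happ : ∀ (r : ℝ≥0∞), 1 ≤ r → r ≠ ⊤ → ∀ f : X → ℂ, ∀ hf : MemLp f 2 μ, MemLp f r μ →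
      ∃ (u : ℕ → SimpleFunc X ℂ) (hu : ∀ n, MemLp (u n) 2 μ),
        Filter.Tendsto (fun n => (hu n).toLp (u n)) Filter.atTop (nhds (hf.toLp f)) ∧
        Filter.Tendsto (fun n => eLpNorm (u n) r μ) Filter.atTop (nhds (eLpNorm f r μ)) := by
    intro r hr hrt f hf hfr
    have hae : f =ᵐ[μ] hf.1.mk f := hf.1.ae_eq_mk
    have hm : Measurable (hf.1.mk f) := hf.1.stronglyMeasurable_mk.measurable
    have hf2 : MemLp (hf.1.mk f) 2 μ := hf.ae_eq hae
    have hfr' : MemLp (hf.1.mk f) r μ := hfr.ae_eq hae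
    refine ⟨SimpleFunc.approxOn _ hm (range (hf.1.mk f) ∪ {0}) 0 (by simp),
      SimpleFunc.memLp_approxOn_range hm hf2, ?_, ?_⟩
    · have := SimpleFunc.tendsto_approxOn_range_Lp (by simp) hm hf2
      rwa [MemLp.toLp_congr hf hf2 hae]
    · have : Fact (1 ≤ r) := ⟨hr⟩
      have h1 := SimpleFunc.tendsto_approxOn_range_Lp hrt hm hfr'
      have h2 := (continuous_enorm.tendsto _).comp h1
      simp only [Function.comp_def, Lp.enorm_toLp] at h2
      exact (eLpNorm_congr_ae (p := r) hae).symm ▸ h2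
  have hle : ∀ f : Lp ℂ 2 μ, MemLp f p μ → eLpNorm (T f) p μ ≤ K * eLpNorm f p μ := by
    intro f hf
    lift eLpNorm f p μ to ℝ≥0 using hf.2.ne with N hN
    rw [← ENNReal.coe_mul]
    refine eLpNorm_le_of_forall_enorm_inner_le hp hpt hpq (T f) _ fun h hh hhq => ?_
    obtain ⟨u, hu, hu1, hu2⟩ := happ p hp.le hpt f (Lp.memLp f) hf
    obtain ⟨v, hv, hv1, hv2⟩ := happ q hq1 hqt h hh hhq
    rw [Lp.toLp_coeFn] at hu1
    have h1 : Filter.Tendsto (fun n => ‖⟪(hv n).toLp (v n), T ((hu n).toLp (u n))⟫_ℂ‖ₑ)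
        Filter.atTop (nhds ‖⟪hh.toLp h, T f⟫_ℂ‖ₑ) :=
      (hv1.inner ((T.continuous.tendsto _).comp hu1)).enorm
    have h2 : Filter.Tendsto (fun n => (K : ℝ≥0∞) * (eLpNorm (v n) q μ * eLpNorm (u n) p μ))
        Filter.atTop (nhds (K * (eLpNorm h q μ * eLpNorm f p μ))) := by
      refine ENNReal.Tendsto.const_mul (ENNReal.Tendsto.mul hv2 (.inr ?_) hu2 (.inr ?_)) ?_
      · exact hf.2.ne
      · exact hhq.2.ne
      · exact .inr ENNReal.coe_ne_top
    have h3 := le_of_tendsto_of_tendsto' h1 h2 fun n => hT _ _ _ _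
    rw [← hN] at h3
    refine h3.trans (le_of_eq ?_)
    push_cast
    ring
  exact iInf₂_le K hle

end LpDuality

namespace ResolutionOfIdentity

variable {H : Type*} [NormedAddCommGroup H] [InnerProductSpace ℂ H] [CompleteSpace H]

theorem spectralMeasure_univ (E : ResolutionOfIdentity H) (f : H) :
    E.spectralMeasure f univ = ENNReal.ofReal (‖f‖ ^ 2) := by
  rw [spectralMeasure_apply _ _ MeasurableSet.univ, E.proj_univ]
  congr 1
  exact inner_self_eq_norm_sq (𝕜 := ℂ) f

instance isFiniteMeasure_spectralMeasure (E : ResolutionOfIdentity H) (f : H) :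
    IsFiniteMeasure (E.spectralMeasure f) :=
  ⟨by rw [spectralMeasure_univ]; exact ENNReal.ofReal_lt_top⟩

theorem inner_proj_self (E : ResolutionOfIdentity H) (f : H) {B : Set ℝ} (hB : MeasurableSet B) :
    ⟪f, E.proj B f⟫_ℂ = ((E.spectralMeasure f).real B : ℂ) := by
  rw [Measure.real, spectralMeasure_apply _ _ hB, ENNReal.toReal_ofReal (E.re_inner_nonneg hB f)]
  refine Complex.ext rfl ?_
  rw [Complex.ofReal_im]
  have h1 : (starRingEnd ℂ) ⟪f, E.proj B f⟫_ℂ = ⟪f, E.proj B f⟫_ℂ := by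
    rw [inner_conj_symm]
    have h3 := ContinuousLinearMap.adjoint_inner_left (E.proj B) f f
    rwa [← ContinuousLinearMap.star_eq_adjoint,
      (E.isStarProjection B hB).isSelfAdjoint.star_eq] at h3
  exact Complex.conj_eq_iff_im.1 h1

theorem isIntegral_simpleFunc (E : ResolutionOfIdentity H) (m : SimpleFunc ℝ ℂ) :
    E.IsIntegral m (∑ c ∈ m.range, c • E.proj (m ⁻¹' {c})) := by
  intro f
  have hi : Integrable m (E.spectralMeasure f) := m.integrable_of_isFiniteMeasure
  refine ⟨hi, ?_⟩
  rw [SimpleFunc.integral_eq_sum m hi, _root_.sum_apply, inner_sum]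
  refine Finset.sum_congr rfl fun c _ => ?_
  rw [_root_.smul_apply, inner_smul_right, E.inner_proj_self f (m.measurableSet_fiber c),
    Complex.real_smul, mul_comm]

/-- The integral of `m` against the complex spectral measure `⟨h, E f⟩`, written by polarization
in terms of the spectral measures of vectors. -/
noncomputable def crossIntegral (E : ResolutionOfIdentity H) (m : ℝ → ℂ) (h f : H) : ℂ :=
  (∫ x, m x ∂(E.spectralMeasure (h + f)) - ∫ x, m x ∂(E.spectralMeasure (h - f))
    - Complex.I * ∫ x, m x ∂(E.spectralMeasure (h + Complex.I • f))
    + Complex.I * ∫ x, m x ∂(E.spectralMeasure (h - Complex.I • f))) / 4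

theorem IsIntegral.inner_eq {E : ResolutionOfIdentity H} {m : ℝ → ℂ} {T : H →L[ℂ] H}
    (hT : E.IsIntegral m T) (h f : H) : ⟪h, T f⟫_ℂ = E.crossIntegral m h f := by
  have := inner_map_polarization (T : H →ₗ[ℂ] H) h f
  rw [← inner_conj_symm]
  simp only [ContinuousLinearMap.coe_coe] at this
  rw [this, crossIntegral, ← (hT _).2, ← (hT _).2, ← (hT _).2, ← (hT _).2,
    ← inner_conj_symm _ (T (h + f)), ← inner_conj_symm _ (T (h - f)),
    ← inner_conj_symm _ (T (h + Complex.I • f)), ← inner_conj_symm _ (T (h - Complex.I • f))]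
  simp only [map_div₀, map_add, map_sub, map_mul, Complex.conj_I, map_ofNat]
  ring

theorem norm_crossIntegral_le (E : ResolutionOfIdentity H) {m : ℝ → ℂ} {B : ℝ}
    (hm : ∀ x, ‖m x‖ ≤ B) (h f : H) : ‖E.crossIntegral m h f‖ ≤ B * (‖h‖ ^ 2 + ‖f‖ ^ 2) := by
  have key : ∀ v : H, ‖∫ x, m x ∂(E.spectralMeasure v)‖ ≤ B * ‖v‖ ^ 2 := by
    intro v
    refine (norm_integral_le_of_norm_le_const (.of_forall hm)).trans (le_of_eq ?_)
    rw [Measure.real, spectralMeasure_univ, ENNReal.toReal_ofReal (by positivity)]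
  have p1 := parallelogram_law_with_norm ℂ h f
  have p2 := parallelogram_law_with_norm ℂ h (Complex.I • f)
  rw [norm_smul, Complex.norm_I, one_mul] at p2
  rw [crossIntegral, norm_div]
  have h4 : ‖(4 : ℂ)‖ = 4 := by simp
  rw [h4, div_le_iff₀ (by norm_num)]
  refine (norm_add_le _ _).trans ?_
  refine (add_le_add ((norm_sub_le _ _).trans (add_le_add (norm_sub_le _ _) le_rfl)) le_rfl).trans ?_
  rw [norm_mul, norm_mul, Complex.norm_I, one_mul, one_mul]
  have k1 := key (h + f)
  have k2 := key (h - f)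
  have k3 := key (h + Complex.I • f)
  have k4 := key (h - Complex.I • f)
  have e : B * (‖h‖ ^ 2 + ‖f‖ ^ 2) * 4 = B * ‖h + f‖ ^ 2 + B * ‖h - f‖ ^ 2 +
      B * ‖h + Complex.I • f‖ ^ 2 + B * ‖h - Complex.I • f‖ ^ 2 := by
    linear_combination (-B) * p1 + (-B) * p2
  rw [e]
  linarith

theorem tendsto_crossIntegral (E : ResolutionOfIdentity H) {m : ℕ → ℝ → ℂ} {m' : ℝ → ℂ} {B : ℝ}
    (hm : ∀ n, Measurable (m n)) (hB : ∀ n x, ‖m n x‖ ≤ B)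
    (hlim : ∀ x, Filter.Tendsto (fun n => m n x) Filter.atTop (nhds (m' x))) (h f : H) :
    Filter.Tendsto (fun n => E.crossIntegral (m n) h f) Filter.atTop
      (nhds (E.crossIntegral m' h f)) := by
  have key : ∀ v : H, Filter.Tendsto (fun n => ∫ x, m n x ∂(E.spectralMeasure v)) Filter.atTop
      (nhds (∫ x, m' x ∂(E.spectralMeasure v))) := fun v =>
    tendsto_integral_of_dominated_convergence (fun _ => B)
      (fun n => (hm n).aestronglyMeasurable) (integrable_const _)
      (fun n => .of_forall (hB n)) (.of_forall hlim)
  exact ((((key _).sub (key _)).sub ((key _).const_mul _)).add ((key _).const_mul _)).div_const _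

theorem crossIntegral_sum (E : ResolutionOfIdentity H) {ι : Type*} (s : Finset ι) (c : ι → ℂ)
    {m : ι → ℝ → ℂ} (hm : ∀ i ∈ s, Measurable (m i)) (hB : ∀ i ∈ s, ∃ B, ∀ x, ‖m i x‖ ≤ B)
    (h f : H) :
    E.crossIntegral (fun x => ∑ i ∈ s, c i * m i x) h f = ∑ i ∈ s, c i * E.crossIntegral (m i) h f := by
  have key : ∀ v : H, ∫ x, ∑ i ∈ s, c i * m i x ∂(E.spectralMeasure v) =
      ∑ i ∈ s, c i * ∫ x, m i x ∂(E.spectralMeasure v) := by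
    intro v
    rw [integral_finsetSum]
    · exact Finset.sum_congr rfl fun i _ => integral_const_mul _ _
    · intro i hi
      obtain ⟨B, hB⟩ := hB i hi
      exact (Integrable.of_bound (hm i hi).aestronglyMeasurable B (.of_forall hB)).const_mul _
  simp only [crossIntegral, key, Finset.mul_sum, ← Finset.sum_sub_distrib, ← Finset.sum_add_distrib,
    Finset.sum_div]
  refine Finset.sum_congr rfl fun i _ => ?_
  ring

/-- The integral of a superposition of bounded functions. -/
theorem crossIntegral_integral (E : ResolutionOfIdentity H) {β : Type*} [MeasurableSpace β]
    {ν : Measure β} [SFinite ν] {M : β → ℝ → ℂ} (hM : Measurable (Function.uncurry M)) {b : β → ℝ}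
    (hb : Integrable b ν) (hMb : ∀ t x, ‖M t x‖ ≤ b t) (h f : H) :
    E.crossIntegral (fun x => ∫ t, M t x ∂ν) h f = ∫ t, E.crossIntegral (M t) h f ∂ν := by
  have hint : ∀ v : H, Integrable (Function.uncurry M) (ν.prod (E.spectralMeasure v)) := by
    intro v
    have h1 : Integrable (fun z : β × ℝ => b z.1) (ν.prod (E.spectralMeasure v)) :=
      hb.comp_fst _
    exact h1.mono' hM.aestronglyMeasurable (.of_forall fun z => hMb z.1 z.2)
  have key : ∀ v : H, ∫ x, ∫ t, M t x ∂ν ∂(E.spectralMeasure v) =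
      ∫ t, ∫ x, M t x ∂(E.spectralMeasure v) ∂ν := fun v => (integral_integral_swap (hint v)).symm
  have hi : ∀ v : H, Integrable (fun t => ∫ x, M t x ∂(E.spectralMeasure v)) ν :=
    fun v => (hint v).integral_prod_left
  simp only [crossIntegral, key]
  rw [integral_div, integral_add, integral_sub, integral_sub, integral_const_mul,
    integral_const_mul]
  · exact hi _
  · exact hi _
  · exact (hi _).sub (hi _)
  · exact (hi _).const_mul _
  · exact ((hi _).sub (hi _)).sub ((hi _).const_mul _)
  · exact (hi _).const_mul _

theorem exists_isIntegral_of_tendsto (E : ResolutionOfIdentity H) {m : ℕ → ℝ → ℂ} {m' : ℝ → ℂ}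
    {B : ℝ} (hm : ∀ n, Measurable (m n)) (hB : ∀ n x, ‖m n x‖ ≤ B)
    (hlim : ∀ x, Filter.Tendsto (fun n => m n x) Filter.atTop (nhds (m' x)))
    {T : ℕ → H →L[ℂ] H} (hT : ∀ n, E.IsIntegral (m n) (T n)) :
    ∃ T' : H →L[ℂ] H, E.IsIntegral m' T' := by
  have hB' : ∀ x, ‖m' x‖ ≤ B := fun x => le_of_tendsto (hlim x).norm (.of_forall fun n => hB n x)
  have hm' : Measurable m' := measurable_of_tendsto_metrizable hm (tendsto_pi_nhds.2 hlim)
  have hB0 : 0 ≤ B := (norm_nonneg _).trans (hB' 0)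
  set ℓ : H → H → ℂ := E.crossIntegral m' with hℓ
  have hlimT : ∀ h f, Filter.Tendsto (fun n => ⟪h, T n f⟫_ℂ) Filter.atTop (nhds (ℓ h f)) := by
    intro h f
    simp only [fun n => (hT n).inner_eq]
    exact E.tendsto_crossIntegral hm hB hlim h f
  have hadd1 : ∀ h h' f, ℓ (h + h') f = ℓ h f + ℓ h' f := fun h h' f =>
    tendsto_nhds_unique (hlimT _ _) (by simpa only [inner_add_left] using (hlimT h f).add (hlimT h' f))
  have hadd2 : ∀ h f f', ℓ h (f + f') = ℓ h f + ℓ h f' := fun h f f' =>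
    tendsto_nhds_unique (hlimT _ _)
      (by simpa only [map_add, inner_add_right] using (hlimT h f).add (hlimT h f'))
  have hsm1 : ∀ (c : ℂ) h f, ℓ (c • h) f = starRingEnd ℂ c • ℓ h f := fun c h f =>
    tendsto_nhds_unique (hlimT _ _)
      (by simpa only [inner_smul_left, smul_eq_mul] using (hlimT h f).const_mul (starRingEnd ℂ c))
  have hsm2 : ∀ (c : ℂ) h f, ℓ h (c • f) = c • ℓ h f := fun c h f =>
    tendsto_nhds_unique (hlimT _ _)
      (by simpa only [map_smul, inner_smul_right, smul_eq_mul] using (hlimT h f).const_mul c)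
  have hbd : ∀ h f, ‖ℓ h f‖ ≤ 2 * B * ‖h‖ * ‖f‖ := by
    intro h f
    rcases eq_or_ne h 0 with rfl | hh
    · have : ℓ 0 f = 0 := by simpa using hsm1 0 0 f
      simp [this]
    rcases eq_or_ne f 0 with rfl | hf
    · have : ℓ h 0 = 0 := by simpa using hsm2 0 h 0
      simp [this]
    have hh' : 0 < ‖h‖ := norm_pos_iff.2 hh
    have hf' : 0 < ‖f‖ := norm_pos_iff.2 hf
    have h1 := E.norm_crossIntegral_le hB' (((‖f‖ / ‖h‖ : ℝ) : ℂ) • h) f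
    rw [← hℓ, hsm1, norm_smul, norm_smul, RCLike.norm_conj, Complex.norm_real,
      Real.norm_of_nonneg (by positivity), div_mul_cancel₀ _ hh'.ne'] at h1
    have h2 : ‖ℓ h f‖ = ‖h‖ / ‖f‖ * (‖f‖ / ‖h‖ * ‖ℓ h f‖) := by field_simp
    rw [h2]
    calc ‖h‖ / ‖f‖ * (‖f‖ / ‖h‖ * ‖ℓ h f‖) ≤ ‖h‖ / ‖f‖ * (B * (‖f‖ ^ 2 + ‖f‖ ^ 2)) := by gcongr
      _ = 2 * B * ‖h‖ * ‖f‖ := by field_simp; ring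
  let Λ : H →L⋆[ℂ] H →L[ℂ] ℂ := LinearMap.mkContinuous₂
    (LinearMap.mk₂'ₛₗ (starRingEnd ℂ) (RingHom.id ℂ) ℓ hadd1 hsm1 hadd2 hsm2) (2 * B) hbd
  refine ⟨ContinuousLinearMap.adjoint (InnerProductSpace.continuousLinearMapOfBilin Λ), fun f =>
    ⟨Integrable.of_bound hm'.aestronglyMeasurable B (.of_forall hB'), ?_⟩⟩
  rw [ContinuousLinearMap.adjoint_inner_right, InnerProductSpace.continuousLinearMapOfBilin_apply]
  refine tendsto_nhds_unique (hlimT f f) ?_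
  simp only [fun n => (hT n f).2]
  exact tendsto_integral_of_dominated_convergence (fun _ => B)
      (fun n => (hm n).aestronglyMeasurable) (integrable_const _)
      (fun n => .of_forall (hB n)) (.of_forall hlim)

/-- Bounded Borel functional calculus. -/
theorem exists_isIntegral (E : ResolutionOfIdentity H) {m : ℝ → ℂ} (hm : Measurable m) {B : ℝ}
    (hB : ∀ x, ‖m x‖ ≤ B) : ∃ T : H →L[ℂ] H, E.IsIntegral m T := by
  have hB0 : 0 ≤ B := (norm_nonneg _).trans (hB 0)
  exact E.exists_isIntegral_of_tendsto
    (fun n => (hm.stronglyMeasurable.approxBounded B n).measurable)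
    (fun n x => hm.stronglyMeasurable.norm_approxBounded_le hB0 n x)
    (fun x => hm.stronglyMeasurable.tendsto_approxBounded_of_norm_le (hB x))
    (fun n => E.isIntegral_simpleFunc _)

end ResolutionOfIdentity

section HeatKernel

open Polynomial in
theorem exists_norm_pow_mul_eval_mul_cexp_le (P : ℂ[X]) (k : ℕ) :
    ∃ C : ℝ, ∀ x : ℝ, ‖x‖ ^ k * ‖P.eval (x : ℂ) * Complex.exp (-(x : ℂ) ^ 2)‖ ≤ C := by
  have hmono : ∀ j : ℕ, ∃ C : ℝ, ∀ x : ℝ, |x| ^ j * Real.exp (-x ^ 2) ≤ C := by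
    intro j
    refine ⟨1 + j.factorial, fun x => ?_⟩
    have h1 : (x ^ 2) ^ j / j.factorial ≤ Real.exp (x ^ 2) :=
      Real.pow_div_factorial_le_exp _ (sq_nonneg x) j
    have h2 : |x| ^ j ≤ 1 + (x ^ 2) ^ j := by
      rw [← sq_abs x, ← pow_mul, mul_comm, pow_mul]
      nlinarith [sq_nonneg (|x| ^ j - 1), pow_nonneg (abs_nonneg x) j]
    have h3 : (1 : ℝ) ≤ Real.exp (x ^ 2) := Real.one_le_exp (sq_nonneg x)
    rw [Real.exp_neg, ← div_eq_mul_inv, div_le_iff₀ (Real.exp_pos _)]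
    rw [div_le_iff₀ (by positivity)] at h1
    nlinarith
  induction P using Polynomial.induction_on' with
  | add p q hp hq =>
    obtain ⟨C, hC⟩ := hp
    obtain ⟨D, hD⟩ := hq
    refine ⟨C + D, fun x => ?_⟩
    rw [eval_add, add_mul]
    calc _ ≤ ‖x‖ ^ k * (_ + _) := by gcongr; exact norm_add_le _ _
      _ ≤ C + D := by rw [mul_add]; exact add_le_add (hC x) (hD x)
  | monomial n a =>
    obtain ⟨C, hC⟩ := hmono (k + n)
    refine ⟨‖a‖ * C, fun x => ?_⟩
    have e : ‖Complex.exp (-(x : ℂ) ^ 2)‖ = Real.exp (-x ^ 2) := by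
      rw [Complex.norm_exp]; congr 1; norm_cast
    rw [eval_monomial, norm_mul, norm_mul, norm_pow, e, Complex.norm_real, Real.norm_eq_abs]
    calc |x| ^ k * (‖a‖ * |x| ^ n * Real.exp (-x ^ 2))
        = ‖a‖ * (|x| ^ (k + n) * Real.exp (-x ^ 2)) := by rw [pow_add]; ring
      _ ≤ _ := by gcongr; exact hC x

open Polynomial in
theorem iteratedDeriv_cexp_neg_sq (n : ℕ) : ∃ P : ℂ[X], iteratedDeriv n
    (fun x : ℝ => Complex.exp (-(x : ℂ) ^ 2)) =
      fun x : ℝ => P.eval (x : ℂ) * Complex.exp (-(x : ℂ) ^ 2) := by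
  induction n with
  | zero => exact ⟨1, by simp⟩
  | succ n ih =>
    obtain ⟨P, hP⟩ := ih
    refine ⟨derivative P - 2 * X * P, ?_⟩
    rw [iteratedDeriv_succ, hP]
    funext x
    have h1 : HasDerivAt (fun z : ℂ => P.eval z * Complex.exp (-z ^ 2))
        ((derivative P).eval (x : ℂ) * Complex.exp (-(x : ℂ) ^ 2) +
          P.eval (x : ℂ) * (Complex.exp (-(x : ℂ) ^ 2) * -(2 * (x : ℂ)))) x := by
      refine (P.hasDerivAt _).mul ?_
      have := ((hasDerivAt_pow 2 (x : ℂ)).neg).cexp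
      simpa using this
    rw [h1.comp_ofReal.deriv]
    simp only [eval_sub, eval_mul, eval_X, eval_ofNat]
    ring

/-- The Gaussian `exp (-x²)` as a Schwartz function. -/
noncomputable def gaussianSchwartz : 𝓢(ℝ, ℂ) where
  toFun x := Complex.exp (-(x : ℂ) ^ 2)
  smooth' := ((Complex.ofRealCLM.contDiff.pow 2).neg).cexp
  decay' k n := by
    obtain ⟨P, hP⟩ := iteratedDeriv_cexp_neg_sq n
    obtain ⟨C, hC⟩ := exists_norm_pow_mul_eval_mul_cexp_le P k
    refine ⟨C, fun x => ?_⟩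
    rw [norm_iteratedFDeriv_eq_norm_iteratedDeriv, hP]
    exact hC x

theorem gaussianSchwartz_apply (x : ℝ) : gaussianSchwartz x = Complex.exp (-(x : ℂ) ^ 2) := rfl

/-- Dilation `x ↦ f (a x)` of a Schwartz function by a factor `a ≠ 0`. -/
noncomputable def SchwartzMap.dilate (a : ℝ) (ha : a ≠ 0) (f : 𝓢(ℝ, ℂ)) : 𝓢(ℝ, ℂ) :=
  SchwartzMap.compCLMOfContinuousLinearEquiv ℂ (ContinuousLinearEquiv.smulLeft (Units.mk0 a ha)) f

theorem SchwartzMap.dilate_apply (a : ℝ) (ha : a ≠ 0) (f : 𝓢(ℝ, ℂ)) (x : ℝ) :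
    f.dilate a ha x = f (a * x) := rfl

/-- The convolution kernel of `exp (-t (1 - d²/dx²))`, for `t > 0`. -/
noncomputable def heatKernel (t : ℝ) : 𝓢(ℝ, ℂ) :=
  if h : 0 < t then
    ((Real.exp (-t) / Real.sqrt (4 * Real.pi * t) : ℝ) : ℂ) •
      gaussianSchwartz.dilate (1 / (2 * Real.sqrt t)) (by positivity)
  else 0

theorem heatKernel_apply {t : ℝ} (ht : 0 < t) (x : ℝ) :
    heatKernel t x = ((Real.exp (-t) / Real.sqrt (4 * Real.pi * t) *
      Real.exp (-x ^ 2 / (4 * t)) : ℝ) : ℂ) := by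
  rw [heatKernel, dif_pos ht, _root_.smul_apply, SchwartzMap.dilate_apply, gaussianSchwartz_apply,
    smul_eq_mul]
  push_cast
  congr 2
  have : ((Real.sqrt t : ℝ) : ℂ) ^ 2 = t := by exact_mod_cast Real.sq_sqrt ht.le
  rw [mul_pow, div_pow, mul_pow, this]
  ring

theorem measurable_heatKernel : Measurable (fun z : ℝ × ℝ => heatKernel z.1 z.2) := by
  have e : (fun z : ℝ × ℝ => heatKernel z.1 z.2) = fun z =>
      if 0 < z.1 then ((Real.exp (-z.1) / Real.sqrt (4 * Real.pi * z.1) *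
      Real.exp (-z.2 ^ 2 / (4 * z.1)) : ℝ) : ℂ) else 0 := by
    funext z
    split_ifs with h
    · exact heatKernel_apply h _
    · rw [heatKernel, dif_neg h]; rfl
  rw [e]
  refine Measurable.ite (measurableSet_lt measurable_const measurable_fst) ?_ measurable_const
  fun_prop

theorem heatKernel_neg (t x : ℝ) : heatKernel t (-x) = heatKernel t x := by
  rcases lt_or_ge 0 t with ht | ht
  · rw [heatKernel_apply ht, heatKernel_apply ht, neg_sq]
  · rw [heatKernel, dif_neg ht.not_gt]; rfl

open FourierTransform in
theorem fourier_heatKernel {t : ℝ} (ht : 0 < t) (ξ : ℝ) :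
    𝓕 (heatKernel t) ξ = ((Real.exp (-t * (1 + 4 * Real.pi ^ 2 * ξ ^ 2)) : ℝ) : ℂ) := by
  rw [SchwartzMap.fourier_coe]
  set b : ℂ := ((1 / (4 * Real.pi * t) : ℝ) : ℂ) with hb
  have hb0 : 0 < 1 / (4 * Real.pi * t) := by positivity
  have h1 : (heatKernel t : ℝ → ℂ) = ((Real.exp (-t) / Real.sqrt (4 * Real.pi * t) : ℝ) : ℂ) •
      fun x : ℝ => Complex.exp (-Real.pi * b * x ^ 2) := by
    funext x
    rw [heatKernel_apply ht, Pi.smul_apply, smul_eq_mul, Complex.ofReal_mul, Complex.ofReal_exp (-x ^ 2 / (4 * t))]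
    congr 2
    rw [hb]; push_cast
    have : (Real.pi : ℂ) ≠ 0 := by exact_mod_cast Real.pi_ne_zero
    have : (t : ℂ) ≠ 0 := by exact_mod_cast ht.ne'
    field_simp
  have h2 := fourier_gaussian_pi (b := b) (by rw [hb, Complex.ofReal_re]; exact hb0)
  have h0 : 𝓕 (((Real.exp (-t) / Real.sqrt (4 * Real.pi * t) : ℝ) : ℂ) •
      fun x : ℝ => Complex.exp (-Real.pi * b * x ^ 2)) =
      ((Real.exp (-t) / Real.sqrt (4 * Real.pi * t) : ℝ) : ℂ) •
        𝓕 (fun x : ℝ => Complex.exp (-Real.pi * b * x ^ 2)) :=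
    VectorFourier.fourierIntegral_const_smul _ _ _ _ _
  rw [h1, h0, Pi.smul_apply, h2, smul_eq_mul]
  beta_reduce
  have h3 : b ^ (1 / 2 : ℂ) = ((Real.sqrt (4 * Real.pi * t))⁻¹ : ℝ) := by
    have : (1 / 2 : ℂ) = ((1 / 2 : ℝ) : ℂ) := by push_cast; rfl
    rw [hb, this, ← Complex.ofReal_cpow hb0.le, ← Real.sqrt_eq_rpow, one_div, Real.sqrt_inv]
  have h4 : -(Real.pi : ℂ) / b * ξ ^ 2 = ((-t * (4 * Real.pi ^ 2 * ξ ^ 2) : ℝ) : ℂ) := by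
    rw [hb]; push_cast
    have : (Real.pi : ℂ) ≠ 0 := by exact_mod_cast Real.pi_ne_zero
    have : (t : ℂ) ≠ 0 := by exact_mod_cast ht.ne'
    field_simp
  rw [h3, h4, ← Complex.ofReal_exp, mul_add, mul_one, Real.exp_add]
  have : Real.sqrt (4 * Real.pi * t) ≠ 0 := (Real.sqrt_pos.2 (by positivity)).ne'
  rw [← Complex.ofReal_one, ← Complex.ofReal_div, ← Complex.ofReal_mul, ← Complex.ofReal_mul]
  congr 1
  field_simp

/-- The iterated derivative of a Schwartz function, as a Schwartz function. -/
noncomputable def SchwartzMap.iterDeriv (n : ℕ) (f : 𝓢(ℝ, ℂ)) : 𝓢(ℝ, ℂ) :=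
  (SchwartzMap.derivCLM ℂ ℂ)^[n] f

theorem SchwartzMap.iterDeriv_zero (f : 𝓢(ℝ, ℂ)) : f.iterDeriv 0 = f := rfl

theorem SchwartzMap.iterDeriv_succ' (n : ℕ) (f : 𝓢(ℝ, ℂ)) :
    f.iterDeriv (n + 1) = SchwartzMap.derivCLM ℂ ℂ (f.iterDeriv n) :=
  Function.iterate_succ_apply' _ _ _

theorem SchwartzMap.coe_iterDeriv (n : ℕ) (f : 𝓢(ℝ, ℂ)) :
    ⇑(f.iterDeriv n) = iteratedDeriv n f := by
  induction n with
  | zero => simp [iterDeriv_zero]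
  | succ n ih =>
    rw [iteratedDeriv_succ, ← ih, iterDeriv_succ']
    rfl

theorem eLpNorm_comp_mul_left {f : ℝ → ℂ} (hf : Measurable f) {a : ℝ} (ha : a ≠ 0) :
    eLpNorm (fun x => f (a * x)) 1 volume = ENNReal.ofReal |a|⁻¹ * eLpNorm f 1 volume := by
  rw [eLpNorm_one_eq_lintegral_enorm, eLpNorm_one_eq_lintegral_enorm, ← abs_inv, ← smul_eq_mul,
    ← lintegral_smul_measure, ← Real.map_volume_mul_left ha,
    lintegral_map hf.enorm (measurable_const_mul a)]

theorem coe_iterDeriv_heatKernel {t : ℝ} (ht : 0 < t) (n : ℕ) :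
    ((heatKernel t).iterDeriv n : ℝ → ℂ) =
      ((Real.exp (-t) / Real.sqrt (4 * Real.pi * t) * (1 / (2 * Real.sqrt t)) ^ n : ℝ) : ℂ) •
        fun x => gaussianSchwartz.iterDeriv n (1 / (2 * Real.sqrt t) * x) := by
  have e : (heatKernel t : ℝ → ℂ) =
      ((Real.exp (-t) / Real.sqrt (4 * Real.pi * t) : ℝ) : ℂ) •
        fun x : ℝ => gaussianSchwartz (1 / (2 * Real.sqrt t) * x) := by
    funext x
    rw [heatKernel, dif_pos ht, _root_.smul_apply, SchwartzMap.dilate_apply, Pi.smul_apply]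
  funext x
  rw [SchwartzMap.coe_iterDeriv, e, iteratedDeriv_const_smul_field,
    iteratedDeriv_comp_const_smul (gaussianSchwartz.smooth n), Pi.smul_apply,
    SchwartzMap.coe_iterDeriv]
  simp only [Complex.real_smul, smul_eq_mul, Complex.ofReal_mul, Complex.ofReal_pow]
  ring

theorem exists_eLpNorm_iterDeriv_heatKernel_le (n : ℕ) :
    ∃ C : ℝ≥0, ∀ t : ℝ, 0 < t → eLpNorm ((heatKernel t).iterDeriv n) 1 volume ≤
      C * ENNReal.ofReal (Real.exp (-t) * t ^ (-(n : ℝ) / 2)) := by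
  have hfin : eLpNorm (gaussianSchwartz.iterDeriv n) 1 volume ≠ ⊤ :=
    (SchwartzMap.memLp _ 1 volume).2.ne
  obtain ⟨N, hN⟩ : ∃ N : ℝ≥0, (N : ℝ≥0∞) = eLpNorm (gaussianSchwartz.iterDeriv n) 1 volume :=
    ⟨_, ENNReal.coe_toNNReal hfin⟩
  refine ⟨N, fun t ht => ?_⟩
  have hst : 0 < Real.sqrt t := Real.sqrt_pos.2 ht
  have ha0 : 0 < 1 / (2 * Real.sqrt t) := by positivity
  rw [coe_iterDeriv_heatKernel ht, eLpNorm_const_smul,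
    eLpNorm_comp_mul_left (SchwartzMap.continuous _).measurable ha0.ne',
    ← hN, ← mul_assoc, mul_comm, abs_of_pos ha0]
  refine mul_le_mul_right ?_ _
  rw [← ofReal_norm, Complex.norm_real, ← ENNReal.ofReal_mul (norm_nonneg _),
    Real.norm_of_nonneg (by positivity)]
  refine ENNReal.ofReal_le_ofReal ?_
  have h2 : Real.sqrt (4 * Real.pi * t) = Real.sqrt Real.pi * (2 * Real.sqrt t) := by
    rw [show 4 * Real.pi * t = Real.pi * (2 ^ 2 * t) by ring, Real.sqrt_mul Real.pi_pos.le,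
      Real.sqrt_mul (by positivity), Real.sqrt_sq (by norm_num)]
  have h3 : t ^ (-(n : ℝ) / 2) = (Real.sqrt t)⁻¹ ^ n := by
    rw [Real.sqrt_eq_rpow, ← Real.rpow_neg ht.le, ← Real.rpow_natCast, ← Real.rpow_mul ht.le]
    congr 1; ring
  have h4 : (1 / (2 * Real.sqrt t)) ^ n ≤ (Real.sqrt t)⁻¹ ^ n := by
    refine pow_le_pow_left₀ ha0.le ?_ n
    rw [one_div, mul_inv]
    have : 0 < (Real.sqrt t)⁻¹ := by positivity
    linarith
  have h5 : 1 ≤ Real.sqrt Real.pi := by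
    rw [Real.one_le_sqrt]; linarith [Real.pi_gt_three]
  rw [h2, h3]
  calc Real.exp (-t) / (Real.sqrt Real.pi * (2 * Real.sqrt t)) * (1 / (2 * Real.sqrt t)) ^ n *
        (1 / (2 * Real.sqrt t))⁻¹
      = (Real.exp (-t) * (1 / (2 * Real.sqrt t)) ^ n) / Real.sqrt Real.pi := by
        field_simp
    _ ≤ Real.exp (-t) * (1 / (2 * Real.sqrt t)) ^ n := div_le_self (by positivity) h5
    _ ≤ _ := by gcongr

end HeatKernel

namespace SchwartzMap

/-- The convolution of a Schwartz function with a function. -/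
noncomputable def conv (k : 𝓢(ℝ, ℂ)) (g : ℝ → ℂ) (x : ℝ) : ℂ := ∫ y, k (x - y) * g y

theorem exists_norm_le (k : 𝓢(ℝ, ℂ)) : ∃ C : ℝ, ∀ x, ‖k x‖ ≤ C :=
  ⟨_, fun x => k.norm_le_seminorm ℝ x⟩

theorem integrable_sub_mul (k : 𝓢(ℝ, ℂ)) {g : ℝ → ℂ} (hg : Integrable g) (x : ℝ) :
    Integrable fun y => k (x - y) * g y := by
  obtain ⟨C, hC⟩ := k.exists_norm_le
  exact hg.bdd_mul (c := C) (k.continuous.comp (continuous_const.sub continuous_id)).aestronglyMeasurable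
    (.of_forall fun y => hC _)

theorem hasDerivAt_conv (k : 𝓢(ℝ, ℂ)) {g : ℝ → ℂ} (hg : Integrable g) (x : ℝ) :
    HasDerivAt (k.conv g) ((derivCLM ℂ ℂ k).conv g x) x := by
  obtain ⟨C, hC⟩ := (derivCLM ℂ ℂ k).exists_norm_le
  refine (hasDerivAt_integral_of_dominated_loc_of_deriv_le (s := univ) (bound := fun y => C * ‖g y‖)
    (F := fun z y => k (z - y) * g y) (F' := fun z y => derivCLM ℂ ℂ k (z - y) * g y)
    Filter.univ_mem (.of_forall fun z => (k.integrable_sub_mul hg z).aestronglyMeasurable)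
    (k.integrable_sub_mul hg x) ((derivCLM ℂ ℂ k).integrable_sub_mul hg x).aestronglyMeasurable
    (.of_forall fun y z _ => ?_) (hg.norm.const_mul C) (.of_forall fun y z _ => ?_)).2
  · rw [norm_mul]
    exact mul_le_mul_of_nonneg_right (hC _) (norm_nonneg _)
  · have h1 : HasDerivAt (fun z => k (z - y)) (deriv k (z - y)) z :=
      (k.hasDerivAt (z - y)).comp_sub_const z y
    exact h1.mul_const (g y)

theorem iteratedDeriv_conv (k : 𝓢(ℝ, ℂ)) {g : ℝ → ℂ} (hg : Integrable g) (n : ℕ) :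
    iteratedDeriv n (k.conv g) = (k.iterDeriv n).conv g := by
  induction n with
  | zero => simp [iterDeriv_zero]
  | succ n ih =>
    funext x
    rw [iteratedDeriv_succ, ih, ((k.iterDeriv n).hasDerivAt_conv hg x).deriv, iterDeriv_succ']

theorem contDiff_conv (k : 𝓢(ℝ, ℂ)) {g : ℝ → ℂ} (hg : Integrable g) :
    ContDiff ℝ ∞ (k.conv g) := by
  refine contDiff_of_differentiable_iteratedDeriv fun m _ x => ?_
  rw [k.iteratedDeriv_conv hg]
  exact ((k.iterDeriv m).hasDerivAt_conv hg x).differentiableAt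

theorem conv_comm (k f : 𝓢(ℝ, ℂ)) : k.conv f = f.conv k := by
  funext x
  rw [conv, ← integral_sub_left_eq_self _ volume x]
  simp only [sub_sub_cancel]
  exact integral_congr_ae (.of_forall fun y => mul_comm _ _)

theorem conv_derivCLM (k f : 𝓢(ℝ, ℂ)) : k.conv (derivCLM ℂ ℂ f) = (derivCLM ℂ ℂ k).conv f := by
  funext x
  rw [conv_comm, ← (f.hasDerivAt_conv k.integrable x).deriv, conv_comm,
    (k.hasDerivAt_conv f.integrable x).deriv]

/-- The operator `1 - d²/dx²`. -/
noncomputable def besselOp : 𝓢(ℝ, ℂ) →L[ℂ] 𝓢(ℝ, ℂ) :=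
  ContinuousLinearMap.id ℂ _ - (derivCLM ℂ ℂ).comp (derivCLM ℂ ℂ)

theorem besselOp_eq (f : 𝓢(ℝ, ℂ)) : besselOp f = f - derivCLM ℂ ℂ (derivCLM ℂ ℂ f) := rfl

theorem conv_besselOp (k f : 𝓢(ℝ, ℂ)) : k.conv (besselOp f) = (besselOp k).conv f := by
  have e1 : k.conv (besselOp f) = k.conv f - k.conv (derivCLM ℂ ℂ (derivCLM ℂ ℂ f)) := by
    funext x
    rw [Pi.sub_apply, conv, conv, conv, ← integral_sub (k.integrable_sub_mul f.integrable x)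
      (k.integrable_sub_mul (SchwartzMap.integrable _) x)]
    simp only [besselOp_eq, _root_.sub_apply, mul_sub]
  have e2 : (besselOp k).conv f = k.conv f - (derivCLM ℂ ℂ (derivCLM ℂ ℂ k)).conv f := by
    funext x
    rw [Pi.sub_apply, conv, conv, conv, ← integral_sub (k.integrable_sub_mul f.integrable x)
      (integrable_sub_mul _ f.integrable x)]
    simp only [besselOp_eq, _root_.sub_apply, sub_mul]
  rw [e1, e2, conv_derivCLM, conv_derivCLM]

theorem conv_iterate_besselOp (k f : 𝓢(ℝ, ℂ)) (M : ℕ) :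
    k.conv (besselOp^[M] f) = (besselOp^[M] k).conv f := by
  induction M generalizing f with
  | zero => rfl
  | succ M ih => rw [Function.iterate_succ_apply, ih, conv_besselOp, Function.iterate_succ_apply']

theorem eLpNorm_conv_le {r : ℝ≥0∞} (hr : 1 ≤ r) (k : 𝓢(ℝ, ℂ)) {g : ℝ → ℂ} (hg : Measurable g) :
    eLpNorm (k.conv g) r volume ≤ eLpNorm k 1 volume * eLpNorm g r volume :=
  eLpNorm_integral_mul_sub_le hr k.continuous.measurable k.integrable hg

theorem iterDeriv_besselOp (n : ℕ) (f : 𝓢(ℝ, ℂ)) :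
    (besselOp f).iterDeriv n = f.iterDeriv n - f.iterDeriv (n + 2) := by
  induction n with
  | zero => rfl
  | succ n ih => rw [iterDeriv_succ', ih, map_sub, ← iterDeriv_succ', ← iterDeriv_succ']

theorem eLpNorm_iterate_besselOp_le {r : ℝ≥0∞} (hr : 1 ≤ r) (M : ℕ) (f : 𝓢(ℝ, ℂ)) (B : ℝ≥0∞)
    {δ : ℝ} (hδ : 0 < δ) (hδ1 : δ ≤ 1)
    (hf : ∀ l ≤ 2 * M, eLpNorm (f.iterDeriv l) r volume ≤ B * ENNReal.ofReal (δ ^ (-(l : ℝ) / 2))) :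
    eLpNorm (besselOp^[M] f) r volume ≤ 2 ^ M * B * ENNReal.ofReal (δ ^ (-(M : ℝ))) := by
  induction M generalizing f B with
  | zero => simpa [iterDeriv_zero] using hf 0 le_rfl
  | succ M ih =>
    rw [Function.iterate_succ_apply]
    refine (ih (besselOp f) (2 * B * ENNReal.ofReal δ⁻¹) fun l hl => ?_).trans (le_of_eq ?_)
    · rw [iterDeriv_besselOp]
      have h1 := hf l (by omega)
      have h2 := hf (l + 2) (by omega)
      have h3 : eLpNorm (f.iterDeriv l - f.iterDeriv (l + 2) : 𝓢(ℝ, ℂ)) r volume ≤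
          eLpNorm (f.iterDeriv l) r volume + eLpNorm (f.iterDeriv (l + 2)) r volume :=
        eLpNorm_sub_le (SchwartzMap.continuous _).aestronglyMeasurable
          (SchwartzMap.continuous _).aestronglyMeasurable hr
      have h4 : δ ^ (-((l + 2 : ℕ) : ℝ) / 2) = δ⁻¹ * δ ^ (-(l : ℝ) / 2) := by
        rw [← Real.rpow_neg_one, ← Real.rpow_add hδ]; congr 1; push_cast; ring
      have h5 : (1 : ℝ) ≤ δ⁻¹ := (one_le_inv₀ hδ).2 hδ1
      refine h3.trans ((add_le_add h1 h2).trans ?_)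
      rw [h4, ENNReal.ofReal_mul (by positivity)]
      calc B * ENNReal.ofReal (δ ^ (-(l : ℝ) / 2)) +
            B * (ENNReal.ofReal δ⁻¹ * ENNReal.ofReal (δ ^ (-(l : ℝ) / 2)))
          ≤ B * (ENNReal.ofReal δ⁻¹ * ENNReal.ofReal (δ ^ (-(l : ℝ) / 2))) +
            B * (ENNReal.ofReal δ⁻¹ * ENNReal.ofReal (δ ^ (-(l : ℝ) / 2))) := by
              gcongr
              refine le_mul_of_one_le_left (zero_le) ?_
              rwa [ENNReal.one_le_ofReal]
        _ = _ := by ring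
    · rw [show -((M + 1 : ℕ) : ℝ) = -1 + -(M : ℝ) by push_cast; ring, Real.rpow_add hδ,
        Real.rpow_neg_one, ENNReal.ofReal_mul (by positivity), pow_succ]
      ring

theorem exists_eLpNorm_iterate_besselOp_heatKernel_le (M : ℕ) :
    ∃ C : ℝ≥0, ∀ t : ℝ, 0 < t → eLpNorm (besselOp^[M] (heatKernel t)) 1 volume ≤
      C * ENNReal.ofReal (Real.exp (-t) * (min t 1) ^ (-(M : ℝ))) := by
  choose c hc using exists_eLpNorm_iterDeriv_heatKernel_le
  refine ⟨2 ^ M * ∑ l ∈ Finset.range (2 * M + 1), c l, fun t ht => ?_⟩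
  have hm : 0 < min t 1 := lt_min ht one_pos
  refine (eLpNorm_iterate_besselOp_le le_rfl M (heatKernel t)
    ((∑ l ∈ Finset.range (2 * M + 1), c l : ℝ≥0) * ENNReal.ofReal (Real.exp (-t))) hm
    (min_le_right _ _) fun l hl => (hc l t ht).trans ?_).trans (le_of_eq ?_)
  · rw [mul_assoc, ← ENNReal.ofReal_mul (Real.exp_nonneg _)]
    refine mul_le_mul' ?_ (ENNReal.ofReal_le_ofReal
      (mul_le_mul_of_nonneg_left ?_ (Real.exp_nonneg _)))
    · rw [ENNReal.coe_le_coe]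
      exact Finset.single_le_sum (f := c) (fun _ _ => zero_le) (Finset.mem_range.2 (by omega))
    · refine Real.rpow_le_rpow_of_nonpos hm (min_le_left _ _) ?_
      have : (0 : ℝ) ≤ l := Nat.cast_nonneg l
      linarith
  · rw [ENNReal.ofReal_mul (Real.exp_nonneg _)]
    push_cast
    ring

theorem measurable_conv_heatKernel {g : ℝ → ℂ} (hg : Measurable g) :
    Measurable (fun z : ℝ × ℝ => (heatKernel z.1).conv g z.2) := by
  refine StronglyMeasurable.measurable ?_
  refine StronglyMeasurable.integral_prod_right (f := fun (z : ℝ × ℝ) y => heatKernel z.1 (z.2 - y) * g y) ?_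
  refine Measurable.stronglyMeasurable ?_
  refine Measurable.mul ?_ (hg.comp measurable_snd)
  exact measurable_heatKernel.comp
    ((measurable_fst.comp measurable_fst).prodMk ((measurable_snd.comp measurable_fst).sub measurable_snd))

end SchwartzMap

section BesselPotential

open FourierTransform

theorem SchwartzMap.fourierInv_apply_eq_integral (f : 𝓢(ℝ, ℂ)) (x : ℝ) :
    𝓕⁻ f x = ∫ ξ, Complex.exp ((2 * Real.pi * (ξ * x) : ℝ) * Complex.I) * f ξ := by
  rw [SchwartzMap.fourierInv_coe, Real.fourierInv_eq']
  simp only [smul_eq_mul, RCLike.inner_apply, conj_trivial]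
  refine integral_congr_ae (.of_forall fun ξ => ?_)
  simp only [mul_comm x ξ]

theorem fourierInv_heatKernel {t : ℝ} (ht : 0 < t) (ξ : ℝ) :
    𝓕⁻ (heatKernel t) ξ = ((Real.exp (-t * (1 + 4 * Real.pi ^ 2 * ξ ^ 2)) : ℝ) : ℂ) := by
  rw [SchwartzMap.fourierInv_coe, Real.fourierInv_eq_fourier_neg, ← SchwartzMap.fourier_coe,
    fourier_heatKernel ht, neg_sq]

theorem fourierInv_compSubConst (f : 𝓢(ℝ, ℂ)) (a ξ : ℝ) :
    𝓕⁻ (f.compSubConstCLM ℂ a) ξ =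
      Complex.exp ((2 * Real.pi * (a * ξ) : ℝ) * Complex.I) * 𝓕⁻ f ξ := by
  rw [SchwartzMap.fourierInv_apply_eq_integral, SchwartzMap.fourierInv_apply_eq_integral,
    ← integral_const_mul, ← integral_add_right_eq_self _ a]
  refine integral_congr_ae (.of_forall fun y => ?_)
  simp only [SchwartzMap.compSubConstCLM_apply, add_sub_cancel_right]
  rw [← mul_assoc (Complex.exp _) (Complex.exp _), ← Complex.exp_add]
  congr 2
  push_cast
  ring

theorem heatKernel_conv_apply {t : ℝ} (ht : 0 < t) (f : 𝓢(ℝ, ℂ)) (x : ℝ) :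
    (heatKernel t).conv f x = ∫ ξ, Complex.exp ((2 * Real.pi * (ξ * x) : ℝ) * Complex.I) *
      (((Real.exp (-t * (1 + 4 * Real.pi ^ 2 * ξ ^ 2)) : ℝ) : ℂ) * 𝓕 f ξ) := by
  have h := SchwartzMap.integral_fourierInv_mul_eq ((heatKernel t).compSubConstCLM ℂ x) (𝓕 f)
  rw [FourierTransform.fourierInv_fourier_eq] at h
  have e : (heatKernel t).conv f x = ∫ y, (heatKernel t).compSubConstCLM ℂ x y * f y := by
    refine integral_congr_ae (.of_forall fun y => ?_)
    simp only [SchwartzMap.compSubConstCLM_apply]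
    rw [← heatKernel_neg, neg_sub]
  rw [e, ← h]
  refine integral_congr_ae (.of_forall fun ξ => ?_)
  simp only
  rw [fourierInv_compSubConst, fourierInv_heatKernel ht, mul_comm x ξ, mul_assoc]

theorem heatKernel_conv_heatKernel {t τ : ℝ} (ht : 0 < t) (hτ : 0 < τ) (x y : ℝ) :
    (heatKernel t).conv ((heatKernel τ).compSubConstCLM ℂ x) y = heatKernel (t + τ) (x - y) := by
  have hF : ∀ ξ, 𝓕 ((heatKernel τ).compSubConstCLM ℂ x) ξ =
      Complex.exp ((2 * Real.pi * (x * -ξ) : ℝ) * Complex.I) *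
        ((Real.exp (-τ * (1 + 4 * Real.pi ^ 2 * ξ ^ 2)) : ℝ) : ℂ) := by
    intro ξ
    have h1 := fourierInv_compSubConst (heatKernel τ) x (-ξ)
    rw [fourierInv_heatKernel hτ, neg_sq] at h1
    rw [← h1, SchwartzMap.fourierInv_coe, Real.fourierInv_eq_fourier_neg, neg_neg]
    rfl
  have h2 : heatKernel (t + τ) (x - y) = 𝓕⁻ (𝓕 (heatKernel (t + τ))) (y - x) := by
    rw [FourierTransform.fourierInv_fourier_eq, ← heatKernel_neg, neg_sub]
  rw [heatKernel_conv_apply ht, h2, SchwartzMap.fourierInv_apply_eq_integral]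
  refine integral_congr_ae (.of_forall fun ξ => ?_)
  simp only [hF, fourier_heatKernel (add_pos ht hτ)]
  rw [neg_add, add_mul, Real.exp_add, mul_sub, mul_sub, sub_eq_add_neg (2 * Real.pi * (ξ * y)),
    Complex.ofReal_add, add_mul, Complex.exp_add,
    show -(2 * Real.pi * (ξ * x)) = 2 * Real.pi * (x * -ξ) by ring]
  push_cast
  ring

/-- The Bessel potential operator of order `s` on Schwartz functions. -/
noncomputable abbrev besselPotential (s : ℝ) : 𝓢(ℝ, ℂ) →L[ℝ] 𝓢(ℝ, ℂ) :=
  SchwartzMap.fourierMultiplierCLM ℂ (besselSymbol s)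

theorem besselPotential_apply (s : ℝ) (f : 𝓢(ℝ, ℂ)) (x : ℝ) :
    besselPotential s f x = ∫ ξ, Complex.exp ((2 * Real.pi * (ξ * x) : ℝ) * Complex.I) *
      ((besselSymbol s ξ : ℂ) * 𝓕 f ξ) := by
  rw [SchwartzMap.fourierMultiplierCLM_apply, SchwartzMap.fourierInv_apply_eq_integral]
  refine integral_congr_ae (.of_forall fun ξ => ?_)
  simp only [SchwartzMap.smulLeftCLM_apply_apply (besselSymbol_hasTemperateGrowth s),
    Complex.real_smul]

theorem besselPotential_besselPotential (a b : ℝ) (f : 𝓢(ℝ, ℂ)) :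
    besselPotential a (besselPotential b f) = besselPotential (a + b) f := by
  rw [SchwartzMap.fourierMultiplierCLM_fourierMultiplierCLM_apply
    (besselSymbol_hasTemperateGrowth a) (besselSymbol_hasTemperateGrowth b)]
  congr 2
  funext ξ
  rw [Pi.mul_apply, besselSymbol, besselSymbol, besselSymbol, ← Real.rpow_add (by positivity)]
  congr 1; ring

theorem besselPotential_zero (f : 𝓢(ℝ, ℂ)) : besselPotential 0 f = f := by
  have : besselSymbol 0 = fun _ => (1 : ℝ) := by
    funext ξ; simp [besselSymbol]
  rw [besselPotential, this, SchwartzMap.fourierMultiplierCLM_const]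
  simp

theorem besselPotential_two (f : 𝓢(ℝ, ℂ)) : besselPotential 2 f = SchwartzMap.besselOp f := by
  have hd : ∀ (g : 𝓢(ℝ, ℂ)) (ξ : ℝ), 𝓕 (SchwartzMap.derivCLM ℂ ℂ g) ξ =
      2 * Real.pi * Complex.I * ξ * 𝓕 g ξ := by
    intro g ξ
    have h := congrFun (Real.fourier_deriv g.integrable g.differentiable
      (SchwartzMap.derivCLM ℂ ℂ g).integrable) ξ
    simp only [smul_eq_mul] at h
    exact h
  have h : 𝓕 (besselPotential 2 f) = 𝓕 (SchwartzMap.besselOp f) := by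
    ext ξ
    rw [SchwartzMap.fourierMultiplierCLM_apply, FourierTransform.fourier_fourierInv_eq,
      SchwartzMap.smulLeftCLM_apply_apply (besselSymbol_hasTemperateGrowth 2),
      SchwartzMap.besselOp_eq, sub_eq_add_neg, ← neg_one_smul ℂ, FourierTransform.fourier_add,
      FourierTransform.fourier_smul, _root_.add_apply, _root_.smul_apply, hd, hd]
    have : besselSymbol 2 ξ = 1 + 4 * Real.pi ^ 2 * ξ ^ 2 := by
      rw [besselSymbol, div_self two_ne_zero, Real.rpow_one]
    rw [this, Complex.real_smul, smul_eq_mul]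
    push_cast
    linear_combination (4 * (Real.pi : ℂ) ^ 2 * ξ ^ 2 * 𝓕 f ξ) * Complex.I_sq
  have h' := congrArg (fun g : 𝓢(ℝ, ℂ) => 𝓕⁻ g) h
  simpa only [FourierTransform.fourierInv_fourier_eq] using h'

theorem besselPotential_eq_iterate_besselOp (s : ℝ) (M : ℕ) (f : 𝓢(ℝ, ℂ)) :
    besselPotential s f = besselPotential (s - 2 * M) (SchwartzMap.besselOp^[M] f) := by
  induction M with
  | zero => simp
  | succ M ih =>
    rw [Function.iterate_succ_apply', ← besselPotential_two, besselPotential_besselPotential, ih]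
    congr 2
    push_cast
    ring

theorem besselPotential_neg_apply {σ : ℝ} (hσ : 0 < σ) (f : 𝓢(ℝ, ℂ)) (x : ℝ) :
    besselPotential (-2 * σ) f x = ((Real.Gamma σ)⁻¹ : ℝ) *
      ∫ t in Ioi (0 : ℝ), ((t ^ (σ - 1) : ℝ) : ℂ) * (heatKernel t).conv f x := by
  set e : ℝ → ℂ := fun ξ => Complex.exp ((2 * Real.pi * (ξ * x) : ℝ) * Complex.I) with he
  have hen : ∀ ξ, ‖e ξ‖ = 1 := fun ξ => Complex.norm_exp_ofReal_mul_I _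
  have hec : Continuous e := by
    simp only [he]
    fun_prop
  set P : ℝ → ℝ := fun ξ => 1 + 4 * Real.pi ^ 2 * ξ ^ 2 with hP
  have hP1 : ∀ ξ, 1 ≤ P ξ := fun ξ => by simp only [hP]; nlinarith [sq_nonneg (Real.pi * ξ)]
  set F : ℝ → ℝ → ℂ := fun t ξ => ((t ^ (σ - 1) : ℝ) : ℂ) *
    (e ξ * (((Real.exp (-t * P ξ) : ℝ) : ℂ) * 𝓕 f ξ)) with hF
  have h1 : ∫ t in Ioi (0 : ℝ), ((t ^ (σ - 1) : ℝ) : ℂ) * (heatKernel t).conv f x =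
      ∫ t in Ioi (0 : ℝ), ∫ ξ, F t ξ := by
    refine setIntegral_congr_fun measurableSet_Ioi fun t ht => ?_
    simp only [hF]
    rw [integral_const_mul, heatKernel_conv_apply ht]
  have hFm : Measurable (Function.uncurry F) := by
    have h2 : Measurable (𝓕 f : 𝓢(ℝ, ℂ)) := (𝓕 f).continuous.measurable
    simp only [hF, hP, he]
    fun_prop
  have hint : Integrable (Function.uncurry F)
      ((volume.restrict (Ioi (0 : ℝ))).prod (volume : Measure ℝ)) := by
    have h2 : Integrable (fun t : ℝ => Real.exp (-t) * t ^ (σ - 1)) (volume.restrict (Ioi 0)) :=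
      Real.GammaIntegral_convergent hσ
    refine (h2.mul_prod (𝓕 f).integrable.norm).mono' hFm.aestronglyMeasurable ?_
    have h3 : ∀ᵐ z : ℝ × ℝ ∂((volume.restrict (Ioi (0 : ℝ))).prod (volume : Measure ℝ)),
        0 < z.1 := by
      have := (Measure.quasiMeasurePreserving_fst (μ := volume.restrict (Ioi (0 : ℝ)))
        (ν := (volume : Measure ℝ))).ae (ae_restrict_mem measurableSet_Ioi)
      exact this
    filter_upwards [h3] with z hz
    simp only [Function.uncurry, hF]
    rw [norm_mul, norm_mul, norm_mul, hen, one_mul, Complex.norm_real, Complex.norm_real,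
      Real.norm_of_nonneg (by positivity), Real.norm_of_nonneg (by positivity), ← mul_assoc,
      mul_comm (z.1 ^ (σ - 1))]
    gcongr
    nlinarith [hP1 z.2]
  rw [h1, integral_integral_swap hint, besselPotential_apply, ← integral_const_mul]
  refine integral_congr_ae (.of_forall fun ξ => ?_)
  have h4 : ∀ t, F t ξ = (((t ^ (σ - 1) * Real.exp (-(P ξ * t)) : ℝ) : ℂ)) * (e ξ * 𝓕 f ξ) := by
    intro t
    simp only [hF]
    rw [show -t * P ξ = -(P ξ * t) by ring]
    push_cast
    ring
  simp only [h4]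
  rw [integral_mul_const, integral_complex_ofReal,
    Real.integral_rpow_mul_exp_neg_mul_Ioi hσ (zero_lt_one.trans_le (hP1 ξ))]
  have hG : (Real.Gamma σ : ℂ) ≠ 0 := by exact_mod_cast (Real.Gamma_pos_of_pos hσ).ne'
  have h5 : besselSymbol (-2 * σ) ξ = (1 / P ξ) ^ σ := by
    rw [besselSymbol, one_div, Real.inv_rpow (by linarith [hP1 ξ]), ← Real.rpow_neg
      (by linarith [hP1 ξ])]
    congr 1; ring
  rw [h5, Complex.ofReal_mul (_ ^ σ), Complex.ofReal_inv]
  change e ξ * _ = _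
  field_simp

theorem isBesselPotential_besselPotential (s : ℝ) (f : 𝓢(ℝ, ℂ)) :
    IsBesselPotential s f (besselPotential s f) := by
  intro ψ
  set σf : 𝓢(ℝ, ℂ) := SchwartzMap.smulLeftCLM ℂ (besselSymbol s) (𝓕⁻ f) with hσf
  have hs := besselSymbol_hasTemperateGrowth s
  have h1 : ∫ x, f x * besselPotential s ψ x = ∫ x, σf x * 𝓕 ψ x := by
    rw [SchwartzMap.fourierMultiplierCLM_apply, ← SchwartzMap.integral_fourierInv_mul_eq]
    refine integral_congr_ae (.of_forall fun ξ => ?_)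
    simp only [hσf, SchwartzMap.smulLeftCLM_apply_apply hs, Complex.real_smul]
    ring
  have h2 : 𝓕 σf = besselPotential s f := by
    ext x
    rw [SchwartzMap.fourierMultiplierCLM_apply, SchwartzMap.fourierInv_coe,
      Real.fourierInv_eq_fourier_comp_neg, SchwartzMap.fourier_coe]
    refine congrFun (congrArg (fun g : ℝ → ℂ => 𝓕 g) (funext fun ξ => ?_)) x
    rw [hσf, SchwartzMap.smulLeftCLM_apply_apply hs, SchwartzMap.smulLeftCLM_apply_apply hs,
      SchwartzMap.fourierInv_coe, Real.fourierInv_eq_fourier_neg, besselSymbol, besselSymbol,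
      neg_sq]
    rfl
  rw [h1, ← SchwartzMap.integral_fourier_mul_eq, h2]

end BesselPotential

section SobolevBounds

theorem exp_neg_mul_min_rpow_le (M : ℕ) {t : ℝ} (ht : 0 < t) :
    Real.exp (-t) * (min t 1) ^ (-(M : ℝ)) ≤ M.factorial * t ^ (-(M : ℝ)) := by
  have hM : (1 : ℝ) ≤ M.factorial := by exact_mod_cast Nat.one_le_iff_ne_zero.2 M.factorial_ne_zero
  rcases le_total t 1 with h | h
  · rw [min_eq_left h]
    gcongr
    exact (Real.exp_le_one_iff.2 (by linarith)).trans hM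
  · rw [min_eq_right h, Real.one_rpow, mul_one, Real.rpow_neg ht.le, Real.rpow_natCast,
      ← div_eq_mul_inv, le_div_iff₀ (by positivity), Real.exp_neg, inv_mul_le_iff₀ (Real.exp_pos _)]
    have := Real.pow_div_factorial_le_exp t ht.le M
    rwa [div_le_iff₀ (by positivity)] at this

theorem lintegral_rpow_mul_max_rpow_neg {σ m δ : ℝ} (hσ : 0 < σ) (hm : σ < m) (hδ : 0 < δ) :
    ∫⁻ t in Ioi (0 : ℝ), ENNReal.ofReal (t ^ (σ - 1) * (max δ t) ^ (-m)) =
      ENNReal.ofReal ((σ⁻¹ + (m - σ)⁻¹) * δ ^ (σ - m)) := by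
  have h1 : ∫⁻ t in Ioc 0 δ, ENNReal.ofReal (t ^ (σ - 1) * (max δ t) ^ (-m)) =
      ENNReal.ofReal (σ⁻¹ * δ ^ (σ - m)) := by
    have e : ∫⁻ t in Ioc 0 δ, ENNReal.ofReal (t ^ (σ - 1) * (max δ t) ^ (-m)) =
        ∫⁻ t in Ioc 0 δ, ENNReal.ofReal (t ^ (σ - 1) * δ ^ (-m)) := by
      refine setLIntegral_congr_fun measurableSet_Ioc fun t ht => ?_
      simp only [max_eq_left ht.2]
    have hi : IntegrableOn (fun t : ℝ => t ^ (σ - 1) * δ ^ (-m)) (Ioc 0 δ) := by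
      have := intervalIntegral.intervalIntegrable_rpow' (a := 0) (b := δ) (r := σ - 1) (by linarith)
      exact (((intervalIntegrable_iff_integrableOn_Ioc_of_le hδ.le).1 this).mul_const _)
    rw [e, ← ofReal_integral_eq_lintegral_ofReal hi]
    · rw [integral_mul_const, ← intervalIntegral.integral_of_le hδ.le,
        integral_rpow (Or.inl (by linarith)), sub_add_cancel, Real.zero_rpow hσ.ne', sub_zero,
        sub_eq_add_neg σ m, Real.rpow_add hδ]
      congr 1; field_simp
    · filter_upwards [ae_restrict_mem measurableSet_Ioc] with t ht
      have := ht.1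
      positivity
  have h2 : ∫⁻ t in Ioi δ, ENNReal.ofReal (t ^ (σ - 1) * (max δ t) ^ (-m)) =
      ENNReal.ofReal ((m - σ)⁻¹ * δ ^ (σ - m)) := by
    have e : ∫⁻ t in Ioi δ, ENNReal.ofReal (t ^ (σ - 1) * (max δ t) ^ (-m)) =
        ∫⁻ t in Ioi δ, ENNReal.ofReal (t ^ (σ - 1 - m)) := by
      refine setLIntegral_congr_fun measurableSet_Ioi fun t ht => ?_
      have ht' : 0 < t := hδ.trans ht
      simp only [max_eq_right (le_of_lt (mem_Ioi.1 ht))]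
      rw [← Real.rpow_add ht', sub_eq_add_neg _ m]
    rw [e, ← ofReal_integral_eq_lintegral_ofReal
      (integrableOn_Ioi_rpow_of_lt (by linarith) hδ), integral_Ioi_rpow_of_lt (by linarith) hδ]
    · congr 1
      rw [show σ - 1 - m + 1 = σ - m by ring, ← neg_sub m σ, neg_div_neg_eq]
      field_simp
    · filter_upwards [ae_restrict_mem measurableSet_Ioi] with t ht
      exact Real.rpow_nonneg (hδ.trans ht).le _
  rw [← Ioc_union_Ioi_eq_Ioi hδ.le, lintegral_union measurableSet_Ioi
    (Ioc_disjoint_Ioi le_rfl), h1, h2, ← ENNReal.ofReal_add, add_mul]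
  · positivity
  · have : 0 < m - σ := by linarith
    positivity

theorem sobolevNorm_le_eLpNorm_besselPotential (r : ℝ≥0∞) (s : ℝ) (f : 𝓢(ℝ, ℂ)) :
    sobolevNorm r s f ≤ eLpNorm (besselPotential s f) r volume :=
  iInf_le_of_le _ (iInf₂_le (SchwartzMap.memLp _ r volume)
    (isBesselPotential_besselPotential s f))

/-- A Schwartz function whose derivatives up to order `2M` obey `‖f^(l)‖_r ≤ B δ^(-l/2)` satisfies
the corresponding bound for the fractional Sobolev norms of order less than `2M`. -/
theorem exists_sobolevNorm_le (M : ℕ) {s : ℝ} (hs : 0 < s) (hsM : s < 2 * M) :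
    ∃ C : ℝ≥0, ∀ r : ℝ≥0∞, 1 ≤ r → ∀ δ : ℝ, 0 < δ → δ ≤ 1 → ∀ (f : 𝓢(ℝ, ℂ)) (B : ℝ≥0∞),
      (∀ l ≤ 2 * M, eLpNorm (f.iterDeriv l) r volume ≤ B * ENNReal.ofReal (δ ^ (-(l : ℝ) / 2))) →
      sobolevNorm r s f ≤ C * B * ENNReal.ofReal (δ ^ (-s / 2)) := by
  obtain ⟨C₀, hC₀⟩ := exists_eLpNorm_iterDeriv_heatKernel_le 0
  obtain ⟨C₁, hC₁⟩ := SchwartzMap.exists_eLpNorm_iterate_besselOp_heatKernel_le M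
  set σ : ℝ := M - s / 2 with hσd
  have hσ : 0 < σ := by linarith
  have hΓ : 0 < Real.Gamma σ := Real.Gamma_pos_of_pos hσ
  set D : ℝ≥0 := C₀ * 2 ^ M + C₁ * M.factorial with hD
  refine ⟨Real.toNNReal ((Real.Gamma σ)⁻¹ * (σ⁻¹ + ((M : ℝ) - σ)⁻¹)) * D,
    fun r hr δ hδ hδ1 f B hf => ?_⟩
  refine (sobolevNorm_le_eLpNorm_besselPotential r s f).trans ?_
  set F := SchwartzMap.besselOp^[M] f with hF
  have hFr : eLpNorm F r volume ≤ 2 ^ M * B * ENNReal.ofReal (δ ^ (-(M : ℝ))) :=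
    SchwartzMap.eLpNorm_iterate_besselOp_le hr M f B hδ hδ1 hf
  have hf0 : eLpNorm f r volume ≤ B := by
    simpa [SchwartzMap.iterDeriv_zero] using hf 0 (by omega)
  have hrep : ∀ x, besselPotential s f x = ((Real.Gamma σ)⁻¹ : ℝ) *
      ∫ t in Ioi (0 : ℝ), ((t ^ (σ - 1) : ℝ) : ℂ) * (heatKernel t).conv F x := by
    intro x
    rw [besselPotential_eq_iterate_besselOp s M f, ← besselPotential_neg_apply hσ]
    congr 3
    rw [hσd]; ring
  set w : ℝ → ℝ≥0∞ := fun t => ENNReal.ofReal (Real.Gamma σ)⁻¹ *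
    ENNReal.ofReal (t ^ (σ - 1) * (max δ t) ^ (-(M : ℝ))) with hw
  set H : ℝ → ℝ → ℝ≥0∞ := fun x t =>
    ENNReal.ofReal ((max δ t) ^ (M : ℝ)) * ‖(heatKernel t).conv F x‖ₑ with hH
  have hmax : ∀ t, 0 < max δ t := fun t => lt_max_of_lt_left hδ
  have hconv : ∀ t, 0 < t → eLpNorm ((heatKernel t).conv F) r volume ≤
      D * B * ENNReal.ofReal ((max δ t) ^ (-(M : ℝ))) := by
    intro t ht
    rcases le_total t δ with h | h
    · rw [max_eq_left h]
      refine (SchwartzMap.eLpNorm_conv_le hr _ F.continuous.measurable).trans ?_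
      have h1 : eLpNorm (heatKernel t) 1 volume ≤ C₀ := by
        refine (hC₀ t ht).trans ?_
        refine mul_le_of_le_one_right zero_le ?_
        rw [ENNReal.ofReal_le_one]
        simpa using ht.le
      refine (mul_le_mul' h1 hFr).trans ?_
      rw [hD, ← mul_assoc, ← mul_assoc]
      gcongr
      push_cast
      exact le_self_add
    · rw [max_eq_right h, hF, SchwartzMap.conv_iterate_besselOp]
      refine (SchwartzMap.eLpNorm_conv_le hr _ f.continuous.measurable).trans ?_
      refine (mul_le_mul' ((hC₁ t ht).trans (mul_le_mul_right
        (ENNReal.ofReal_le_ofReal (exp_neg_mul_min_rpow_le M ht)) _)) hf0).trans ?_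
      rw [ENNReal.ofReal_mul (by positivity), ENNReal.ofReal_natCast]
      calc (C₁ : ℝ≥0∞) * (M.factorial * ENNReal.ofReal (t ^ (-(M : ℝ)))) * B
          = (C₁ * M.factorial) * B * ENNReal.ofReal (t ^ (-(M : ℝ))) := by ring
        _ ≤ _ := by
          rw [hD]
          gcongr
          push_cast
          exact le_add_self
  have hw_int : ∫⁻ t, w t ∂(volume.restrict (Ioi (0 : ℝ))) =
      ENNReal.ofReal ((Real.Gamma σ)⁻¹ * (σ⁻¹ + ((M : ℝ) - σ)⁻¹)) *
        ENNReal.ofReal (δ ^ (-s / 2)) := by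
    have hMσ : 0 < (M : ℝ) - σ := by linarith
    rw [hw, lintegral_const_mul' _ _ ENNReal.ofReal_ne_top, lintegral_rpow_mul_max_rpow_neg hσ (by linarith) hδ,
      ENNReal.ofReal_mul (by positivity), ENNReal.ofReal_mul (by positivity), ← mul_assoc]
    congr 3
    rw [hσd]; ring
  have hmain := eLpNorm_le_lintegral_mul_of_enorm_le (μ := volume)
    (ν := volume.restrict (Ioi (0 : ℝ))) hr (G := besselPotential s f) (w := w) (H := H)
    (B := D * B) (by simp only [hw]; fun_prop) (by rw [hw_int]; exact ENNReal.mul_ne_top ENNReal.ofReal_ne_top ENNReal.ofReal_ne_top) ?_ ?_ ?_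
  · rw [hw_int] at hmain
    refine hmain.trans (le_of_eq ?_)
    push_cast
    rw [← ENNReal.ofReal]
    ring
  · refine Measurable.mul (f := fun z : ℝ × ℝ => ENNReal.ofReal ((max δ z.2) ^ (M : ℝ)))
      (by fun_prop) ?_
    exact ((SchwartzMap.measurable_conv_heatKernel F.continuous.measurable).comp
      measurable_swap).enorm
  · intro t
    have e : eLpNorm (fun x => H x t) r volume =
        ENNReal.ofReal ((max δ t) ^ (M : ℝ)) * eLpNorm ((heatKernel t).conv F) r volume := by
      have : (fun x => H x t) = fun x =>
          ‖(((max δ t) ^ (M : ℝ) : ℝ) • (heatKernel t).conv F) x‖ₑ := by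
        funext x
        rw [Pi.smul_apply, enorm_smul, ← ofReal_norm ((max δ t) ^ (M : ℝ)),
          Real.norm_of_nonneg (Real.rpow_nonneg (hmax t).le _)]
      rw [this, eLpNorm_enorm, eLpNorm_const_smul, ← ofReal_norm ((max δ t) ^ (M : ℝ)),
          Real.norm_of_nonneg (Real.rpow_nonneg (hmax t).le _)]
    rw [e]
    rcases lt_or_ge 0 t with ht | ht
    · refine (mul_le_mul_right (hconv t ht) _).trans (le_of_eq ?_)
      rw [mul_comm, mul_assoc, ← ENNReal.ofReal_mul (Real.rpow_nonneg (hmax t).le _),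
        ← Real.rpow_add (hmax t), neg_add_cancel, Real.rpow_zero, ENNReal.ofReal_one, mul_one]
    · have : (heatKernel t).conv F = 0 := by
        funext x
        simp [SchwartzMap.conv, heatKernel, dif_neg ht.not_gt]
      rw [this]
      simp
  · refine .of_forall fun x => ?_
    rw [hrep, enorm_mul, ← ofReal_norm (_ : ℂ), Complex.norm_real,
      Real.norm_of_nonneg (inv_nonneg.2 hΓ.le)]
    refine (mul_le_mul_right (enorm_integral_le_lintegral_enorm _) _).trans ?_
    rw [← lintegral_const_mul' _ _ ENNReal.ofReal_ne_top]
    refine lintegral_mono_ae ?_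
    filter_upwards [ae_restrict_mem measurableSet_Ioi] with t ht
    have ht' : (0 : ℝ) < t := ht
    simp only [hw, hH]
    have h1 : t ^ (σ - 1) * (max δ t) ^ (-(M : ℝ)) * (max δ t) ^ (M : ℝ) = t ^ (σ - 1) := by
      rw [mul_assoc, ← Real.rpow_add (hmax t), neg_add_cancel, Real.rpow_zero, mul_one]
    rw [enorm_mul, ← ofReal_norm ((t ^ (σ - 1) : ℝ) : ℂ), Complex.norm_real, Real.norm_of_nonneg
      (Real.rpow_nonneg ht'.le _), mul_assoc (ENNReal.ofReal _),
      ← mul_assoc (ENNReal.ofReal (_ * _)), ← ENNReal.ofReal_mul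
        (mul_nonneg (Real.rpow_nonneg ht'.le _) (Real.rpow_nonneg (hmax t).le _)), h1]

end SobolevBounds

section HeatInput

theorem norm_heatKernel_le {t : ℝ} (ht : 0 < t) (x : ℝ) :
    ‖heatKernel t x‖ ≤ Real.exp (-t) * t ^ (-(1 / 2) : ℝ) := by
  rw [heatKernel_apply ht, Complex.norm_real, Real.norm_of_nonneg (by positivity)]
  have h1 : Real.exp (-x ^ 2 / (4 * t)) ≤ 1 := by
    rw [Real.exp_le_one_iff]
    exact div_nonpos_of_nonpos_of_nonneg (by nlinarith [sq_nonneg x]) (by positivity)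
  have h2 : Real.sqrt t ≤ Real.sqrt (4 * Real.pi * t) :=
    Real.sqrt_le_sqrt (by nlinarith [Real.pi_gt_three])
  have h3 : 0 < Real.sqrt t := Real.sqrt_pos.2 ht
  rw [Real.rpow_neg ht.le, ← Real.sqrt_eq_rpow, ← div_eq_mul_inv]
  calc Real.exp (-t) / Real.sqrt (4 * Real.pi * t) * Real.exp (-x ^ 2 / (4 * t))
      ≤ Real.exp (-t) / Real.sqrt (4 * Real.pi * t) := mul_le_of_le_one_right (by positivity) h1
    _ ≤ _ := by gcongr

/-- The `L^r → L^∞` bound for the heat semigroup. -/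
theorem exists_lintegral_heatKernel_mul_le : ∃ C : ℝ≥0, ∀ r : ℝ≥0∞, 1 ≤ r → ∀ t : ℝ, 0 < t →
    ∀ (g : ℝ → ℂ), AEStronglyMeasurable g volume → ∀ x : ℝ,
      ∫⁻ y, ‖heatKernel t (x - y) * g y‖ₑ ≤
      C * ENNReal.ofReal (Real.exp (-t) * t ^ (-((r⁻¹).toReal / 2))) * eLpNorm g r volume := by
  obtain ⟨C₀, hC₀⟩ := exists_eLpNorm_iterDeriv_heatKernel_le 0
  refine ⟨max C₀ 1, fun r hr t ht g hg x => ?_⟩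
  set C : ℝ≥0 := max C₀ 1 with hC
  set ρ : Measure ℝ := volume.withDensity fun y => ‖heatKernel t (x - y)‖ₑ with hρ
  have hkm : Measurable fun y => ‖heatKernel t (x - y)‖ₑ :=
    ((heatKernel t).continuous.measurable.comp (measurable_const.sub measurable_id)).enorm
  have hρu : ρ univ ≤ C * ENNReal.ofReal (Real.exp (-t)) := by
    have h1 := hC₀ t ht
    rw [SchwartzMap.iterDeriv_zero, eLpNorm_one_eq_lintegral_enorm] at h1
    rw [hρ, withDensity_apply _ MeasurableSet.univ, Measure.restrict_univ,
      lintegral_sub_left_eq_self (fun y => ‖heatKernel t y‖ₑ)]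
    refine h1.trans ?_
    simp only [CharP.cast_eq_zero, neg_zero, zero_div, Real.rpow_zero, mul_one]
    gcongr
    exact le_max_left _ _
  have hc : ρ ≤ ENNReal.ofReal (Real.exp (-t) * t ^ (-(1 / 2) : ℝ)) • volume := by
    rw [← withDensity_const]
    refine withDensity_mono (.of_forall fun y => ?_)
    change ‖_‖ₑ ≤ _
    rw [← ofReal_norm]
    exact ENNReal.ofReal_le_ofReal (norm_heatKernel_le ht _)
  have hgρ : AEStronglyMeasurable g ρ := hg.mono_ac (withDensity_absolutelyContinuous _ _)
  have h1 := eLpNorm_le_eLpNorm_mul_rpow_measure_univ hr hgρ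
  have e1 : eLpNorm g 1 ρ = ∫⁻ y, ‖heatKernel t (x - y) * g y‖ₑ := by
    rw [eLpNorm_one_eq_lintegral_enorm, hρ,
      lintegral_withDensity_eq_lintegral_mul_non_measurable _ hkm
      (.of_forall fun y => enorm_lt_top)]
    simp [enorm_mul]
  set a : ℝ := (r⁻¹).toReal with ha
  have ha0 : 0 ≤ a := ENNReal.toReal_nonneg
  have ha1 : a ≤ 1 := by
    rw [ha, ← ENNReal.toReal_one]
    exact ENNReal.toReal_mono ENNReal.one_ne_top (ENNReal.inv_le_one.2 hr)
  have h2 : eLpNorm g r ρ ≤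
      ENNReal.ofReal (Real.exp (-t) * t ^ (-(1 / 2) : ℝ)) ^ a * eLpNorm g r volume := by
    refine (eLpNorm_mono_measure g hc).trans ?_
    rw [eLpNorm_smul_measure_of_ne_zero (by simpa using by positivity)]
    rw [one_div r, smul_eq_mul]
  rw [e1] at h1
  refine h1.trans ?_
  have e2 : 1 / (1 : ℝ≥0∞).toReal - 1 / r.toReal = 1 - a := by
    simp [ha, ENNReal.toReal_inv]
  rw [e2]
  calc eLpNorm g r ρ * ρ univ ^ (1 - a)
      ≤ (ENNReal.ofReal (Real.exp (-t) * t ^ (-(1 / 2) : ℝ)) ^ a * eLpNorm g r volume) *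
        (C * ENNReal.ofReal (Real.exp (-t))) ^ (1 - a) := by
        gcongr
    _ ≤ (ENNReal.ofReal (Real.exp (-t) * t ^ (-(1 / 2) : ℝ)) ^ a * eLpNorm g r volume) *
        (C * ENNReal.ofReal (Real.exp (-t)) ^ (1 - a)) := by
        rw [ENNReal.mul_rpow_of_nonneg _ _ (by linarith : 0 ≤ 1 - a)]
        gcongr
        calc (C : ℝ≥0∞) ^ (1 - a) ≤ (C : ℝ≥0∞) ^ (1 : ℝ) := by
              refine ENNReal.rpow_le_rpow_of_exponent_le ?_ (by linarith)
              rw [← ENNReal.coe_one, ENNReal.coe_le_coe]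
              exact le_max_right _ _
          _ = C := ENNReal.rpow_one _
    _ = C * (ENNReal.ofReal (Real.exp (-t) * t ^ (-(1 / 2) : ℝ)) ^ a *
          ENNReal.ofReal (Real.exp (-t)) ^ (1 - a)) * eLpNorm g r volume := by ring
    _ = _ := by
        rw [ENNReal.ofReal_rpow_of_nonneg (by positivity) ha0,
          ENNReal.ofReal_rpow_of_nonneg (by positivity) (by linarith),
          ← ENNReal.ofReal_mul (by positivity), Real.mul_rpow (by positivity) (by positivity),
          mul_right_comm (Real.exp (-t) ^ a), ← Real.rpow_add (Real.exp_pos _), add_sub_cancel,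
          Real.rpow_one, ← Real.rpow_mul ht.le, show -(1 / 2) * a = -(a / 2) by ring]

variable {r : ℝ≥0∞} {g : ℝ → ℂ}

theorem integrable_heatKernel_mul (hr : 1 ≤ r) (hg : MemLp g r volume) {t : ℝ} (ht : 0 < t)
    (x : ℝ) : Integrable fun y => heatKernel t (x - y) * g y := by
  obtain ⟨C, hC⟩ := exists_lintegral_heatKernel_mul_le
  refine ⟨AEStronglyMeasurable.mul (((heatKernel t).continuous.comp
    (continuous_const.sub continuous_id)).aestronglyMeasurable) hg.1, ?_⟩
  refine (hC r hr t ht g hg.1 x).trans_lt ?_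
  exact ENNReal.mul_lt_top (ENNReal.mul_lt_top (by simp) (by simp)) hg.2

theorem exists_norm_conv_heatKernel_le : ∃ C : ℝ, 0 ≤ C ∧ ∀ r : ℝ≥0∞, 1 ≤ r → ∀ (g : ℝ → ℂ),
    MemLp g r volume → ∀ t : ℝ, 0 < t → ∀ x : ℝ, ‖(heatKernel t).conv g x‖ ≤
      C * (Real.exp (-t) * t ^ (-((r⁻¹).toReal / 2))) * (eLpNorm g r volume).toReal := by
  obtain ⟨C, hC⟩ := exists_lintegral_heatKernel_mul_le
  refine ⟨C, C.2, fun r hr g hg t ht x => ?_⟩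
  have h1 := (enorm_integral_le_lintegral_enorm _).trans (hC r hr t ht g hg.1 x)
  have h2 := ENNReal.toReal_mono (ENNReal.mul_ne_top (ENNReal.mul_ne_top (by simp) (by simp))
    hg.2.ne) h1
  rw [ENNReal.toReal_mul, ENNReal.toReal_mul, ENNReal.toReal_ofReal (by positivity)] at h2
  rw [toReal_enorm, ENNReal.coe_toReal] at h2
  exact h2

theorem exp_neg_add_mul_rpow_neg_le {t τ b : ℝ} (ht : 0 < t) (hτ : 0 ≤ τ) (hb : 0 ≤ b) :
    Real.exp (-(t + τ)) * (t + τ) ^ (-b) ≤ Real.exp (-t) * t ^ (-b) := by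
  exact mul_le_mul (Real.exp_le_exp.2 (by linarith))
    (Real.rpow_le_rpow_of_nonpos ht (by linarith) (by linarith)) (by positivity) (by positivity)

theorem integrableOn_rpow_mul_exp_neg_mul_rpow_neg {s b : ℝ} (hb : b < s) :
    IntegrableOn (fun t : ℝ => t ^ (s - 1) * (Real.exp (-t) * t ^ (-b))) (Ioi 0) := by
  refine (Real.GammaIntegral_convergent (s := s - b) (by linarith)).congr_fun (fun t ht => ?_)
    measurableSet_Ioi
  have ht' : (0 : ℝ) < t := ht
  simp only
  rw [mul_left_comm, ← Real.rpow_add ht']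
  congr 2; ring

/-- Recovering the heat smoothing of `u` from its Bessel potential `g ∈ L^r`. -/
theorem conv_heatKernel_eq_of_isBesselPotential {s : ℝ} (hr : 1 ≤ r) (hs : 0 < s)
    (hrs : (r⁻¹).toReal < s) {u : ℝ → ℂ} (hg : MemLp g r volume) (hgm : Measurable g)
    (hug : IsBesselPotential s u g) {τ : ℝ} (hτ : 0 < τ) (x : ℝ) :
    (heatKernel τ).conv u x = ((Real.Gamma (s / 2))⁻¹ : ℝ) *
      ∫ t in Ioi (0 : ℝ), ((t ^ (s / 2 - 1) : ℝ) : ℂ) * (heatKernel (t + τ)).conv g x := by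
  set k := (heatKernel τ).compSubConstCLM ℂ x with hk
  have hs2 : 0 < s / 2 := by linarith
  have h1 := hug (besselPotential (-2 * (s / 2)) k)
  have e1 : besselPotential s (besselPotential (-2 * (s / 2)) k) = k := by
    rw [besselPotential_besselPotential, show s + -2 * (s / 2) = 0 by ring, besselPotential_zero]
  rw [e1] at h1
  have e2 : (heatKernel τ).conv u x = ∫ y, u y * k y := by
    refine integral_congr_ae (.of_forall fun y => ?_)
    simp only [hk, SchwartzMap.compSubConstCLM_apply]
    rw [← heatKernel_neg, neg_sub, mul_comm]
  set F : ℝ → ℝ → ℂ := fun y t =>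
    ((t ^ (s / 2 - 1) : ℝ) : ℂ) * (heatKernel (t + τ) (x - y) * g y) with hF
  have hFm : Measurable (Function.uncurry F) := by
    simp only [hF]
    refine Measurable.mul (f := fun z : ℝ × ℝ => ((z.2 ^ (s / 2 - 1) : ℝ) : ℂ)) (by fun_prop) ?_
    refine Measurable.mul ?_ (hgm.comp measurable_fst)
    exact measurable_heatKernel.comp ((measurable_snd.add_const τ).prodMk
      (measurable_const.sub measurable_fst))
  have e3 : ∫ y, g y * besselPotential (-2 * (s / 2)) k y =
      ((Real.Gamma (s / 2))⁻¹ : ℝ) * ∫ y, ∫ t in Ioi (0 : ℝ), F y t := by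
    rw [← integral_const_mul]
    refine integral_congr_ae (.of_forall fun y => ?_)
    simp only
    rw [besselPotential_neg_apply hs2, mul_left_comm, ← integral_const_mul]
    congr 1
    refine setIntegral_congr_fun measurableSet_Ioi fun t ht => ?_
    simp only [hF, hk]
    rw [heatKernel_conv_heatKernel ht hτ]
    ring
  have hint : Integrable (Function.uncurry F)
      ((volume : Measure ℝ).prod (volume.restrict (Ioi (0 : ℝ)))) := by
    obtain ⟨C, hC⟩ := exists_lintegral_heatKernel_mul_le
    refine ⟨hFm.aestronglyMeasurable, ?_⟩
    rw [HasFiniteIntegral, lintegral_prod_symm' _ hFm.enorm]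
    set b : ℝ := (r⁻¹).toReal / 2 with hb
    have hb0 : 0 ≤ b := by positivity
    have h2 : ∀ t ∈ Ioi (0 : ℝ), ∫⁻ y, ‖Function.uncurry F (y, t)‖ₑ ≤
        ENNReal.ofReal (t ^ (s / 2 - 1) * (Real.exp (-t) * t ^ (-b))) *
          (C * eLpNorm g r volume) := by
      intro t ht
      have ht' : (0 : ℝ) < t := ht
      have h3 := hC r hr (t + τ) (by positivity) g hg.1 x
      simp only [Function.uncurry, hF, enorm_mul (((t ^ (s / 2 - 1) : ℝ) : ℂ))]
      rw [lintegral_const_mul' _ _ enorm_ne_top, ← ofReal_norm, Complex.norm_real,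
        Real.norm_of_nonneg (by positivity), ENNReal.ofReal_mul (by positivity), mul_assoc]
      refine mul_le_mul_right (h3.trans ?_) _
      calc _ ≤ C * ENNReal.ofReal (Real.exp (-t) * t ^ (-b)) * eLpNorm g r volume := by
            refine mul_le_mul_left (mul_le_mul_right (ENNReal.ofReal_le_ofReal ?_) _) _
            exact exp_neg_add_mul_rpow_neg_le ht' hτ.le hb0
        _ = _ := by ring
    refine (setLIntegral_mono' measurableSet_Ioi h2).trans_lt ?_
    rw [lintegral_mul_const _ (by fun_prop)]
    refine ENNReal.mul_lt_top ?_ (ENNReal.mul_lt_top (by simp) hg.2)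
    have h4 := (integrableOn_rpow_mul_exp_neg_mul_rpow_neg (s := s / 2) (b := b)
      (by rw [hb]; linarith)).2
    refine lt_of_le_of_lt (lintegral_mono fun t => ?_) h4
    exact Real.ofReal_le_enorm _
  rw [e2, h1, e3, integral_integral_swap hint]
  congr 1
  refine integral_congr_ae (.of_forall fun t => ?_)
  simp only [hF]
  rw [integral_const_mul]
  rfl

end HeatInput

section Localization

theorem eLpNorm_comp_mul_left_le {r : ℝ≥0∞} (hr : 1 ≤ r) {f : ℝ → ℂ} (hf : Measurable f) {l : ℝ}
    (hl : 0 < l) :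
    eLpNorm (fun x => f (l * x)) r volume ≤ ENNReal.ofReal (max 1 l⁻¹) * eLpNorm f r volume := by
  have h1 : eLpNorm (fun x => f (l * x)) r volume =
      eLpNorm f r (ENNReal.ofReal |l⁻¹| • volume) := by
    rw [← Real.map_volume_mul_left hl.ne', eLpNorm_map_measure hf.aestronglyMeasurable
      (measurable_const_mul l).aemeasurable]
    rfl
  have hl' : 0 < l⁻¹ := inv_pos.2 hl
  rw [h1, eLpNorm_smul_measure_of_ne_zero (by simpa using hl.ne'), smul_eq_mul, abs_of_pos hl']
  gcongr
  have h2 : (1 / r).toReal ≤ 1 := by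
    rw [one_div]
    exact ENNReal.toReal_le_of_le_ofReal zero_le_one (by simpa using hr)
  calc ENNReal.ofReal l⁻¹ ^ (1 / r).toReal
      ≤ ENNReal.ofReal (max 1 l⁻¹) ^ (1 / r).toReal := by
        gcongr; exact le_max_right _ _
    _ ≤ ENNReal.ofReal (max 1 l⁻¹) ^ (1 : ℝ) :=
        ENNReal.rpow_le_rpow_of_exponent_le (by simp) h2
    _ = _ := ENNReal.rpow_one _

theorem norm_iteratedDeriv_mul_le_of_bounded {f g : ℝ → ℂ} (hf : ContDiff ℝ ∞ f)
    (hg : ContDiff ℝ ∞ g) {A : ℝ} {L l : ℕ} (hl : l ≤ L) {x : ℝ}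
    (hA : ∀ i ≤ L, ‖iteratedDeriv i f x‖ ≤ A) :
    ‖iteratedDeriv l (fun y => f y * g y) x‖ ≤
      2 ^ L * A * ∑ i ∈ Finset.range (l + 1), ‖iteratedDeriv i g x‖ := by
  have hA0 : 0 ≤ A := (norm_nonneg _).trans (hA 0 (Nat.zero_le _))
  rw [← norm_iteratedFDeriv_eq_norm_iteratedDeriv]
  refine (norm_iteratedFDeriv_mul_le (n := l) (N := ∞) hf hg x (by exact_mod_cast le_top)).trans ?_
  rw [← Finset.sum_range_reflect (fun i => ‖iteratedDeriv i g x‖), Finset.mul_sum]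
  refine Finset.sum_le_sum fun i hi => ?_
  rw [Finset.mem_range] at hi
  rw [norm_iteratedFDeriv_eq_norm_iteratedDeriv, norm_iteratedFDeriv_eq_norm_iteratedDeriv]
  have e : l + 1 - 1 - i = l - i := by omega
  have h2 : (l.choose i : ℝ) ≤ 2 ^ L := by
    calc (l.choose i : ℝ) ≤ 2 ^ l := by exact_mod_cast Nat.choose_le_two_pow l i
      _ ≤ 2 ^ L := pow_le_pow_right₀ (by norm_num) hl
  rw [e]
  gcongr
  exact hA i (by omega)

theorem HasCompactSupport.exists_norm_iteratedDeriv_le {f : ℝ → ℂ} (hf : HasCompactSupport f)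
    (hf' : ContDiff ℝ ∞ f) (L : ℕ) : ∃ A : ℝ, ∀ i ≤ L, ∀ x, ‖iteratedDeriv i f x‖ ≤ A := by
  choose c hc using fun i => ((hf.toSchwartzMap hf').iterDeriv i).exists_norm_le
  refine ⟨∑ i ∈ Finset.range (L + 1), c i, fun i hi x => ?_⟩
  have h1 := hc i x
  rw [SchwartzMap.coe_iterDeriv] at h1
  refine h1.trans (Finset.single_le_sum (f := c) (fun j _ => ?_) (Finset.mem_range.2 (by omega)))
  exact (norm_nonneg _).trans (hc j 0)

theorem iteratedDeriv_comp_mul {f : ℝ → ℂ} (hf : ContDiff ℝ ∞ f) (l : ℝ) (i : ℕ) (x : ℝ) :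
    ‖iteratedDeriv i (fun y => f (l * y)) x‖ = |l| ^ i * ‖iteratedDeriv i f (l * x)‖ := by
  rw [iteratedDeriv_comp_const_smul (hf.of_le (by exact_mod_cast le_top)), norm_smul, norm_pow,
    Real.norm_eq_abs]

/-- Derivatives of the localized dilate `φ(x) χ(l x) v(l x)`, uniformly for `l` in a compact subset
of `(0, ∞)`. -/
theorem exists_eLpNorm_iteratedDeriv_localized_le {φ χ : ℝ → ℂ} (hφ : HasCompactSupport φ)
    (hφ' : ContDiff ℝ ∞ φ) (hχ : HasCompactSupport χ) (hχ' : ContDiff ℝ ∞ χ) {a b : ℝ} (ha : 0 < a)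
    (L : ℕ) : ∃ C : ℝ≥0, ∀ r : ℝ≥0∞, 1 ≤ r → ∀ l ∈ Icc a b, ∀ δ : ℝ, 0 < δ → δ ≤ 1 →
      ∀ (v : ℝ → ℂ) (_ : ContDiff ℝ ∞ v) (B : ℝ≥0∞),
      (∀ i ≤ L, eLpNorm (iteratedDeriv i v) r volume ≤ B * ENNReal.ofReal (δ ^ (-(i : ℝ) / 2))) →
      ∀ i ≤ L, eLpNorm (iteratedDeriv i (fun x => φ x * χ (l * x) * v (l * x))) r volume ≤
        C * B * ENNReal.ofReal (δ ^ (-(i : ℝ) / 2)) := by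
  obtain ⟨A₁, hA₁⟩ := hφ.exists_norm_iteratedDeriv_le hφ' L
  obtain ⟨A₂, hA₂⟩ := hχ.exists_norm_iteratedDeriv_le hχ' L
  have hA₁0 : 0 ≤ A₁ := (norm_nonneg _).trans (hA₁ 0 (Nat.zero_le _) 0)
  have hA₂0 : 0 ≤ A₂ := (norm_nonneg _).trans (hA₂ 0 (Nat.zero_le _) 0)
  set b' : ℝ := max 1 b ^ L with hb'
  have hb'0 : 0 ≤ b' := by positivity
  set A : ℝ := 2 ^ L * A₁ * ((L + 1) * (b' * A₂)) with hA
  have hA0 : 0 ≤ A := by positivity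
  set D : ℝ≥0 := Real.toNNReal (2 ^ L * A * b') with hD
  refine ⟨D * (Real.toNNReal (max 1 a⁻¹) * (L + 1)), fun r hr l hl δ hδ hδ1 v hv B hvB i hi => ?_⟩
  have hl0 : 0 < l := ha.trans_le hl.1
  have hpow : ∀ j ≤ L, |l| ^ j ≤ b' := by
    intro j hj
    rw [abs_of_pos hl0]
    calc l ^ j ≤ (max 1 b) ^ j := pow_le_pow_left₀ hl0.le (hl.2.trans (le_max_right _ _)) j
      _ ≤ b' := pow_le_pow_right₀ (le_max_left _ _) hj
  have hχl : ContDiff ℝ ∞ (fun x => χ (l * x)) := hχ'.comp (contDiff_const.mul contDiff_id)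
  have hvl : ContDiff ℝ ∞ (fun x => v (l * x)) := hv.comp (contDiff_const.mul contDiff_id)
  have h1 : ∀ j ≤ L, ∀ x, ‖iteratedDeriv j (fun x => φ x * χ (l * x)) x‖ ≤ A := by
    intro j hj x
    refine (norm_iteratedDeriv_mul_le_of_bounded hφ' hχl hj (fun i hi => hA₁ i hi x)).trans ?_
    rw [hA]
    refine mul_le_mul_of_nonneg_left ?_ (by positivity)
    calc ∑ i ∈ Finset.range (j + 1), ‖iteratedDeriv i (fun x => χ (l * x)) x‖
        ≤ ∑ i ∈ Finset.range (j + 1), b' * A₂ := by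
          refine Finset.sum_le_sum fun i hi => ?_
          rw [Finset.mem_range] at hi
          rw [iteratedDeriv_comp_mul hχ']
          exact mul_le_mul (hpow i (by omega)) (hA₂ i (by omega) _) (norm_nonneg _) hb'0
      _ = (j + 1) * (b' * A₂) := by simp
      _ ≤ (L + 1) * (b' * A₂) := by gcongr
  have h2 : ∀ x, ‖iteratedDeriv i (fun x => φ x * χ (l * x) * v (l * x)) x‖ ≤
      D * ‖∑ j ∈ Finset.range (i + 1), ‖iteratedDeriv j v (l * x)‖‖ := by
    intro x
    refine (norm_iteratedDeriv_mul_le_of_bounded (hφ'.mul hχl) hvl hi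
      (fun j hj => h1 j hj x)).trans ?_
    rw [Real.norm_of_nonneg (Finset.sum_nonneg fun _ _ => norm_nonneg _), hD,
      Real.coe_toNNReal _ (by positivity), mul_assoc _ b', Finset.mul_sum _ _ b']
    refine mul_le_mul_of_nonneg_left (Finset.sum_le_sum fun j hj => ?_) (by positivity)
    rw [Finset.mem_range] at hj
    rw [iteratedDeriv_comp_mul hv]
    exact mul_le_mul_of_nonneg_right (hpow j (by omega)) (norm_nonneg _)
  have hcont : ∀ j, Continuous (iteratedDeriv j v) := fun j =>
    hv.continuous_iteratedDeriv j (by exact_mod_cast le_top)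
  have h3 : eLpNorm (fun x => ∑ j ∈ Finset.range (i + 1), ‖iteratedDeriv j v (l * x)‖) r volume ≤
      ∑ j ∈ Finset.range (i + 1), ENNReal.ofReal (max 1 a⁻¹) *
        (B * ENNReal.ofReal (δ ^ (-(i : ℝ) / 2))) := by
    have e : (fun x => ∑ j ∈ Finset.range (i + 1), ‖iteratedDeriv j v (l * x)‖) =
        ∑ j ∈ Finset.range (i + 1), fun x => ‖iteratedDeriv j v (l * x)‖ := by
      funext x; simp
    rw [e]
    refine (eLpNorm_sum_le (fun j _ => ?_) hr).trans (Finset.sum_le_sum fun j hj => ?_)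
    · exact ((hcont j).comp (continuous_const.mul continuous_id)).norm.aestronglyMeasurable
    · rw [Finset.mem_range] at hj
      rw [eLpNorm_norm]
      refine (eLpNorm_comp_mul_left_le hr (hcont j).measurable hl0).trans ?_
      refine mul_le_mul' (ENNReal.ofReal_le_ofReal (max_le_max le_rfl
        (inv_anti₀ ha hl.1))) ((hvB j (by omega)).trans ?_)
      refine mul_le_mul_right (ENNReal.ofReal_le_ofReal
        (Real.rpow_le_rpow_of_exponent_ge hδ hδ1 ?_)) _
      have : (j : ℝ) ≤ i := by exact_mod_cast Nat.lt_succ_iff.1 hj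
      linarith
  refine (eLpNorm_le_nnreal_smul_eLpNorm_of_ae_le_mul (c := D)
    (g := fun x => ∑ j ∈ Finset.range (i + 1), ‖iteratedDeriv j v (l * x)‖)
    (.of_forall fun x => ?_) r).trans ?_
  · exact_mod_cast h2 x
  · rw [ENNReal.smul_def, smul_eq_mul]
    refine (mul_le_mul_right h3 _).trans ?_
    rw [Finset.sum_const, Finset.card_range, nsmul_eq_mul]
    push_cast
    have : ((i : ℝ≥0∞) + 1) ≤ L + 1 := by gcongr
    calc (D : ℝ≥0∞) * ((i + 1) * (ENNReal.ofReal (max 1 a⁻¹) *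
          (B * ENNReal.ofReal (δ ^ (-(i : ℝ) / 2)))))
        ≤ (D : ℝ≥0∞) * ((L + 1) * (ENNReal.ofReal (max 1 a⁻¹) *
          (B * ENNReal.ofReal (δ ^ (-(i : ℝ) / 2))))) := by gcongr
      _ = _ := by simp only [ENNReal.ofReal]; ring

end Localization

section Bump

theorem exists_subset_Icc_of_isCompact {K : Set ℝ} (hK : IsCompact K) (hK' : K ⊆ Ioi 0) :
    ∃ a b : ℝ, 0 < a ∧ a ≤ b ∧ K ⊆ Icc a b := by
  rcases K.eq_empty_or_nonempty with rfl | hne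
  · exact ⟨1, 1, one_pos, le_rfl, empty_subset _⟩
  · exact ⟨sInf K, sSup K, hK' (hK.sInf_mem hne),
      Real.sInf_le_sSup K hK.bddBelow hK.bddAbove,
      fun x hx => ⟨csInf_le hK.bddBelow hx, le_csSup hK.bddAbove hx⟩⟩

/-- The points of a geometric progression in a compact subset of `(0, ∞)` have bounded gaps. -/
theorem exists_abs_sub_le_of_exp_mul_mem_Icc {η a b : ℝ} (hη : 0 < η) (ha : 0 < a) :
    ∃ N : ℕ, ∀ (x : ℝ) (k l : ℤ), Real.exp (-(k * η)) * x ∈ Icc a b →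
      Real.exp (-(l * η)) * x ∈ Icc a b → |k - l| ≤ N := by
  obtain ⟨N, hN⟩ := exists_nat_ge ((Real.log b - Real.log a) / η)
  have key : ∀ (x : ℝ) (k l : ℤ), Real.exp (-(k * η)) * x ∈ Icc a b →
      Real.exp (-(l * η)) * x ∈ Icc a b → k - l ≤ N := by
    intro x k l hk hl
    have hx : 0 < x := by
      have := ha.trans_le hk.1
      exact pos_of_mul_pos_right this (Real.exp_pos _).le
    have h1 := Real.log_le_log ha hk.1
    have h2 := Real.log_le_log (ha.trans_le hl.1) hl.2
    rw [Real.log_mul (Real.exp_pos _).ne' hx.ne', Real.log_exp] at h1 h2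
    have h3 : ((k - l : ℤ) : ℝ) ≤ (N : ℤ) := by
      rw [div_le_iff₀ hη] at hN
      push_cast
      have : ((k : ℝ) - l) * η ≤ N * η := by linarith
      exact le_of_mul_le_mul_right this hη
    exact_mod_cast h3
  exact ⟨N, fun x k l hk hl => abs_sub_le_iff.2 ⟨key x k l hk hl, key x l k hl hk⟩⟩

theorem exists_card_filter_exp_mul_mem_Icc_le {η a b : ℝ} (hη : 0 < η) (ha : 0 < a) :
    ∃ N : ℕ, ∀ (x : ℝ) (S : Finset ℤ),
      (∀ k ∈ S, Real.exp (-(k * η)) * x ∈ Icc a b) → S.card ≤ N := by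
  obtain ⟨N, hN⟩ := exists_abs_sub_le_of_exp_mul_mem_Icc (b := b) hη ha
  refine ⟨2 * N + 1, fun x S hS => ?_⟩
  rcases S.eq_empty_or_nonempty with rfl | ⟨k, hk⟩
  · simp
  · have h1 : S ⊆ Finset.Icc (k - N) (k + N) := by
      intro l hl
      have := abs_le.1 (hN x k l (hS k hk) (hS l hl))
      rw [Finset.mem_Icc]
      omega
    refine (Finset.card_le_card h1).trans ?_
    rw [Int.card_Icc]
    omega

/-- A smooth partition of unity subordinate to the dilates of a bump function. -/
theorem IsSlocBump.exists_partition {φ : ℝ → ℂ} (hφ : IsSlocBump φ) :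
    ∃ (η : ℝ) (χ : ℝ → ℂ), 0 < η ∧ ContDiff ℝ ∞ χ ∧ HasCompactSupport χ ∧ tsupport χ ⊆ Ioi 0 ∧
      ∀ x : ℝ, 0 < x → ∀ᶠ n : ℕ in Filter.atTop, ∑ k ∈ Finset.Icc (-n : ℤ) n,
        χ (Real.exp (-(k * η)) * x) * φ (Real.exp (-(k * η)) * x) = 1 := by
  obtain ⟨a, b, ha, -, hab⟩ := exists_subset_Icc_of_isCompact hφ.hasCompactSupport
    hφ.tsupport_subset
  have hsupp : ∀ x, φ x ≠ 0 → x ∈ Icc a b := fun x hx => hab (subset_tsupport φ hx)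
  obtain ⟨x₀, hx₀⟩ := Function.ne_iff.1 hφ.ne_zero
  have hx₀p : 0 < x₀ := ha.trans_le (hsupp x₀ hx₀).1
  obtain ⟨η, hη, hηφ⟩ : ∃ η > 0, ∀ t : ℝ, |t| < η → φ (x₀ * Real.exp t) ≠ 0 := by
    have hc : ContinuousAt (fun t : ℝ => φ (x₀ * Real.exp t)) 0 :=
      (hφ.smooth.continuous.comp (by fun_prop : Continuous fun t : ℝ => x₀ * Real.exp t)).continuousAt
    have : ∀ᶠ t in nhds (0 : ℝ), φ (x₀ * Real.exp t) ≠ 0 :=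
      hc.eventually_ne (by simpa using hx₀)
    obtain ⟨η, hη, h⟩ := Metric.eventually_nhds_iff.1 this
    exact ⟨η, hη, fun t ht => h (by simpa using ht)⟩
  obtain ⟨N, hN⟩ := exists_abs_sub_le_of_exp_mul_mem_Icc (b := b) hη ha
  have hex : ∀ x : ℝ, 0 < x → ∃ k : ℤ, φ (Real.exp (-(k * η)) * x) ≠ 0 := by
    intro x hx
    refine ⟨round (Real.log (x / x₀) / η), ?_⟩
    set k := round (Real.log (x / x₀) / η) with hk
    have h1 := abs_sub_round (Real.log (x / x₀) / η)
    have h2 := hηφ (Real.log (x / x₀) - k * η) (by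
      have : Real.log (x / x₀) - k * η = (Real.log (x / x₀) / η - k) * η := by field_simp
      rw [this, abs_mul, abs_of_pos hη]
      nlinarith)
    have e : x₀ * Real.exp (Real.log (x / x₀) - k * η) = Real.exp (-(k * η)) * x := by
      rw [sub_eq_add_neg, Real.exp_add, Real.exp_log (by positivity)]
      field_simp
    rwa [e] at h2
  set D : ℝ → ℝ := fun x => ∑ j ∈ Finset.Icc (-N : ℤ) N, ‖φ (Real.exp (-(j * η)) * x)‖ ^ 2 with hD
  have hDs : ContDiff ℝ ∞ D := by
    refine ContDiff.sum fun j _ => ?_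
    exact (hφ.smooth.comp (contDiff_const.mul contDiff_id)).norm_sq ℂ
  have hDpos : ∀ x ∈ Icc a b, D x ≠ 0 := by
    intro x hx
    obtain ⟨k, hk⟩ := hex x (ha.trans_le hx.1)
    have h1 := hN x k 0 (hsupp _ hk) (by simpa using hx)
    rw [sub_zero, abs_le] at h1
    refine (lt_of_lt_of_le (by positivity : 0 < ‖φ (Real.exp (-(k * η)) * x)‖ ^ 2) ?_).ne'
    exact Finset.single_le_sum (f := fun j : ℤ => ‖φ (Real.exp (-(j * η)) * x)‖ ^ 2)
      (fun _ _ => sq_nonneg _) (Finset.mem_Icc.2 h1)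
  set χ : ℝ → ℂ := fun x => starRingEnd ℂ (φ x) * ((D x)⁻¹ : ℝ) with hχ
  have hχsupp : Function.support χ ⊆ Function.support φ := by
    intro x hx hx'
    apply hx
    rw [hχ]; simp [hx']
  have hχt : tsupport χ ⊆ tsupport φ := closure_mono hχsupp
  refine ⟨η, χ, hη, ?_, hφ.hasCompactSupport.mono hχsupp, hχt.trans hφ.tsupport_subset, ?_⟩
  · rw [contDiff_iff_contDiffAt]
    intro x
    by_cases hx : x ∈ tsupport φ
    · have h1 : ContDiffAt ℝ ∞ (fun x => ((D x)⁻¹ : ℝ)) x :=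
        hDs.contDiffAt.inv (hDpos x (hab hx))
      exact (Complex.conjCLE.contDiff.contDiffAt.comp x hφ.smooth.contDiffAt).mul
        (Complex.ofRealCLM.contDiff.contDiffAt.comp x h1)
    · have : χ =ᶠ[nhds x] fun _ => 0 := notMem_tsupport_iff_eventuallyEq.1 fun h => hx (hχt h)
      exact contDiffAt_const.congr_of_eventuallyEq this
  · intro x hx
    obtain ⟨k₀, hk₀⟩ := hex x hx
    have hfin : ∀ k : ℤ, φ (Real.exp (-(k * η)) * x) ≠ 0 → |k - k₀| ≤ N :=
      fun k hk => hN x k k₀ (hsupp _ hk) (hsupp _ hk₀)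
    set f : ℤ → ℝ := fun k => ‖φ (Real.exp (-(k * η)) * x)‖ ^ 2 with hf
    have hf0 : ∀ k, f k ≠ 0 → φ (Real.exp (-(k * η)) * x) ≠ 0 := by
      intro k hk h
      apply hk; simp [hf, h]
    refine Filter.eventually_atTop.2 ⟨k₀.natAbs + N, fun n hn => ?_⟩
    have hT : ∑ᶠ l, f l = ∑ l ∈ Finset.Icc (-n : ℤ) n, f l := by
      refine finsum_eq_sum_of_support_subset _ fun k hk => ?_
      have := abs_le.1 (hfin k (hf0 k hk))
      rw [Finset.coe_Icc, mem_Icc]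
      omega
    have hDk : ∀ k : ℤ, φ (Real.exp (-(k * η)) * x) ≠ 0 →
        D (Real.exp (-(k * η)) * x) = ∑ᶠ l, f l := by
      intro k hk
      rw [← finsum_comp_equiv (Equiv.addRight k)]
      symm
      have e : ∀ j : ℤ, f (Equiv.addRight k j) =
          ‖φ (Real.exp (-(j * η)) * (Real.exp (-(k * η)) * x))‖ ^ 2 := by
        intro j
        rw [hf, ← mul_assoc, ← Real.exp_add]
        simp only [Equiv.coe_addRight]
        push_cast
        ring_nf
      simp only [hD, ← e]
      refine finsum_eq_sum_of_support_subset _ fun j hj => ?_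
      have h2 := abs_le.1 (hN x (j + k) k (hsupp _ (hf0 _ hj)) (hsupp _ hk))
      rw [Finset.coe_Icc, mem_Icc]
      omega
    have hT0 : ∑ᶠ l, f l ≠ 0 := by
      rw [← hDk k₀ hk₀]
      exact hDpos _ (hsupp _ hk₀)
    have hterm : ∀ k : ℤ, χ (Real.exp (-(k * η)) * x) * φ (Real.exp (-(k * η)) * x) =
        ((f k * (∑ᶠ l, f l)⁻¹ : ℝ) : ℂ) := by
      intro k
      by_cases hk : φ (Real.exp (-(k * η)) * x) = 0
      · simp [hf, hk]
      · simp only [hχ, hDk k hk, hf]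
        push_cast
        rw [mul_right_comm, Complex.conj_mul']
    rw [Finset.sum_congr rfl fun k _ => hterm k, ← Complex.ofReal_sum, ← Finset.sum_mul, ← hT,
      mul_inv_cancel₀ hT0, Complex.ofReal_one]


/-- The superposition `∑ k ∈ S, χ(e^{-kη} x) v_k(e^{-kη} x)` of dilated bumps. -/
noncomputable def multiplierSum (χ : ℝ → ℂ) (η : ℝ) (S : Finset ℤ) (v : ℤ → ℝ → ℂ) (x : ℝ) : ℂ :=
  ∑ k ∈ S, χ (Real.exp (-(k * η)) * x) * v k (Real.exp (-(k * η)) * x)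

theorem isMultiplierAwayFromZero_multiplierSum {χ : ℝ → ℂ} (hχ : Continuous χ)
    (hχc : HasCompactSupport χ) (hχs : tsupport χ ⊆ Ioi 0) (η : ℝ) (S : Finset ℤ)
    {v : ℤ → ℝ → ℂ} (hv : ∀ k, Continuous (v k)) :
    IsMultiplierAwayFromZero (multiplierSum χ η S v) := by
  obtain ⟨a, b, ha, -, hab⟩ := exists_subset_Icc_of_isCompact hχc hχs
  refine ⟨continuous_finsetSum _ fun k _ => ?_, ?_⟩
  · have : Continuous fun x : ℝ => Real.exp (-(k * η)) * x := continuous_const.mul continuous_id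
    exact (hχ.comp this).mul ((hv k).comp this)
  · have h1 : ∀ᶠ ε in nhdsWithin (0 : ℝ) (Ioi 0), ∀ k ∈ S, Real.exp (-(k * η)) * ε < a := by
      rw [Filter.eventually_all_finset]
      intro k _
      have hc : ContinuousAt (fun x : ℝ => Real.exp (-(k * η)) * x) 0 :=
        (continuous_const.mul continuous_id).continuousAt
      exact (hc.eventually_lt_const (by simpa using ha)).filter_mono nhdsWithin_le_nhds
    obtain ⟨ε, hε, hε0⟩ := (h1.and self_mem_nhdsWithin).exists
    refine ⟨ε, hε0, fun x hx => Finset.sum_eq_zero fun k hk => ?_⟩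
    have h2 : χ (Real.exp (-(k * η)) * x) = 0 := by
      by_contra h
      have h3 := (hab (subset_tsupport χ h)).1
      have h4 := hε k hk
      have : Real.exp (-(k * η)) * x < Real.exp (-(k * η)) * ε :=
        mul_lt_mul_of_pos_left hx (Real.exp_pos _)
      linarith
    rw [h2, zero_mul]

/-- At each point only boundedly many terms of a `multiplierSum` are nonzero. -/
theorem exists_norm_multiplierSum_le {χ : ℝ → ℂ} (hχ : Continuous χ)
    (hχc : HasCompactSupport χ) (hχs : tsupport χ ⊆ Ioi 0) {η : ℝ} (hη : 0 < η) :
    ∃ C : ℝ, 0 ≤ C ∧ ∀ (S : Finset ℤ) (v : ℤ → ℝ → ℂ) (B : ℝ), (∀ k x, ‖v k x‖ ≤ B) →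
      ∀ x, ‖multiplierSum χ η S v x‖ ≤ C * B := by
  obtain ⟨a, b, ha, -, hab⟩ := exists_subset_Icc_of_isCompact hχc hχs
  obtain ⟨N, hN⟩ := exists_card_filter_exp_mul_mem_Icc_le (b := b) hη ha
  obtain ⟨M, hM⟩ := hχ.bounded_above_of_compact_support hχc
  have hM0 : 0 ≤ M := (norm_nonneg _).trans (hM 0)
  refine ⟨N * M, by positivity, fun S v B hB x => ?_⟩
  have hB0 : 0 ≤ B := (norm_nonneg _).trans (hB 0 0)
  classical
  set S' := S.filter fun k : ℤ => Real.exp (-(k * η)) * x ∈ Icc a b with hS'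
  have e : multiplierSum χ η S v x =
      ∑ k ∈ S', χ (Real.exp (-(k * η)) * x) * v k (Real.exp (-(k * η)) * x) := by
    refine (Finset.sum_subset (Finset.filter_subset _ _) fun k hk hk' => ?_).symm
    have h2 : χ (Real.exp (-(k * η)) * x) = 0 := by
      by_contra h
      exact hk' (Finset.mem_filter.2 ⟨hk, hab (subset_tsupport χ h)⟩)
    rw [h2, zero_mul]
  have hc : S'.card ≤ N := hN x S' fun k hk => (Finset.mem_filter.1 hk).2
  rw [e]
  calc _ ≤ S'.card • (M * B) := by
        refine (norm_sum_le _ _).trans (Finset.sum_le_card_nsmul _ _ _ fun k _ => ?_)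
        rw [norm_mul]
        exact mul_le_mul (hM _) (hB _ _) (norm_nonneg _) hM0
    _ ≤ N * (M * B) := by
        rw [nsmul_eq_mul]
        gcongr
    _ = _ := by ring

theorem exists_eLpNorm_iteratedDeriv_conv_heatKernel_le (L : ℕ) : ∃ C : ℝ≥0, ∀ r : ℝ≥0∞, 1 ≤ r →
    ∀ t : ℝ, 0 < t → ∀ g : ℝ → ℂ, Measurable g → Integrable g → ∀ i ≤ L,
      eLpNorm (iteratedDeriv i ((heatKernel t).conv g)) r volume ≤
        C * ENNReal.ofReal (Real.exp (-t)) * eLpNorm g r volume *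
          ENNReal.ofReal ((min t 1) ^ (-(i : ℝ) / 2)) := by
  choose c hc using exists_eLpNorm_iterDeriv_heatKernel_le
  refine ⟨∑ i ∈ Finset.range (L + 1), c i, fun r hr t ht g hg hgi i hi => ?_⟩
  rw [SchwartzMap.iteratedDeriv_conv _ hgi]
  refine (SchwartzMap.eLpNorm_conv_le hr _ hg).trans ?_
  have h1 : c i ≤ ∑ i ∈ Finset.range (L + 1), c i :=
    Finset.single_le_sum (f := c) (fun j _ => zero_le) (Finset.mem_range.2 (by omega))
  have h2 : t ^ (-(i : ℝ) / 2) ≤ (min t 1) ^ (-(i : ℝ) / 2) := by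
    refine Real.rpow_le_rpow_of_nonpos (lt_min ht one_pos) (min_le_left _ _) ?_
    have : (0 : ℝ) ≤ i := Nat.cast_nonneg i
    linarith
  calc _ ≤ c i * ENNReal.ofReal (Real.exp (-t) * t ^ (-(i : ℝ) / 2)) * eLpNorm g r volume := by
        gcongr; exact hc i t ht
    _ ≤ ((∑ i ∈ Finset.range (L + 1), c i : ℝ≥0) : ℝ≥0∞) *
        ENNReal.ofReal (Real.exp (-t) * (min t 1) ^ (-(i : ℝ) / 2)) * eLpNorm g r volume := by
        gcongr
    _ = _ := by
        rw [ENNReal.ofReal_mul (Real.exp_pos _).le]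
        ring

/-- The scale-invariant Sobolev norm of a superposition of heat-regularized pieces. -/
theorem exists_slocNorm_multiplierSum_le {φ χ : ℝ → ℂ} (hφ : IsSlocBump φ) (hχ : ContDiff ℝ ∞ χ)
    (hχc : HasCompactSupport χ) (hχs : tsupport χ ⊆ Ioi 0) {η : ℝ} (hη : 0 < η) {s : ℝ}
    (hs : 0 < s) : ∃ C : ℝ≥0, ∀ r : ℝ≥0∞, 1 ≤ r → ∀ t : ℝ, 0 < t → ∀ (S : Finset ℤ)
      (g : ℤ → ℝ → ℂ) (G : ℝ≥0∞), (∀ k, Measurable (g k)) → (∀ k, Integrable (g k)) →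
      (∀ k, eLpNorm (g k) r volume ≤ G) →
      slocNorm φ r s (multiplierSum χ η S fun k => (heatKernel t).conv (g k)) ≤
        C * ENNReal.ofReal (Real.exp (-t) * (min t 1) ^ (-s / 2)) * G := by
  obtain ⟨M, hM⟩ := exists_nat_gt (s / 2)
  have hsM : s < 2 * M := by linarith
  obtain ⟨α, β, hα, hαβ, hab⟩ := exists_subset_Icc_of_isCompact hφ.hasCompactSupport
    hφ.tsupport_subset
  obtain ⟨α', β', hα', hαβ', hab'⟩ := exists_subset_Icc_of_isCompact hχc hχs
  have hβ : 0 < β := hα.trans_le hαβ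
  set a := α' / β with ha
  set b := β' / α with hb
  have ha0 : 0 < a := by positivity
  obtain ⟨N, hN⟩ := exists_card_filter_exp_mul_mem_Icc_le (b := b) hη ha0
  obtain ⟨c₁, hc₁⟩ := exists_sobolevNorm_le M hs hsM
  obtain ⟨c₂, hc₂⟩ := exists_eLpNorm_iteratedDeriv_localized_le hφ.hasCompactSupport hφ.smooth hχc
    hχ (b := b) ha0 (2 * M)
  obtain ⟨c₃, hc₃⟩ := exists_eLpNorm_iteratedDeriv_conv_heatKernel_le (2 * M)
  refine ⟨c₁ * (N * (c₂ * c₃)), fun r hr t ht S g G hgm hgi hgG => iSup₂_le fun R hR => ?_⟩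
  set δ := min t 1 with hδ
  have hδ0 : 0 < δ := lt_min ht one_pos
  have hδ1 : δ ≤ 1 := min_le_right _ _
  classical
  set l : ℤ → ℝ := fun k => Real.exp (-(k * η)) * R with hl
  set S' := S.filter fun k : ℤ => l k ∈ Icc a b with hS'
  set v : ℤ → ℝ → ℂ := fun k => (heatKernel t).conv (g k) with hv
  have hvs : ∀ k, ContDiff ℝ ∞ (v k) := fun k => SchwartzMap.contDiff_conv _ (hgi k)
  set w : ℤ → ℝ → ℂ := fun k x => φ x * χ (l k * x) * v k (l k * x) with hw
  have hws : ∀ k, ContDiff ℝ ∞ (w k) := fun k =>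
    (hφ.smooth.mul (hχ.comp (contDiff_const.mul contDiff_id))).mul
      ((hvs k).comp (contDiff_const.mul contDiff_id))
  have e : (fun x => φ x * multiplierSum χ η S v (R * x)) = fun x => ∑ k ∈ S', w k x := by
    funext x
    have h1 : ∀ k : ℤ, φ x * (χ (Real.exp (-(k * η)) * (R * x)) *
        v k (Real.exp (-(k * η)) * (R * x))) = w k x := by
      intro k
      simp only [hw, hl, mul_assoc]
    rw [multiplierSum, Finset.mul_sum, Finset.sum_congr rfl fun k _ => h1 k]
    refine (Finset.sum_subset (Finset.filter_subset _ _) fun k hk hk' => ?_).symm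
    have h2 : φ x * χ (l k * x) = 0 := by
      by_contra h
      have hx := hab (subset_tsupport φ (left_ne_zero_of_mul h))
      have hx' := hab' (subset_tsupport χ (right_ne_zero_of_mul h))
      have hl0 : 0 < l k := mul_pos (Real.exp_pos _) hR
      refine hk' (Finset.mem_filter.2 ⟨hk, ?_, ?_⟩)
      · rw [ha, div_le_iff₀ hβ]
        exact hx'.1.trans (mul_le_mul_of_nonneg_left hx.2 hl0.le)
      · rw [hb, le_div_iff₀ hα]
        exact (mul_le_mul_of_nonneg_left hx.1 hl0.le).trans hx'.2
    simp only [hw, h2, zero_mul]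
  have hc : S'.card ≤ N := hN R S' fun k hk => (Finset.mem_filter.1 hk).2
  have hcs : HasCompactSupport fun x => ∑ k ∈ S', w k x := by
    refine hφ.hasCompactSupport.mono fun x hx h => hx ?_
    refine Finset.sum_eq_zero fun k _ => ?_
    simp only [hw, h, zero_mul]
  have hsm : ContDiff ℝ ∞ fun x => ∑ k ∈ S', w k x := ContDiff.sum fun k _ => hws k
  rw [e]
  set B : ℝ≥0∞ := c₃ * ENNReal.ofReal (Real.exp (-t)) * G with hB
  have h1 := hc₁ r hr δ hδ0 hδ1 (hcs.toSchwartzMap hsm) (N * (c₂ * B)) fun i hi => by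
    rw [SchwartzMap.coe_iterDeriv]
    change eLpNorm (iteratedDeriv i fun x => ∑ k ∈ S', w k x) r volume ≤ _
    have e2 : (iteratedDeriv i fun x => ∑ k ∈ S', w k x) = ∑ k ∈ S', iteratedDeriv i (w k) := by
      funext x
      rw [iteratedDeriv_fun_sum fun k _ =>
        ((hws k).of_le (by exact_mod_cast le_top)).contDiffAt, Finset.sum_apply]
    rw [e2]
    refine (eLpNorm_sum_le (fun k _ => ((hws k).continuous_iteratedDeriv i
      (by exact_mod_cast le_top)).aestronglyMeasurable) hr).trans ?_
    calc _ ≤ S'.card • (c₂ * B * ENNReal.ofReal (δ ^ (-(i : ℝ) / 2))) := by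
          refine Finset.sum_le_card_nsmul _ _ _ fun k hk => ?_
          refine hc₂ r hr (l k) (Finset.mem_filter.1 hk).2 δ hδ0 hδ1 (v k) (hvs k) B ?_ i hi
          intro j hj
          refine (hc₃ r hr t ht (g k) (hgm k) (hgi k) j hj).trans ?_
          rw [hB]
          gcongr
          exact hgG k
      _ ≤ N * (c₂ * B * ENNReal.ofReal (δ ^ (-(i : ℝ) / 2))) := by
          rw [nsmul_eq_mul]
          gcongr
      _ = _ := by ring
  refine h1.trans (le_of_eq ?_)
  rw [hB, ENNReal.ofReal_mul (Real.exp_pos _).le]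
  push_cast
  ring

end Bump

section Strip

/-- Entire functions that are bounded on the strip `0 ≤ Re z ≤ 1`. -/
structure IsEntireBoundedOnStrip (F : ℂ → ℂ) : Prop where
  differentiable : Differentiable ℂ F
  bounded : ∃ B : ℝ, ∀ z : ℂ, z.re ∈ Icc (0 : ℝ) 1 → ‖F z‖ ≤ B

namespace IsEntireBoundedOnStrip

variable {F G : ℂ → ℂ}

theorem const (c : ℂ) : IsEntireBoundedOnStrip fun _ => c :=
  ⟨differentiable_const c, ‖c‖, fun _ _ => le_rfl⟩

theorem mul (hF : IsEntireBoundedOnStrip F) (hG : IsEntireBoundedOnStrip G) :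
    IsEntireBoundedOnStrip fun z => F z * G z := by
  obtain ⟨A, hA⟩ := hF.bounded
  obtain ⟨B, hB⟩ := hG.bounded
  refine ⟨hF.differentiable.mul hG.differentiable, A * B, fun z hz => ?_⟩
  rw [norm_mul]
  exact mul_le_mul (hA z hz) (hB z hz) (norm_nonneg _) ((norm_nonneg _).trans (hA z hz))

theorem sum {ι : Type*} {s : Finset ι} {F : ι → ℂ → ℂ}
    (hF : ∀ i ∈ s, IsEntireBoundedOnStrip (F i)) :
    IsEntireBoundedOnStrip fun z => ∑ i ∈ s, F i z := by
  have h : ∀ i, ∃ B : ℝ, i ∈ s → ∀ z : ℂ, z.re ∈ Icc (0 : ℝ) 1 → ‖F i z‖ ≤ B := by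
    intro i
    by_cases hi : i ∈ s
    · obtain ⟨B, hB⟩ := (hF i hi).bounded
      exact ⟨B, fun _ => hB⟩
    · exact ⟨0, fun h => absurd h hi⟩
  choose B hB using h
  refine ⟨Differentiable.fun_sum fun i hi => (hF i hi).differentiable, ∑ i ∈ s, B i,
    fun z hz => (norm_sum_le _ _).trans (Finset.sum_le_sum fun i hi => hB i hi z hz)⟩

theorem norm_le (hF : IsEntireBoundedOnStrip F) {A₀ A₁ : ℝ} (h₀ : ∀ z : ℂ, z.re = 0 → ‖F z‖ ≤ A₀)
    (h₁ : ∀ z : ℂ, z.re = 1 → ‖F z‖ ≤ A₁) {θ : ℝ} (hθ₀ : 0 ≤ θ) (hθ₁ : θ ≤ 1) :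
    ‖F θ‖ ≤ A₀ ^ (1 - θ) * A₁ ^ θ := by
  obtain ⟨B, hB⟩ := hF.bounded
  have := Complex.HadamardThreeLines.norm_le_interp_of_mem_verticalClosedStrip₀₁' F (z := θ)
    (a := A₀) (b := A₁) (by simpa [Complex.HadamardThreeLines.verticalClosedStrip] using ⟨hθ₀, hθ₁⟩)
    hF.differentiable.diffContOnCl ⟨B, by rintro _ ⟨z, hz, rfl⟩; exact hB z hz⟩
    (fun z hz => h₀ z hz) (fun z hz => h₁ z hz)
  simpa using this

end IsEntireBoundedOnStrip

/-- The power `(w / |w|) |w|^e` of the modulus of `w`, with the phase of `w`. -/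
noncomputable def polarPow (e w : ℂ) : ℂ :=
  if w = 0 then 0 else w / ‖w‖ * Complex.exp (e * Real.log ‖w‖)

theorem polarPow_zero (e : ℂ) : polarPow e 0 = 0 := if_pos rfl

theorem polarPow_one (w : ℂ) : polarPow 1 w = w := by
  rw [polarPow]
  split_ifs with h
  · exact h.symm
  · have h' : (‖w‖ : ℂ) ≠ 0 := by simpa using h
    rw [one_mul, ← Complex.ofReal_exp, Real.exp_log (norm_pos_iff.2 h), div_mul_cancel₀ _ h']

theorem norm_polarPow_le (e w : ℂ) : ‖polarPow e w‖ ≤ ‖w‖ ^ e.re := by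
  rw [polarPow]
  split_ifs with h
  · rw [norm_zero]; positivity
  · have h0 := norm_pos_iff.2 h
    rw [norm_mul, norm_div, Complex.norm_real, norm_norm, div_self h0.ne', one_mul,
      Complex.norm_exp, Complex.re_mul_ofReal, Real.rpow_def_of_pos h0, mul_comm]

theorem conj_polarPow (e w : ℂ) :
    starRingEnd ℂ (polarPow e w) = polarPow (starRingEnd ℂ e) (starRingEnd ℂ w) := by
  rw [polarPow, polarPow]
  simp only [map_eq_zero]
  split_ifs with h
  · simp
  · rw [map_mul, map_div₀, Complex.conj_ofReal, ← Complex.exp_conj, map_mul, Complex.conj_ofReal,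
      RCLike.norm_conj]

/-- The affine function with values `a₀` at `0` and `a₁` at `1`. -/
noncomputable def affineExponent (a₀ a₁ : ℝ) (z : ℂ) : ℂ := (1 - z) * a₀ + z * a₁

theorem affineExponent_re (a₀ a₁ : ℝ) (z : ℂ) :
    (affineExponent a₀ a₁ z).re = (1 - z.re) * a₀ + z.re * a₁ := by
  simp [affineExponent]

theorem conj_affineExponent (a₀ a₁ : ℝ) (z : ℂ) :
    starRingEnd ℂ (affineExponent a₀ a₁ z) = affineExponent a₀ a₁ (starRingEnd ℂ z) := by
  simp [affineExponent]

theorem isEntireBoundedOnStrip_polarPow (a₀ a₁ : ℝ) (w : ℂ) :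
    IsEntireBoundedOnStrip fun z => polarPow (affineExponent a₀ a₁ z) w := by
  by_cases hw : w = 0
  · simp only [hw, polarPow_zero]
    exact .const 0
  · refine ⟨?_, Real.exp ((|a₀| + |a₁|) * |Real.log ‖w‖|), fun z hz => ?_⟩
    · simp only [polarPow, if_neg hw, affineExponent]
      fun_prop
    · have h0 := norm_pos_iff.2 hw
      refine (norm_polarPow_le _ _).trans ?_
      rw [Real.rpow_def_of_pos h0, Real.exp_le_exp, mul_comm]
      refine (le_abs_self _).trans ?_
      rw [abs_mul, affineExponent_re]
      refine mul_le_mul_of_nonneg_right ((abs_add_le _ _).trans ?_) (abs_nonneg _)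
      rw [abs_mul, abs_mul, abs_of_nonneg hz.1, abs_of_nonneg (sub_nonneg.2 hz.2)]
      have h1 := abs_nonneg a₀
      have h2 := abs_nonneg a₁
      nlinarith [hz.1, hz.2]

theorem exists_interpolation_exponents {θ : ℝ} (hθ₀ : 0 < θ) (hθ₁ : θ < 1) {q q₀ q₁ : ℝ≥0∞}
    (hq₀ : q₀ ≠ 0) (hq₁ : q₁ ≠ 0)
    (h : q⁻¹ = ENNReal.ofReal (1 - θ) * q₀⁻¹ + ENNReal.ofReal θ * q₁⁻¹) :
    ∃ a₀ a₁ : ℝ, 0 ≤ a₀ ∧ 0 ≤ a₁ ∧ q₀⁻¹ = ENNReal.ofReal a₀ * q⁻¹ ∧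
      q₁⁻¹ = ENNReal.ofReal a₁ * q⁻¹ ∧ (1 - θ) * a₀ + θ * a₁ = 1 := by
  have hθ' : 0 < 1 - θ := by linarith
  have ht₀ : q₀⁻¹ ≠ ⊤ := by simpa using hq₀
  have ht₁ : q₁⁻¹ ≠ ⊤ := by simpa using hq₁
  lift q₀⁻¹ to ℝ≥0 using ht₀ with x₀
  lift q₁⁻¹ to ℝ≥0 using ht₁ with x₁
  have hx : q⁻¹ = ENNReal.ofReal ((1 - θ) * x₀ + θ * x₁) := by
    rw [h, ENNReal.ofReal_add (by positivity) (by positivity), ENNReal.ofReal_mul hθ'.le,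
      ENNReal.ofReal_mul hθ₀.le, ENNReal.ofReal_coe_nnreal, ENNReal.ofReal_coe_nnreal]
  set y : ℝ := (1 - θ) * x₀ + θ * x₁ with hy
  rw [hx]
  have hy0 : 0 ≤ y := by positivity
  rcases hy0.eq_or_lt with h0 | h0
  · have e₀ : (x₀ : ℝ) = 0 := by
      have : 0 ≤ θ * (x₁ : ℝ) := by positivity
      have h2 : 0 ≤ (1 - θ) * (x₀ : ℝ) := by positivity
      have h3 : (1 - θ) * (x₀ : ℝ) = 0 := by linarith
      exact (mul_eq_zero.1 h3).resolve_left hθ'.ne'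
    have e₁ : (x₁ : ℝ) = 0 := by
      rw [e₀, mul_zero, zero_add] at hy
      rw [← h0] at hy
      exact (mul_eq_zero.1 hy.symm).resolve_left hθ₀.ne'
    refine ⟨1, 1, zero_le_one, zero_le_one, ?_, ?_, by ring⟩
    · rw [← h0, NNReal.coe_eq_zero.1 e₀]; simp
    · rw [← h0, NNReal.coe_eq_zero.1 e₁]; simp
  · refine ⟨x₀ / y, x₁ / y, by positivity, by positivity, ?_, ?_, ?_⟩
    · rw [← ENNReal.ofReal_mul (by positivity), div_mul_cancel₀ _ h0.ne', ENNReal.ofReal_coe_nnreal]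
    · rw [← ENNReal.ofReal_mul (by positivity), div_mul_cancel₀ _ h0.ne', ENNReal.ofReal_coe_nnreal]
    · rw [hy] at h0 ⊢
      field_simp

end Strip

section SimplePieces

open Classical in
/-- The part of a simple function where it takes the value `a`. -/
noncomputable def MeasureTheory.SimpleFunc.piece {α : Type*} [MeasurableSpace α]
    (f : SimpleFunc α ℂ) (a : ℂ) : SimpleFunc α ℂ :=
  f.map fun w => if w = a then w else 0

variable {α : Type*} [MeasurableSpace α] {μ : Measure α}

theorem MeasureTheory.SimpleFunc.apply_eq_sum_piece (f : SimpleFunc α ℂ) {G : ℂ → ℂ}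
    (hG : G 0 = 0) (x : α) : G (f x) = ∑ a ∈ f.range, (G a / a) * f.piece a x := by
  rw [Finset.sum_eq_single (f x)]
  · simp only [SimpleFunc.piece, SimpleFunc.map_apply, if_true]
    by_cases h : f x = 0
    · simp [h, hG]
    · field_simp
  · intro a _ ha
    simp [SimpleFunc.piece, ha.symm]
  · intro h
    exact absurd (f.mem_range_self x) h

theorem MeasureTheory.SimpleFunc.memLp_piece {f : SimpleFunc α ℂ} {p : ℝ≥0∞} (hf : MemLp f p μ)
    (a : ℂ) : MemLp (f.piece a) p μ := by
  refine hf.mono (f.piece a).aestronglyMeasurable (.of_forall fun x => ?_)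
  simp only [SimpleFunc.piece, SimpleFunc.map_apply]
  split_ifs <;> simp

theorem MeasureTheory.SimpleFunc.memLp_map {f : SimpleFunc α ℂ} {p : ℝ≥0∞} (hf : MemLp f p μ)
    {G : ℂ → ℂ} (hG : G 0 = 0) : MemLp (f.map G) p μ := by
  have e : ⇑(f.map G) = fun x => ∑ a ∈ f.range, (G a / a) * f.piece a x := by
    funext x
    rw [SimpleFunc.map_apply, f.apply_eq_sum_piece hG]
  rw [e]
  exact memLp_finsetSum _ fun a _ => (SimpleFunc.memLp_piece hf a).const_mul _

theorem MeasureTheory.SimpleFunc.toLp_map {f : SimpleFunc α ℂ} {p : ℝ≥0∞} (hf : MemLp f p μ)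
    {G : ℂ → ℂ} (hG : G 0 = 0) : (SimpleFunc.memLp_map hf hG).toLp (f.map G) =
      ∑ a ∈ f.range, (G a / a) • (SimpleFunc.memLp_piece hf a).toLp (f.piece a) := by
  refine Lp.ext ?_
  have h1 : ∀ᵐ x ∂μ, ∀ a ∈ f.range,
      ((G a / a) • (SimpleFunc.memLp_piece hf a).toLp (f.piece a) : Lp ℂ p μ) x =
        (G a / a) * f.piece a x := by
    rw [Filter.eventually_all_finset]
    intro a _
    filter_upwards [Lp.coeFn_smul (G a / a) ((SimpleFunc.memLp_piece hf a).toLp (f.piece a)),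
      (SimpleFunc.memLp_piece hf a).coeFn_toLp] with x hx hx'
    rw [hx, Pi.smul_apply, hx', smul_eq_mul]
  filter_upwards [(SimpleFunc.memLp_map hf hG).coeFn_toLp,
    Lp.coeFn_finsetSum f.range fun a => (G a / a) •
      (SimpleFunc.memLp_piece hf a).toLp (f.piece a), h1] with x hx hx' hx1
  rw [hx, hx', Finset.sum_apply, SimpleFunc.map_apply, f.apply_eq_sum_piece hG]
  exact (Finset.sum_congr rfl hx1).symm

end SimplePieces

section MultilinearInterpolation

theorem SchwartzMap.conv_sum {ι : Type*} (k : 𝓢(ℝ, ℂ)) (s : Finset ι) (c : ι → ℂ)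
    {g : ι → ℝ → ℂ} (hg : ∀ i ∈ s, Integrable (g i)) (x : ℝ) :
    k.conv (fun y => ∑ i ∈ s, c i * g i y) x = ∑ i ∈ s, c i * k.conv (g i) x := by
  simp only [SchwartzMap.conv, Finset.mul_sum]
  rw [integral_finsetSum]
  · refine Finset.sum_congr rfl fun i _ => ?_
    rw [← integral_const_mul]
    congr 1; funext y; ring
  · intro i hi
    have := (k.integrable_sub_mul (hg i hi) x).const_mul (c i)
    refine this.congr (.of_forall fun y => ?_)
    ring

theorem exists_norm_conv_heatKernel_le_of_integrable {t : ℝ} (ht : 0 < t) {g : ℝ → ℂ}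
    (hg : Integrable g) : ∃ B : ℝ, ∀ x, ‖(heatKernel t).conv g x‖ ≤ B := by
  obtain ⟨C, -, hC⟩ := exists_norm_conv_heatKernel_le
  exact ⟨_, fun x => hC 1 le_rfl g (memLp_one_iff_integrable.2 hg) t ht x⟩

variable {X : Type*} [MeasurableSpace X] {μ : Measure X}

/-- The analytic family of simple functions through `f` used in the complex interpolation
method. -/
noncomputable def MeasureTheory.SimpleFunc.analyticFamily {α : Type*} [MeasurableSpace α]
    (f : SimpleFunc α ℂ) (a : ℝ × ℝ) (z : ℂ) : SimpleFunc α ℂ :=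
  f.map (polarPow (affineExponent a.1 a.2 z))

theorem MeasureTheory.SimpleFunc.analyticFamily_eq_self {α : Type*} [MeasurableSpace α]
    (f : SimpleFunc α ℂ) {a : ℝ × ℝ} {θ : ℝ} (ha : (1 - θ) * a.1 + θ * a.2 = 1) :
    f.analyticFamily a θ = f := by
  ext x
  have : affineExponent a.1 a.2 θ = 1 := by
    rw [affineExponent]; exact_mod_cast ha
  rw [analyticFamily, SimpleFunc.map_apply, this, polarPow_one]

theorem MeasureTheory.SimpleFunc.eLpNorm_analyticFamily_le {α : Type*} [MeasurableSpace α]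
    {ν : Measure α} (f : SimpleFunc α ℂ) {a : ℝ × ℝ} {z : ℂ} {b : ℝ} (hb : 0 ≤ b)
    (hz : (1 - z.re) * a.1 + z.re * a.2 = b) {q q₀ : ℝ≥0∞} (hq : q ≠ 0) (hq₀ : q₀ ≠ 0)
    (h : q₀⁻¹ = ENNReal.ofReal b * q⁻¹) (hf : eLpNorm f q ν ≤ 1) :
    eLpNorm (f.analyticFamily a z) q₀ ν ≤ 1 := by
  refine eLpNorm_le_one_of_norm_le_rpow hq hq₀ hb h hf fun x => ?_
  rw [analyticFamily, SimpleFunc.map_apply, ← hz, ← affineExponent_re]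
  exact norm_polarPow_le _ _

theorem MeasureTheory.SimpleFunc.memLp_analyticFamily {α : Type*} [MeasurableSpace α]
    {ν : Measure α} {f : SimpleFunc α ℂ} {q : ℝ≥0∞} (hf : MemLp f q ν) (a : ℝ × ℝ) (z : ℂ) :
    MemLp (f.analyticFamily a z) q ν :=
  SimpleFunc.memLp_map hf (polarPow_zero _)

open MeasureTheory.SimpleFunc in
theorem isEntireBoundedOnStrip_inner {h f : SimpleFunc X ℂ} (hh : MemLp h 2 μ) (hf : MemLp f 2 μ)
    (a b : ℝ × ℝ) (T : Lp ℂ 2 μ →L[ℂ] Lp ℂ 2 μ) :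
    IsEntireBoundedOnStrip fun z =>
      ⟪(memLp_analyticFamily hh b (starRingEnd ℂ z)).toLp (h.analyticFamily b (starRingEnd ℂ z)),
        T ((memLp_analyticFamily hf a z).toLp (f.analyticFamily a z))⟫_ℂ := by
  have e : ∀ z : ℂ, ⟪(memLp_analyticFamily hh b (starRingEnd ℂ z)).toLp
        (h.analyticFamily b (starRingEnd ℂ z)),
        T ((memLp_analyticFamily hf a z).toLp (f.analyticFamily a z))⟫_ℂ =
      ∑ u ∈ h.range, ∑ v ∈ f.range,
        polarPow (affineExponent b.1 b.2 z) (starRingEnd ℂ u) *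
        (polarPow (affineExponent a.1 a.2 z) v *
          ((starRingEnd ℂ u)⁻¹ * v⁻¹ *
            ⟪(memLp_piece hh u).toLp (h.piece u), T ((memLp_piece hf v).toLp (f.piece v))⟫_ℂ)) := by
    intro z
    have e1 := toLp_map hh (polarPow_zero (affineExponent b.1 b.2 (starRingEnd ℂ z)))
    have e2 := toLp_map hf (polarPow_zero (affineExponent a.1 a.2 z))
    change ⟪(memLp_map hh (polarPow_zero _)).toLp (h.map _),
      T ((memLp_map hf (polarPow_zero _)).toLp (f.map _))⟫_ℂ = _
    rw [e1, e2, map_sum, sum_inner]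
    refine Finset.sum_congr rfl fun u _ => ?_
    rw [inner_sum]
    refine Finset.sum_congr rfl fun v _ => ?_
    rw [map_smul, inner_smul_left, inner_smul_right, map_div₀, conj_polarPow, conj_affineExponent,
      Complex.conj_conj]
    ring
  simp only [e]
  refine .sum fun u _ => .sum fun v _ => ?_
  exact (isEntireBoundedOnStrip_polarPow _ _ _).mul
    ((isEntireBoundedOnStrip_polarPow _ _ _).mul (.const _))

theorem multiplierSum_analyticFamily {χ : ℝ → ℂ} (η : ℝ) (S : Finset ℤ) {g : ℤ → SimpleFunc ℝ ℂ}
    (hg : ∀ k, Integrable (g k)) (c : ℝ × ℝ) (K : 𝓢(ℝ, ℂ)) (z : ℂ) :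
    (multiplierSum χ η S fun k => K.conv ((g k).analyticFamily c z)) = fun x =>
      ∑ i ∈ S.sigma fun k => (g k).range,
        (polarPow (affineExponent c.1 c.2 z) i.2 / i.2) *
          multiplierSum χ η {i.1} (fun k => K.conv ((g k).piece i.2)) x := by
  funext x
  rw [multiplierSum, Finset.sum_sigma]
  refine Finset.sum_congr rfl fun k _ => ?_
  have e : ⇑((g k).analyticFamily c z) = fun y => ∑ a ∈ (g k).range,
      (polarPow (affineExponent c.1 c.2 z) a / a) * (g k).piece a y := by
    funext y
    exact (g k).apply_eq_sum_piece (polarPow_zero _) y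
  rw [e, SchwartzMap.conv_sum _ _ _ fun a _ => memLp_one_iff_integrable.1
    (SimpleFunc.memLp_piece (memLp_one_iff_integrable.2 (hg k)) a), Finset.mul_sum]
  refine Finset.sum_congr rfl fun a _ => ?_
  rw [multiplierSum, Finset.sum_singleton]
  ring

theorem measurable_multiplierSum {χ : ℝ → ℂ} (hχ : Measurable χ) (η : ℝ) (S : Finset ℤ)
    {v : ℤ → ℝ → ℂ} (hv : ∀ k, Measurable (v k)) : Measurable (multiplierSum χ η S v) := by
  refine Finset.measurable_fun_sum _ fun k _ => ?_
  have : Measurable fun x : ℝ => Real.exp (-(k * η)) * x := measurable_const_mul _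
  exact (hχ.comp this).mul ((hv k).comp this)

open MeasureTheory.SimpleFunc in
theorem isEntireBoundedOnStrip_crossIntegral (E : ResolutionOfIdentity (Lp ℂ 2 μ))
    {χ : ℝ → ℂ} (hχ : Continuous χ) (hχc : HasCompactSupport χ) (η : ℝ) (S : Finset ℤ)
    {g : ℤ → SimpleFunc ℝ ℂ} (hg : ∀ k, Integrable (g k)) {t : ℝ} (ht : 0 < t)
    {h f : SimpleFunc X ℂ} (hh : MemLp h 2 μ) (hf : MemLp f 2 μ) (a b c : ℝ × ℝ) :
    IsEntireBoundedOnStrip fun z => E.crossIntegral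
      (multiplierSum χ η S fun k => (heatKernel t).conv ((g k).analyticFamily c z))
      ((memLp_analyticFamily hh b (starRingEnd ℂ z)).toLp (h.analyticFamily b (starRingEnd ℂ z)))
      ((memLp_analyticFamily hf a z).toLp (f.analyticFamily a z)) := by
  have hgp : ∀ k w, Integrable ((g k).piece w) := fun k w => memLp_one_iff_integrable.1
    (SimpleFunc.memLp_piece (memLp_one_iff_integrable.2 (hg k)) w)
  have hm : ∀ i : Σ _ : ℤ, ℂ, Measurable
      (multiplierSum χ η {i.1} fun k => (heatKernel t).conv ((g k).piece i.2)) := fun i =>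
    measurable_multiplierSum hχ.measurable _ _ fun k =>
      (SchwartzMap.contDiff_conv _ (hgp k i.2)).continuous.measurable
  have hB : ∀ i : Σ _ : ℤ, ℂ, ∃ B : ℝ, ∀ x,
      ‖multiplierSum χ η {i.1} (fun k => (heatKernel t).conv ((g k).piece i.2)) x‖ ≤ B := by
    intro i
    obtain ⟨M, hM⟩ := hχ.bounded_above_of_compact_support hχc
    obtain ⟨B, hB⟩ := exists_norm_conv_heatKernel_le_of_integrable ht (hgp i.1 i.2)
    refine ⟨M * B, fun x => ?_⟩
    rw [multiplierSum, Finset.sum_singleton, norm_mul]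
    exact mul_le_mul (hM _) (hB _) (norm_nonneg _) ((norm_nonneg _).trans (hM 0))
  choose T hT using fun i => E.exists_isIntegral (hm i) (hB i).choose_spec
  simp only [multiplierSum_analyticFamily η S hg c]
  simp only [E.crossIntegral_sum _ _ (fun i _ => hm i) (fun i _ => hB i), ← (hT _).inner_eq]
  refine .sum fun i _ => .mul ?_ (isEntireBoundedOnStrip_inner hh hf a b (T i))
  simp only [div_eq_mul_inv]
  exact (isEntireBoundedOnStrip_polarPow _ _ _).mul (.const _)

theorem eLpNorm_le_lpOpNorm {p : ℝ≥0∞} (T : Lp ℂ 2 μ →L[ℂ] Lp ℂ 2 μ) {f : Lp ℂ 2 μ}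
    (hf : eLpNorm f p μ ≤ 1) : eLpNorm (T f) p μ ≤ lpOpNorm μ p T := by
  refine le_iInf₂ fun K hK => (hK f ⟨Lp.aestronglyMeasurable f, hf.trans_lt ENNReal.one_lt_top⟩).trans
    ?_
  exact (mul_le_mul_right hf _).trans (mul_one _).le

theorem enorm_inner_le_eLpNorm_mul {p q : ℝ≥0∞} (hpq : p⁻¹ + q⁻¹ = 1) (h f : Lp ℂ 2 μ) :
    ‖⟪h, f⟫_ℂ‖ₑ ≤ eLpNorm h q μ * eLpNorm f p μ := by
  have : ENNReal.HolderTriple q p 1 := ⟨by rw [add_comm, hpq, inv_one]⟩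
  have h1 := eLpNorm_le_eLpNorm_mul_eLpNorm_of_nnnorm (p := q) (q := p) (r := 1)
    (Lp.aestronglyMeasurable h) (Lp.aestronglyMeasurable f) (fun u v : ℂ => ⟪u, v⟫_ℂ) 1
    (.of_forall fun x => by rw [one_mul]; exact nnnorm_inner_le_nnnorm _ _)
  rw [ENNReal.coe_one, one_mul] at h1
  refine le_trans ?_ h1
  rw [L2.inner_def, eLpNorm_one_eq_lintegral_enorm]
  exact enorm_integral_le_lintegral_enorm _

/-- The bilinear form of a multiplier estimate. -/
theorem MultiplierEstimate.enorm_crossIntegral_le {L : Lp ℂ 2 μ →ₗ.[ℂ] Lp ℂ 2 μ} {φ : ℝ → ℂ}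
    {p q r : ℝ≥0∞} {s : ℝ} {C : ℝ≥0} (hL : MultiplierEstimate L φ p r s C)
    {E : ResolutionOfIdentity (Lp ℂ 2 μ)} (hE : E.IsResolutionOf L) (hpq : p⁻¹ + q⁻¹ = 1)
    {m : ℝ → ℂ} (hm : IsMultiplierAwayFromZero m) {B : ℝ≥0∞} (hB : B ≠ ⊤)
    (hmB : slocNorm φ r s m ≤ B) {h f : X → ℂ} (hh : MemLp h 2 μ) (hf : MemLp f 2 μ)
    (hh' : eLpNorm h q μ ≤ 1) (hf' : eLpNorm f p μ ≤ 1) :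
    ‖E.crossIntegral m (hh.toLp h) (hf.toLp f)‖ₑ ≤ C * B := by
  obtain ⟨T, hT, hTn⟩ := hL m hm (hmB.trans_lt hB.lt_top) E hE
  rw [← hT.inner_eq]
  refine (enorm_inner_le_eLpNorm_mul hpq _ _).trans ?_
  rw [eLpNorm_congr_ae hh.coeFn_toLp]
  calc _ ≤ 1 * lpOpNorm μ p T := by
        refine mul_le_mul' hh' (eLpNorm_le_lpOpNorm T ?_)
        rwa [eLpNorm_congr_ae hf.coeFn_toLp]
    _ ≤ C * B := by
        rw [one_mul]
        exact hTn.trans (mul_le_mul_right hmB _)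

open MeasureTheory.SimpleFunc in
/-- Complex interpolation between two multiplier estimates, for simple functions. -/
theorem exists_norm_crossIntegral_multiplierSum_le_of_simpleFunc {L : Lp ℂ 2 μ →ₗ.[ℂ] Lp ℂ 2 μ}
    {φ χ : ℝ → ℂ} (hφ : IsSlocBump φ) (hχ : ContDiff ℝ ∞ χ) (hχc : HasCompactSupport χ)
    (hχs : tsupport χ ⊆ Ioi 0) {η : ℝ} (hη : 0 < η) {θ s₀ s₁ : ℝ} (hθ₀ : 0 < θ) (hθ₁ : θ < 1)
    (hs₀ : 0 < s₀) (hs₁ : 0 < s₁) (C₀ C₁ : ℝ≥0) :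
    ∃ C : ℝ, 0 ≤ C ∧ ∀ p₀ p₁ q₀ q₁ r₀ r₁ p q r : ℝ≥0∞,
      p₀⁻¹ + q₀⁻¹ = 1 → p₁⁻¹ + q₁⁻¹ = 1 → 1 ≤ r₀ → 1 ≤ r₁ →
      p⁻¹ = ENNReal.ofReal (1 - θ) * p₀⁻¹ + ENNReal.ofReal θ * p₁⁻¹ →
      q⁻¹ = ENNReal.ofReal (1 - θ) * q₀⁻¹ + ENNReal.ofReal θ * q₁⁻¹ →
      r⁻¹ = ENNReal.ofReal (1 - θ) * r₀⁻¹ + ENNReal.ofReal θ * r₁⁻¹ →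
      MultiplierEstimate L φ p₀ r₀ s₀ C₀ → MultiplierEstimate L φ p₁ r₁ s₁ C₁ →
      ∀ E : ResolutionOfIdentity (Lp ℂ 2 μ), E.IsResolutionOf L → ∀ t : ℝ, 0 < t →
      ∀ (S : Finset ℤ) (g : ℤ → SimpleFunc ℝ ℂ), (∀ k, Integrable (g k)) →
      (∀ k, eLpNorm (g k) r volume ≤ 1) →
      ∀ (h f : SimpleFunc X ℂ) (hh : MemLp h 2 μ) (hf : MemLp f 2 μ),
      eLpNorm h q μ ≤ 1 → eLpNorm f p μ ≤ 1 →
      ‖E.crossIntegral (multiplierSum χ η S fun k => (heatKernel t).conv (g k))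
        (hh.toLp h) (hf.toLp f)‖ ≤
        C * (Real.exp (-t) * (min t 1) ^ (-((1 - θ) * s₀ + θ * s₁) / 2)) := by
  obtain ⟨c₀, hc₀⟩ := exists_slocNorm_multiplierSum_le hφ hχ hχc hχs hη hs₀
  obtain ⟨c₁, hc₁⟩ := exists_slocNorm_multiplierSum_le hφ hχ hχc hχs hη hs₁
  have hθ' : 0 < 1 - θ := by linarith
  refine ⟨(C₀ * c₀ : ℝ) ^ (1 - θ) * (C₁ * c₁ : ℝ) ^ θ, by positivity, ?_⟩
  intro p₀ p₁ q₀ q₁ r₀ r₁ p q r hpq₀ hpq₁ hr₀ hr₁ hp hq hr hE₀ hE₁ E hE t ht S g hg hgr h f hh hf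
    hhq hfp
  have hne : ∀ {x y : ℝ≥0∞}, x⁻¹ + y⁻¹ = 1 → x ≠ 0 := by
    rintro x y hxy rfl; simp at hxy
  have hne' : ∀ {x y : ℝ≥0∞}, x⁻¹ + y⁻¹ = 1 → y ≠ 0 := by
    rintro x y hxy rfl; simp at hxy
  have hr₀0 : r₀ ≠ 0 := (zero_lt_one.trans_le hr₀).ne'
  have hr₁0 : r₁ ≠ 0 := (zero_lt_one.trans_le hr₁).ne'
  have hne0 : ∀ {x x₀ x₁ : ℝ≥0∞}, x₀ ≠ 0 → x₁ ≠ 0 →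
      x⁻¹ = ENNReal.ofReal (1 - θ) * x₀⁻¹ + ENNReal.ofReal θ * x₁⁻¹ → x ≠ 0 := by
    intro x x₀ x₁ h0 h1 hx
    rw [← ENNReal.inv_ne_top, hx]
    exact ENNReal.add_ne_top.2 ⟨ENNReal.mul_ne_top ENNReal.ofReal_ne_top (ENNReal.inv_ne_top.2 h0),
      ENNReal.mul_ne_top ENNReal.ofReal_ne_top (ENNReal.inv_ne_top.2 h1)⟩
  have hp0 := hne0 (hne hpq₀) (hne hpq₁) hp
  have hq0 := hne0 (hne' hpq₀) (hne' hpq₁) hq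
  have hr0 := hne0 hr₀0 hr₁0 hr
  obtain ⟨a₀, a₁, ha₀, ha₁, hpa₀, hpa₁, ha⟩ :=
    exists_interpolation_exponents hθ₀ hθ₁ (hne hpq₀) (hne hpq₁) hp
  obtain ⟨b₀, b₁, hb₀, hb₁, hqb₀, hqb₁, hb⟩ :=
    exists_interpolation_exponents hθ₀ hθ₁ (hne' hpq₀) (hne' hpq₁) hq
  obtain ⟨d₀, d₁, hd₀, hd₁, hrd₀, hrd₁, hd⟩ :=
    exists_interpolation_exponents hθ₀ hθ₁ hr₀0 hr₁0 hr
  have hreg := isEntireBoundedOnStrip_crossIntegral E hχ.continuous hχc η S hg ht hh hf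
    (a₀, a₁) (b₀, b₁) (d₀, d₁)
  set δ := min t 1 with hδ
  have hδ0 : 0 < δ := lt_min ht one_pos
  have hgi : ∀ z k, Integrable ((g k).analyticFamily (d₀, d₁) z) := fun z k =>
    memLp_one_iff_integrable.1 (memLp_analyticFamily (memLp_one_iff_integrable.2 (hg k)) _ z)
  have hmul : ∀ z, IsMultiplierAwayFromZero (multiplierSum χ η S fun k =>
      (heatKernel t).conv ((g k).analyticFamily (d₀, d₁) z)) := fun z =>
    isMultiplierAwayFromZero_multiplierSum hχ.continuous hχc hχs η S fun k =>
      (SchwartzMap.contDiff_conv _ (hgi z k)).continuous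
  have hbound : ∀ (s : ℝ) (c C : ℝ≥0), 0 ≤ (C : ℝ) * c * (Real.exp (-t) * δ ^ (-s / 2)) ∧
      (C : ℝ≥0∞) * (c * ENNReal.ofReal (Real.exp (-t) * δ ^ (-s / 2)) * 1) =
        ENNReal.ofReal (C * c * (Real.exp (-t) * δ ^ (-s / 2))) := by
    intro s c C
    refine ⟨by positivity, ?_⟩
    rw [ENNReal.ofReal_mul (p := (C * c : ℝ)) (by positivity), ENNReal.ofReal_mul C.coe_nonneg,
      ENNReal.ofReal_coe_nnreal, ENNReal.ofReal_coe_nnreal]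
    ring
  have hres := hreg.norm_le (θ := θ) (A₀ := C₀ * c₀ * (Real.exp (-t) * δ ^ (-s₀ / 2)))
    (A₁ := C₁ * c₁ * (Real.exp (-t) * δ ^ (-s₁ / 2))) ?_ ?_ hθ₀.le hθ₁.le
  · simp only [Complex.conj_ofReal] at hres
    simp only [analyticFamily_eq_self _ (a := (a₀, a₁)) ha, analyticFamily_eq_self _ (a := (b₀, b₁)) hb,
      analyticFamily_eq_self _ (a := (d₀, d₁)) hd] at hres
    refine hres.trans (le_of_eq ?_)
    rw [Real.mul_rpow (by positivity) (by positivity), Real.mul_rpow (x := (C₁ * c₁ : ℝ))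
      (by positivity) (by positivity), Real.mul_rpow (x := Real.exp (-t)) (by positivity)
      (by positivity), Real.mul_rpow (x := Real.exp (-t)) (by positivity) (by positivity),
      ← Real.rpow_mul hδ0.le, ← Real.rpow_mul hδ0.le]
    have e1 : Real.exp (-t) = Real.exp (-t) ^ (1 - θ) * Real.exp (-t) ^ θ := by
      rw [← Real.rpow_add (Real.exp_pos _), sub_add_cancel, Real.rpow_one]
    have e2 : δ ^ (-((1 - θ) * s₀ + θ * s₁) / 2) =
        δ ^ (-s₀ / 2 * (1 - θ)) * δ ^ (-s₁ / 2 * θ) := by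
      rw [← Real.rpow_add hδ0]
      congr 1; ring
    rw [e2]
    nth_rw 3 [e1]
    ring
  · intro z hz
    have h1 := hE₀.enorm_crossIntegral_le hE hpq₀ (hmul z) (B := c₀ * ENNReal.ofReal
      (Real.exp (-t) * δ ^ (-s₀ / 2)) * 1) (by finiteness)
      (hc₀ r₀ hr₀ t ht S _ 1 (fun k => SimpleFunc.measurable _) (hgi z) fun k =>
        eLpNorm_analyticFamily_le _ hd₀ (by simp [hz]) hr0 hr₀0 hrd₀ (hgr k))
      (memLp_analyticFamily hh (b₀, b₁) (starRingEnd ℂ z)) (memLp_analyticFamily hf (a₀, a₁) z)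
      (eLpNorm_analyticFamily_le _ hb₀ (by simp [hz]) hq0 (hne' hpq₀) hqb₀ hhq)
      (eLpNorm_analyticFamily_le _ ha₀ (by simp [hz]) hp0 (hne hpq₀) hpa₀ hfp)
    rw [(hbound s₀ c₀ C₀).2, ← ofReal_norm, ENNReal.ofReal_le_ofReal_iff (hbound s₀ c₀ C₀).1] at h1
    exact h1
  · intro z hz
    have h1 := hE₁.enorm_crossIntegral_le hE hpq₁ (hmul z) (B := c₁ * ENNReal.ofReal
      (Real.exp (-t) * δ ^ (-s₁ / 2)) * 1) (by finiteness)
      (hc₁ r₁ hr₁ t ht S _ 1 (fun k => SimpleFunc.measurable _) (hgi z) fun k =>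
        eLpNorm_analyticFamily_le _ hd₁ (by simp [hz]) hr0 hr₁0 hrd₁ (hgr k))
      (memLp_analyticFamily hh (b₀, b₁) (starRingEnd ℂ z)) (memLp_analyticFamily hf (a₀, a₁) z)
      (eLpNorm_analyticFamily_le _ hb₁ (by simp [hz]) hq0 (hne' hpq₁) hqb₁ hhq)
      (eLpNorm_analyticFamily_le _ ha₁ (by simp [hz]) hp0 (hne hpq₁) hpa₁ hfp)
    rw [(hbound s₁ c₁ C₁).2, ← ofReal_norm, ENNReal.ofReal_le_ofReal_iff (hbound s₁ c₁ C₁).1] at h1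
    exact h1

end MultilinearInterpolation

section Extension

variable {X : Type*} [MeasurableSpace X] {μ : Measure X}

theorem lpOpNorm_le_of_normalized_simpleFunc {p q : ℝ≥0∞} (hp : 1 < p) (hpt : p ≠ ⊤)
    (hpq : p⁻¹ + q⁻¹ = 1) (T : Lp ℂ 2 μ →L[ℂ] Lp ℂ 2 μ) (K : ℝ≥0)
    (hT : ∀ (h f : SimpleFunc X ℂ) (hh : MemLp h 2 μ) (hf : MemLp f 2 μ),
      eLpNorm h q μ ≤ 1 → eLpNorm f p μ ≤ 1 → ‖⟪hh.toLp h, T (hf.toLp f)⟫_ℂ‖ₑ ≤ K) :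
    lpOpNorm μ p T ≤ K := by
  have hp0 : p ≠ 0 := (zero_lt_one.trans hp).ne'
  have hq0 : q ≠ 0 := by
    rintro rfl; simp at hpq
  have hfin : ∀ (r : ℝ≥0∞) {f : SimpleFunc X ℂ}, MemLp f 2 μ → eLpNorm f r μ ≠ ⊤ :=
    fun r f hf => (SimpleFunc.memLp_of_finite_measure_preimage r
      ((SimpleFunc.memLp_iff (by simp) (by simp)).1 hf)).2.ne
  have hscale : ∀ {r : ℝ≥0∞} {f : SimpleFunc X ℂ}, MemLp f 2 μ → eLpNorm f r μ ≠ 0 →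
      eLpNorm (f.map fun w => (((eLpNorm f r μ).toReal⁻¹ : ℝ) : ℂ) * w) r μ ≤ 1 := by
    intro r f hf h0
    have ht := hfin r hf
    have h1 := ENNReal.toReal_pos h0 ht
    change eLpNorm ((((eLpNorm f r μ).toReal⁻¹ : ℝ) : ℂ) • ⇑f) r μ ≤ 1
    rw [eLpNorm_const_smul, ← ofReal_norm, Complex.norm_real, Real.norm_of_nonneg (by positivity),
      ENNReal.ofReal_inv_of_pos h1, ENNReal.ofReal_toReal ht, ENNReal.inv_mul_cancel h0 ht]
  refine lpOpNorm_le_of_simpleFunc hp hpt hpq T K fun h f hh hf => ?_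
  have hzero : ∀ {r : ℝ≥0∞} {f : SimpleFunc X ℂ} (hf : MemLp f 2 μ), r ≠ 0 →
      eLpNorm f r μ = 0 → hf.toLp f = 0 := by
    intro r f hf hr h0
    rw [eLpNorm_eq_zero_iff f.aestronglyMeasurable hr] at h0
    exact (MemLp.toLp_congr hf MemLp.zero h0).trans (MemLp.toLp_zero _)
  by_cases hh0 : eLpNorm h q μ = 0
  · simp [hzero hh hq0 hh0]
  by_cases hf0 : eLpNorm f p μ = 0
  · simp [hzero hf hp0 hf0]
  set x := (eLpNorm h q μ).toReal with hx
  set y := (eLpNorm f p μ).toReal with hy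
  have hx0 : 0 < x := ENNReal.toReal_pos hh0 (hfin q hh)
  have hy0 : 0 < y := ENNReal.toReal_pos hf0 (hfin p hf)
  have h1 := hT (h.map fun w => ((x⁻¹ : ℝ) : ℂ) * w) (f.map fun w => ((y⁻¹ : ℝ) : ℂ) * w)
    (hh.const_mul _) (hf.const_mul _) (hscale hh hh0) (hscale hf hf0)
  have e1 : (hh.const_mul ((x⁻¹ : ℝ) : ℂ)).toLp (h.map fun w => ((x⁻¹ : ℝ) : ℂ) * w) =
      ((x⁻¹ : ℝ) : ℂ) • hh.toLp h := MemLp.toLp_const_smul ((x⁻¹ : ℝ) : ℂ) hh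
  have e2 : (hf.const_mul ((y⁻¹ : ℝ) : ℂ)).toLp (f.map fun w => ((y⁻¹ : ℝ) : ℂ) * w) =
      ((y⁻¹ : ℝ) : ℂ) • hf.toLp f := MemLp.toLp_const_smul ((y⁻¹ : ℝ) : ℂ) hf
  rw [e1, e2, map_smul, inner_smul_left, inner_smul_right, Complex.conj_ofReal, ← ofReal_norm,
    norm_mul, norm_mul, Complex.norm_real, Complex.norm_real, Real.norm_of_nonneg (by positivity),
    Real.norm_of_nonneg (by positivity)] at h1
  have h2 := ENNReal.ofReal_le_iff_le_toReal (by simp) |>.1 h1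
  rw [← ENNReal.ofReal_toReal (hfin q hh), ← ENNReal.ofReal_toReal (hfin p hf), ← hx, ← hy,
    ← ofReal_norm, ← ENNReal.ofReal_mul hx0.le, ← ENNReal.ofReal_coe_nnreal,
    ← ENNReal.ofReal_mul K.coe_nonneg]
  refine ENNReal.ofReal_le_ofReal ?_
  rw [ENNReal.coe_toReal] at h2
  calc _ = x * y * (x⁻¹ * (y⁻¹ * ‖⟪hh.toLp h, T (hf.toLp f)⟫_ℂ‖)) := by field_simp
    _ ≤ x * y * K := by gcongr
    _ = _ := by ring

theorem ResolutionOfIdentity.crossIntegral_const_mul {H : Type*} [NormedAddCommGroup H]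
    [InnerProductSpace ℂ H] [CompleteSpace H] (E : ResolutionOfIdentity H) (c : ℂ) (m : ℝ → ℂ)
    (h f : H) : E.crossIntegral (fun x => c * m x) h f = c * E.crossIntegral m h f := by
  simp only [crossIntegral, integral_const_mul]
  ring

theorem multiplierSum_const_mul (χ : ℝ → ℂ) (η : ℝ) (S : Finset ℤ) (c : ℂ) (v : ℤ → ℝ → ℂ)
    (x : ℝ) : multiplierSum χ η S (fun k y => c * v k y) x = c * multiplierSum χ η S v x := by
  simp only [multiplierSum, Finset.mul_sum]
  exact Finset.sum_congr rfl fun k _ => by ring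

theorem SchwartzMap.conv_const_mul (k : 𝓢(ℝ, ℂ)) (c : ℂ) (g : ℝ → ℂ) (x : ℝ) :
    k.conv (fun y => c * g y) x = c * k.conv g x := by
  simp only [SchwartzMap.conv, ← integral_const_mul]
  congr 1; funext y; ring

/-- Pointwise approximation of a measurable function by integrable simple functions dominated by
twice its modulus. -/
theorem exists_simpleFunc_tendsto {g : ℝ → ℂ} (hg : Measurable g) :
    ∃ u : ℕ → SimpleFunc ℝ ℂ, (∀ n, Integrable (u n)) ∧ (∀ n x, ‖u n x‖ ≤ 2 * ‖g x‖) ∧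
      ∀ x, Filter.Tendsto (fun n => u n x) Filter.atTop (nhds (g x)) := by
  set w : ℕ → SimpleFunc ℝ ℂ := SimpleFunc.approxOn g hg univ 0 (mem_univ _) with hw
  have hwx : ∀ n x, ‖w n x‖ ≤ 2 * ‖g x‖ := by
    intro n x
    rw [two_mul]
    exact SimpleFunc.norm_approxOn_zero_le hg (mem_univ _) x n
  refine ⟨fun n => (w n).restrict (Icc (-n : ℝ) n), fun n => ?_, fun n x => ?_, fun x => ?_⟩
  · rw [SimpleFunc.coe_restrict _ measurableSet_Icc, integrable_indicator_iff measurableSet_Icc]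
    have : IsFiniteMeasure (volume.restrict (Icc (-n : ℝ) n)) := ⟨by simp⟩
    exact (w n).integrable_of_isFiniteMeasure
  · rw [SimpleFunc.coe_restrict _ measurableSet_Icc]
    exact (norm_indicator_le_norm_self _ _).trans (hwx n x)
  · have h1 := SimpleFunc.tendsto_approxOn hg (mem_univ (0 : ℂ)) (x := x) (by simp)
    refine h1.congr' ?_
    obtain ⟨N, hN⟩ := exists_nat_ge |x|
    filter_upwards [Filter.eventually_ge_atTop N] with n hn
    rw [SimpleFunc.coe_restrict _ measurableSet_Icc, indicator_of_mem]
    have : (N : ℝ) ≤ n := by exact_mod_cast hn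
    exact abs_le.1 (hN.trans this)

theorem tendsto_conv_heatKernel {r : ℝ≥0∞} (hr : 1 ≤ r) {g : ℝ → ℂ} (hg : MemLp g r volume)
    {u : ℕ → ℝ → ℂ} (hu : ∀ n, Measurable (u n)) (hug : ∀ n x, ‖u n x‖ ≤ 2 * ‖g x‖)
    (hlim : ∀ x, Filter.Tendsto (fun n => u n x) Filter.atTop (nhds (g x))) {t : ℝ} (ht : 0 < t)
    (x : ℝ) : Filter.Tendsto (fun n => (heatKernel t).conv (u n) x) Filter.atTop
      (nhds ((heatKernel t).conv g x)) := by
  refine tendsto_integral_of_dominated_convergence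
    (fun y => 2 * ‖heatKernel t (x - y) * g y‖) (fun n => ?_)
    ((integrable_heatKernel_mul hr hg ht x).norm.const_mul 2) (fun n => .of_forall fun y => ?_)
    (.of_forall fun y => (hlim y).const_mul _)
  · have : Continuous fun y => heatKernel t (x - y) :=
      (heatKernel t).continuous.comp (by fun_prop)
    exact this.aestronglyMeasurable.mul (hu n).aestronglyMeasurable
  · rw [norm_mul, norm_mul]
    calc _ ≤ ‖heatKernel t (x - y)‖ * (2 * ‖g y‖) := by gcongr; exact hug n y
      _ = _ := by ring

/-- Complex interpolation between two multiplier estimates. -/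
theorem exists_norm_crossIntegral_multiplierSum_le {L : Lp ℂ 2 μ →ₗ.[ℂ] Lp ℂ 2 μ}
    {φ χ : ℝ → ℂ} (hφ : IsSlocBump φ) (hχ : ContDiff ℝ ∞ χ) (hχc : HasCompactSupport χ)
    (hχs : tsupport χ ⊆ Ioi 0) {η : ℝ} (hη : 0 < η) {θ s₀ s₁ : ℝ} (hθ₀ : 0 < θ) (hθ₁ : θ < 1)
    (hs₀ : 0 < s₀) (hs₁ : 0 < s₁) (C₀ C₁ : ℝ≥0) :
    ∃ C : ℝ, 0 ≤ C ∧ ∀ p₀ p₁ q₀ q₁ r₀ r₁ p q r : ℝ≥0∞,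
      p₀⁻¹ + q₀⁻¹ = 1 → p₁⁻¹ + q₁⁻¹ = 1 → 1 ≤ r₀ → 1 ≤ r₁ → 1 ≤ r →
      p⁻¹ = ENNReal.ofReal (1 - θ) * p₀⁻¹ + ENNReal.ofReal θ * p₁⁻¹ →
      q⁻¹ = ENNReal.ofReal (1 - θ) * q₀⁻¹ + ENNReal.ofReal θ * q₁⁻¹ →
      r⁻¹ = ENNReal.ofReal (1 - θ) * r₀⁻¹ + ENNReal.ofReal θ * r₁⁻¹ →
      MultiplierEstimate L φ p₀ r₀ s₀ C₀ → MultiplierEstimate L φ p₁ r₁ s₁ C₁ →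
      ∀ E : ResolutionOfIdentity (Lp ℂ 2 μ), E.IsResolutionOf L → ∀ t : ℝ, 0 < t →
      ∀ (S : Finset ℤ) (G : ℝ), 0 < G → ∀ (g : ℤ → ℝ → ℂ), (∀ k, Measurable (g k)) →
      (∀ k, eLpNorm (g k) r volume ≤ ENNReal.ofReal G) →
      ∀ (h f : SimpleFunc X ℂ) (hh : MemLp h 2 μ) (hf : MemLp f 2 μ),
      eLpNorm h q μ ≤ 1 → eLpNorm f p μ ≤ 1 →
      ‖E.crossIntegral (multiplierSum χ η S fun k => (heatKernel t).conv (g k))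
        (hh.toLp h) (hf.toLp f)‖ ≤
        C * (Real.exp (-t) * (min t 1) ^ (-((1 - θ) * s₀ + θ * s₁) / 2)) * G := by
  obtain ⟨C, hC0, hC⟩ := exists_norm_crossIntegral_multiplierSum_le_of_simpleFunc (μ := μ) (L := L)
    hφ hχ hχc hχs hη hθ₀ hθ₁ hs₀ hs₁ C₀ C₁
  obtain ⟨D, hD0, hD⟩ := exists_norm_multiplierSum_le hχ.continuous hχc hχs hη
  obtain ⟨D', hD'0, hD'⟩ := exists_norm_conv_heatKernel_le
  refine ⟨2 * C, by positivity, ?_⟩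
  intro p₀ p₁ q₀ q₁ r₀ r₁ p q r hpq₀ hpq₁ hr₀ hr₁ hr1 hp hq hr hE₀ hE₁ E hE t ht S G hG g hg hgr h f
    hh hf hhq hfp
  set c : ℂ := ((2 * G : ℝ) : ℂ) with hc
  have hc0 : c ≠ 0 := by
    rw [hc, Complex.ofReal_ne_zero]; positivity
  have hcn : ‖c‖ = 2 * G := by rw [hc, Complex.norm_real, Real.norm_of_nonneg (by positivity)]
  set g' : ℤ → ℝ → ℂ := fun k x => c⁻¹ * g k x with hg'
  have hg'm : ∀ k, Measurable (g' k) := fun k => (hg k).const_mul _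
  have hg'L : ∀ k, MemLp (g' k) r volume := fun k =>
    MemLp.const_mul ⟨(hg k).aestronglyMeasurable, (hgr k).trans_lt ENNReal.ofReal_lt_top⟩ _
  choose u hui hub hul using fun k => exists_simpleFunc_tendsto (hg'm k)
  have hun : ∀ k n, eLpNorm (u k n) r volume ≤ 1 := by
    intro k n
    have h1 : eLpNorm (u k n) r volume ≤ eLpNorm ((G⁻¹ : ℝ) • g k) r volume := by
      refine eLpNorm_mono fun x => (hub k n x).trans (le_of_eq ?_)
      rw [hg', norm_mul, norm_inv, hcn, Pi.smul_apply, norm_smul, Real.norm_of_nonneg (by positivity)]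
      field_simp
    refine h1.trans ?_
    rw [eLpNorm_const_smul, Real.enorm_of_nonneg (by positivity)]
    calc _ ≤ ENNReal.ofReal G⁻¹ * ENNReal.ofReal G := by gcongr; exact hgr k
      _ = 1 := by
        rw [← ENNReal.ofReal_mul (by positivity), inv_mul_cancel₀ hG.ne', ENNReal.ofReal_one]
  have hlim := E.tendsto_crossIntegral (B := D * (D' * (Real.exp (-t) * t ^ (-((r⁻¹).toReal / 2))) * 1))
    (m := fun n => multiplierSum χ η S fun k => (heatKernel t).conv (u k n))
    (m' := multiplierSum χ η S fun k => (heatKernel t).conv (g' k)) ?_ ?_ ?_ (hh.toLp h) (hf.toLp f)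
  · have h1 : ‖E.crossIntegral (multiplierSum χ η S fun k => (heatKernel t).conv (g' k))
        (hh.toLp h) (hf.toLp f)‖ ≤
        C * (Real.exp (-t) * (min t 1) ^ (-((1 - θ) * s₀ + θ * s₁) / 2)) :=
      le_of_tendsto' hlim.norm fun n => hC p₀ p₁ q₀ q₁ r₀ r₁ p q r hpq₀ hpq₁ hr₀ hr₁ hp hq hr hE₀ hE₁
        E hE t ht S (fun k => u k n) (fun k => hui k n) (fun k => hun k n) h f hh hf hhq hfp
    have e : (multiplierSum χ η S fun k => (heatKernel t).conv (g k)) =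
        fun x => c * multiplierSum χ η S (fun k => (heatKernel t).conv (g' k)) x := by
      funext x
      rw [← multiplierSum_const_mul]
      congr 1
      funext k y
      rw [hg', SchwartzMap.conv_const_mul, mul_inv_cancel_left₀ hc0]
    rw [e, E.crossIntegral_const_mul, norm_mul, hcn]
    calc _ ≤ 2 * G * (C * (Real.exp (-t) * (min t 1) ^ (-((1 - θ) * s₀ + θ * s₁) / 2))) := by gcongr
      _ = _ := by ring
  · exact fun n => measurable_multiplierSum hχ.continuous.measurable _ _ fun k =>
      (SchwartzMap.contDiff_conv _ (hui k n)).continuous.measurable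
  · intro n x
    refine hD S _ _ (fun k y => ?_) x
    have hmem : MemLp (u k n) r volume :=
      ⟨(u k n).aestronglyMeasurable, (hun k n).trans_lt ENNReal.one_lt_top⟩
    refine (hD' r hr1 (u k n) hmem t ht y).trans ?_
    gcongr
    exact ENNReal.toReal_le_of_le_ofReal zero_le_one (by simpa using hun k n)
  · intro x
    refine tendsto_finsetSum _ fun k _ => Filter.Tendsto.const_mul _ ?_
    exact tendsto_conv_heatKernel hr1 (hg'L k) (fun n => (u k n).measurable) (hub k) (hul k) ht _

end Extension

section Regularization

/-- The heat kernels form an approximate identity. -/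
theorem tendsto_heatKernel_conv {u : ℝ → ℂ} (hu : Continuous u) (hui : Integrable u) (x : ℝ) :
    Filter.Tendsto (fun n : ℕ => (heatKernel (1 / (n + 1 : ℝ))).conv u x) Filter.atTop
      (nhds (u x)) := by
  have hc : Filter.Tendsto (fun n : ℕ => ((n : ℝ) + 1) / (4 * Real.pi ^ 2)) Filter.atTop
      Filter.atTop :=
    (Filter.tendsto_atTop_add_const_right _ 1 tendsto_natCast_atTop_atTop).atTop_div_const
      (by positivity)
  have h1 := (Real.tendsto_integral_gaussian_smul' hui (hu.continuousAt (x := x))).comp hc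
  have h2 : Filter.Tendsto (fun n : ℕ => ((Real.exp (-(1 / ((n : ℝ) + 1))) : ℝ) : ℂ)) Filter.atTop
      (nhds 1) := by
    have := (Real.continuous_exp.tendsto 0).comp
      (by simpa using tendsto_one_div_add_atTop_nhds_zero_nat (𝕜 := ℝ).neg :
        Filter.Tendsto (fun n : ℕ => -(1 / ((n : ℝ) + 1))) Filter.atTop (nhds 0))
    rw [Real.exp_zero] at this
    exact_mod_cast (Complex.continuous_ofReal.tendsto 1).comp this
  have h3 := h2.mul h1
  rw [one_mul] at h3
  refine h3.congr fun n => ?_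
  rw [Function.comp_apply, SchwartzMap.conv, ← integral_const_mul]
  refine integral_congr_ae (.of_forall fun y => ?_)
  have hn : (0 : ℝ) < (n : ℝ) + 1 := by positivity
  set c : ℝ := ((n : ℝ) + 1) / (4 * Real.pi ^ 2) with hcdef
  have e1 : ((Real.pi : ℂ) * (c : ℂ)) ^ ((Module.finrank ℝ ℝ : ℂ) / 2) =
      (((Real.sqrt (4 * Real.pi * (1 / ((n : ℝ) + 1))))⁻¹ : ℝ) : ℂ) := by
    have h5 : ((Module.finrank ℝ ℝ : ℂ) / 2) = ((1 / 2 : ℝ) : ℂ) := by simp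
    have h6 : 4 * Real.pi * (1 / ((n : ℝ) + 1)) = (Real.pi * c)⁻¹ := by
      rw [hcdef]; field_simp
    rw [h5, ← Complex.ofReal_mul, ← Complex.ofReal_cpow (by positivity), ← Real.sqrt_eq_rpow, h6,
      Real.sqrt_inv, inv_inv]
  have e2 : -(x - y) ^ 2 / (4 * (1 / ((n : ℝ) + 1))) = -Real.pi ^ 2 * c * ‖x - y‖ ^ 2 := by
    rw [hcdef, Real.norm_eq_abs, sq_abs]; field_simp
  simp only
  rw [e1, heatKernel_apply (by positivity), e2]
  push_cast
  rw [smul_eq_mul]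
  ring

variable {r : ℝ≥0∞} {s : ℝ}

theorem exists_norm_conv_heatKernel_add_le : ∃ D : ℝ, 0 ≤ D ∧ ∀ r : ℝ≥0∞, 1 ≤ r → ∀ A : ℝ, 0 ≤ A →
    ∀ g : ℝ → ℂ, Measurable g → eLpNorm g r volume ≤ ENNReal.ofReal A → ∀ t τ : ℝ, 0 < t → 0 < τ →
    ∀ x, ‖(heatKernel (t + τ)).conv g x‖ ≤
      D * A * (Real.exp (-t) * t ^ (-((r⁻¹).toReal / 2))) := by
  obtain ⟨D, hD0, hD⟩ := exists_norm_conv_heatKernel_le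
  refine ⟨D, hD0, fun r hr A hA g hg hgA t τ ht hτ x => ?_⟩
  refine (hD r hr g ⟨hg.aestronglyMeasurable, hgA.trans_lt ENNReal.ofReal_lt_top⟩ (t + τ)
    (by positivity) x).trans ?_
  have h1 := exp_neg_add_mul_rpow_neg_le (b := (r⁻¹).toReal / 2) ht hτ.le (by positivity)
  have h2 : (eLpNorm g r volume).toReal ≤ A := ENNReal.toReal_le_of_le_ofReal hA hgA
  calc _ ≤ D * (Real.exp (-t) * t ^ (-((r⁻¹).toReal / 2))) * A := by gcongr
    _ = _ := by ring

theorem exists_norm_conv_heatKernel_le_of_isBesselPotential (hr : 1 ≤ r) (hs : 0 < s)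
    (hrs : (r⁻¹).toReal < s) {A : ℝ} (hA : 0 ≤ A) : ∃ B : ℝ, ∀ u g : ℝ → ℂ, Measurable g →
      eLpNorm g r volume ≤ ENNReal.ofReal A → IsBesselPotential s u g → ∀ τ : ℝ, 0 < τ →
      ∀ x, ‖(heatKernel τ).conv u x‖ ≤ B := by
  obtain ⟨D, hD0, hD⟩ := exists_norm_conv_heatKernel_add_le
  have hs2 : 0 < s / 2 := by positivity
  refine ⟨(Real.Gamma (s / 2))⁻¹ * ∫ t in Ioi (0 : ℝ),
    D * A * (t ^ (s / 2 - 1) * (Real.exp (-t) * t ^ (-((r⁻¹).toReal / 2)))),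
    fun u g hg hgA hug τ hτ x => ?_⟩
  rw [conv_heatKernel_eq_of_isBesselPotential hr hs hrs
    ⟨hg.aestronglyMeasurable, hgA.trans_lt ENNReal.ofReal_lt_top⟩ hg hug hτ, norm_mul,
    Complex.norm_real, Real.norm_of_nonneg (inv_nonneg.2 (Real.Gamma_pos_of_pos hs2).le)]
  refine mul_le_mul_of_nonneg_left ?_ (inv_nonneg.2 (Real.Gamma_pos_of_pos hs2).le)
  refine norm_integral_le_of_norm_le ((integrableOn_rpow_mul_exp_neg_mul_rpow_neg
    (by linarith)).const_mul _) ((ae_restrict_iff' measurableSet_Ioi).2 (.of_forall fun t ht => ?_))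
  have ht' : (0 : ℝ) < t := ht
  rw [norm_mul, Complex.norm_real, Real.norm_of_nonneg (by positivity)]
  calc _ ≤ t ^ (s / 2 - 1) * (D * A * (Real.exp (-t) * t ^ (-((r⁻¹).toReal / 2)))) := by
        gcongr
        exact hD r hr A hA g hg hgA t τ ht' hτ x
    _ = _ := by ring

theorem ResolutionOfIdentity.norm_crossIntegral_le_of_isBesselPotential {H : Type*}
    [NormedAddCommGroup H] [InnerProductSpace ℂ H] [CompleteSpace H] (E : ResolutionOfIdentity H)
    {χ : ℝ → ℂ} (hχ : Continuous χ) (hχc : HasCompactSupport χ) (hχs : tsupport χ ⊆ Ioi 0) {η : ℝ}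
    (hη : 0 < η) (hr : 1 ≤ r) (hs : 0 < s) (hrs : (r⁻¹).toReal < s) {A : ℝ} (hA : 0 ≤ A)
    {u g : ℤ → ℝ → ℂ} (hg : ∀ k, Measurable (g k))
    (hgA : ∀ k, eLpNorm (g k) r volume ≤ ENNReal.ofReal A)
    (hug : ∀ k, IsBesselPotential s (u k) (g k)) {τ : ℝ} (hτ : 0 < τ) (S : Finset ℤ) (h f : H)
    {w : ℝ → ℝ} (hw : IntegrableOn (fun t => t ^ (s / 2 - 1) * w t) (Ioi 0))
    (hwb : ∀ t : ℝ, 0 < t → ‖E.crossIntegral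
      (multiplierSum χ η S fun k => (heatKernel (t + τ)).conv (g k)) h f‖ ≤ w t) :
    ‖E.crossIntegral (multiplierSum χ η S fun k => (heatKernel τ).conv (u k)) h f‖ ≤
      (Real.Gamma (s / 2))⁻¹ * ∫ t in Ioi (0 : ℝ), t ^ (s / 2 - 1) * w t := by
  obtain ⟨D, hD0, hD⟩ := exists_norm_conv_heatKernel_add_le
  obtain ⟨D', hD'0, hD'⟩ := exists_norm_multiplierSum_le hχ hχc hχs hη
  have hs2 : 0 < s / 2 := by positivity
  have hΓ : 0 ≤ (Real.Gamma (s / 2))⁻¹ := inv_nonneg.2 (Real.Gamma_pos_of_pos hs2).le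
  set ρ : ℝ → ℝ := fun t => t ^ (s / 2 - 1) * (Real.exp (-t) * t ^ (-((r⁻¹).toReal / 2))) with hρ
  have hρi : IntegrableOn ρ (Ioi 0) := integrableOn_rpow_mul_exp_neg_mul_rpow_neg (by linarith)
  have hmeas : ∀ k, Measurable fun z : ℝ × ℝ => (heatKernel (z.1 + τ)).conv (g k) z.2 := fun k =>
    (SchwartzMap.measurable_conv_heatKernel (hg k)).comp
      ((measurable_fst.add_const τ).prodMk measurable_snd)
  set M : ℝ → ℝ → ℂ := fun t x => (Ioi (0 : ℝ)).indicator (fun t => ((t ^ (s / 2 - 1) : ℝ) : ℂ) *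
    multiplierSum χ η S (fun k => (heatKernel (t + τ)).conv (g k)) x) t with hM
  have hMm : Measurable (Function.uncurry M) := by
    have e : Function.uncurry M = ((Ioi (0 : ℝ)) ×ˢ univ).indicator fun z : ℝ × ℝ =>
        ((z.1 ^ (s / 2 - 1) : ℝ) : ℂ) *
          multiplierSum χ η S (fun k => (heatKernel (z.1 + τ)).conv (g k)) z.2 := by
      funext ⟨t, x⟩
      by_cases ht : 0 < t <;> simp [hM, Function.uncurry, ht]
    rw [e]
    refine Measurable.indicator ?_ (measurableSet_Ioi.prod MeasurableSet.univ)
    refine Measurable.mul (by fun_prop) (Finset.measurable_fun_sum _ fun k _ => ?_)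
    have h1 : Measurable fun z : ℝ × ℝ => Real.exp (-(k * η)) * z.2 := measurable_snd.const_mul _
    exact (hχ.measurable.comp h1).mul ((hmeas k).comp (measurable_fst.prodMk h1))
  have hMb : ∀ t x, ‖M t x‖ ≤ (Ioi (0 : ℝ)).indicator (fun t => D' * (D * A) * ρ t) t := by
    intro t x
    by_cases ht : 0 < t
    · have ht' : t ∈ Ioi (0 : ℝ) := ht
      rw [hM]
      simp only [indicator_of_mem ht']
      rw [norm_mul, Complex.norm_real, Real.norm_of_nonneg (by positivity)]
      have h1 := hD' S (fun k => (heatKernel (t + τ)).conv (g k)) _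
        (fun k y => hD r hr A hA (g k) (hg k) (hgA k) t τ ht hτ y) x
      calc _ ≤ t ^ (s / 2 - 1) * _ := mul_le_mul_of_nonneg_left h1 (by positivity)
        _ = _ := by rw [hρ]; ring
    · have ht' : t ∉ Ioi (0 : ℝ) := ht
      simp [hM, ht']
  have hrep : (multiplierSum χ η S fun k => (heatKernel τ).conv (u k)) =
      fun x => (((Real.Gamma (s / 2))⁻¹ : ℝ) : ℂ) * ∫ t, M t x := by
    funext x
    have hi : ∀ (k : ℤ) (y : ℝ), Integrable (fun t : ℝ => ((t ^ (s / 2 - 1) : ℝ) : ℂ) *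
        (heatKernel (t + τ)).conv (g k) y) (volume.restrict (Ioi 0)) := by
      intro k y
      refine Integrable.mono' (hρi.const_mul (D * A)) ?_
        ((ae_restrict_iff' measurableSet_Ioi).2 (.of_forall fun t ht => ?_))
      · exact (Measurable.mul (by fun_prop)
          ((hmeas k).comp (measurable_id.prodMk measurable_const))).aestronglyMeasurable
      · have ht' : (0 : ℝ) < t := ht
        rw [norm_mul, Complex.norm_real, Real.norm_of_nonneg (by positivity)]
        calc _ ≤ t ^ (s / 2 - 1) * _ := mul_le_mul_of_nonneg_left
              (hD r hr A hA (g k) (hg k) (hgA k) t τ ht' hτ y) (by positivity)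
          _ = _ := by rw [hρ]; ring
    simp only [hM]
    rw [integral_indicator measurableSet_Ioi]
    simp only [multiplierSum, Finset.mul_sum, mul_left_comm _ (χ _)]
    rw [integral_finsetSum _ fun k _ => (hi k _).const_mul _, Finset.mul_sum]
    refine Finset.sum_congr rfl fun k _ => ?_
    rw [conv_heatKernel_eq_of_isBesselPotential hr hs hrs ⟨(hg k).aestronglyMeasurable,
      (hgA k).trans_lt ENNReal.ofReal_lt_top⟩ (hg k) (hug k) hτ, integral_const_mul]
    ring
  have hbi : Integrable ((Ioi (0 : ℝ)).indicator fun t => D' * (D * A) * ρ t) :=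
    (integrable_indicator_iff measurableSet_Ioi).2 (hρi.const_mul _)
  rw [hrep, E.crossIntegral_const_mul, E.crossIntegral_integral hMm hbi hMb, norm_mul,
    Complex.norm_real, Real.norm_of_nonneg hΓ]
  refine mul_le_mul_of_nonneg_left ?_ hΓ
  rw [← integral_indicator measurableSet_Ioi]
  refine norm_integral_le_of_norm_le ((integrable_indicator_iff measurableSet_Ioi).2 hw)
    (.of_forall fun t => ?_)
  by_cases ht : 0 < t
  · have ht' : t ∈ Ioi (0 : ℝ) := ht
    simp only [hM, indicator_of_mem ht']
    rw [E.crossIntegral_const_mul, norm_mul, Complex.norm_real, Real.norm_of_nonneg (by positivity)]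
    exact mul_le_mul_of_nonneg_left (hwb t ht) (by positivity)
  · have ht' : t ∉ Ioi (0 : ℝ) := ht
    simp [hM, ht', ResolutionOfIdentity.crossIntegral]

theorem exp_neg_add_mul_min_rpow_neg_le {t τ b : ℝ} (ht : 0 < t) (hτ : 0 < τ) (hb : 0 ≤ b) :
    Real.exp (-(t + τ)) * (min (t + τ) 1) ^ (-b) ≤
      Real.exp (-t) * t ^ (-b) + Real.exp (-t) * t ^ (-0 : ℝ) := by
  have h1 : (min (t + τ) 1) ^ (-b) ≤ t ^ (-b) + 1 := by
    rcases le_total (t + τ) 1 with h | h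
    · rw [min_eq_left h]
      have := Real.rpow_le_rpow_of_nonpos ht (by linarith : t ≤ t + τ) (neg_nonpos.2 hb)
      linarith
    · rw [min_eq_right h, Real.one_rpow]
      have : 0 ≤ t ^ (-b) := by positivity
      linarith
  have h2 : Real.exp (-(t + τ)) ≤ Real.exp (-t) := Real.exp_le_exp.2 (by linarith)
  rw [neg_zero, Real.rpow_zero, ← mul_add]
  exact mul_le_mul h2 h1 (by positivity) (Real.exp_pos _).le

end Regularization

section Interpolation

variable {X : Type*} [MeasurableSpace X] {μ : Measure X}

theorem exists_isBesselPotential_of_sobolevNorm_lt {r : ℝ≥0∞} {s A : ℝ} {u : ℝ → ℂ}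
    (h : sobolevNorm r s u < ENNReal.ofReal A) : ∃ g : ℝ → ℂ, Measurable g ∧
      eLpNorm g r volume ≤ ENNReal.ofReal A ∧ IsBesselPotential s u g := by
  simp only [sobolevNorm, iInf_lt_iff] at h
  obtain ⟨g, hg, hug, hgA⟩ := h
  have hae := hg.1.ae_eq_mk
  refine ⟨hg.1.mk g, hg.1.stronglyMeasurable_mk.measurable, ?_, fun ψ => ?_⟩
  · rw [← eLpNorm_congr_ae hae]; exact hgA.le
  · rw [hug ψ]
    refine integral_congr_ae ?_
    filter_upwards [hae] with x hx
    rw [hx]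

/-- Decomposition of a multiplier into heat-regularized pieces of size `A`. -/
theorem tendsto_multiplierSum {φ χ : ℝ → ℂ} (hφ : IsSlocBump φ)
    (hχs : tsupport χ ⊆ Ioi 0) {η : ℝ}
    (hφχ : ∀ x : ℝ, 0 < x → ∀ᶠ n : ℕ in Filter.atTop, ∑ k ∈ Finset.Icc (-n : ℤ) n,
      χ (Real.exp (-(k * η)) * x) * φ (Real.exp (-(k * η)) * x) = 1)
    (hχc : HasCompactSupport χ) (hη : 0 < η)
    {m : ℝ → ℂ} (hm : IsMultiplierAwayFromZero m) (x : ℝ) :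
    Filter.Tendsto (fun n : ℕ => multiplierSum χ η (Finset.Icc (-n : ℤ) n)
      (fun k => (heatKernel (1 / (n + 1 : ℝ))).conv fun y => φ y * m (Real.exp (k * η) * y)) x)
      Filter.atTop (nhds (m x)) := by
  have hχ0 : ∀ y, y ≤ 0 → χ y = 0 := by
    intro y hy
    by_contra h
    exact (not_lt.2 hy) (hχs (subset_tsupport χ h))
  rcases le_or_gt x 0 with hx | hx
  · have h1 : ∀ (k : ℤ), χ (Real.exp (-(k * η)) * x) = 0 := fun k =>
      hχ0 _ (mul_nonpos_of_nonneg_of_nonpos (Real.exp_pos _).le hx)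
    obtain ⟨ε, hε, hmε⟩ := hm.eq_zero
    rw [hmε x (hx.trans_lt hε)]
    simp only [multiplierSum, h1, zero_mul, Finset.sum_const_zero]
    exact tendsto_const_nhds
  · obtain ⟨a, b, ha, -, hab⟩ := exists_subset_Icc_of_isCompact hχc hχs
    obtain ⟨N, hN⟩ := exists_abs_sub_le_of_exp_mul_mem_Icc (b := b) hη ha
    obtain ⟨K, hK⟩ : ∃ K : ℕ, ∀ k : ℤ, χ (Real.exp (-(k * η)) * x) ≠ 0 →
        k ∈ Finset.Icc (-K : ℤ) K := by
      by_cases hex : ∃ k₀ : ℤ, χ (Real.exp (-(k₀ * η)) * x) ≠ 0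
      · obtain ⟨k₀, hk₀⟩ := hex
        refine ⟨k₀.natAbs + N, fun k hk => ?_⟩
        have := abs_le.1 (hN x k k₀ (hab (subset_tsupport χ hk)) (hab (subset_tsupport χ hk₀)))
        rw [Finset.mem_Icc]
        omega
      · push Not at hex
        exact ⟨0, fun k hk => absurd (hex k) hk⟩
    set u : ℤ → ℝ → ℂ := fun k y => φ y * m (Real.exp (k * η) * y) with hu
    have huc : ∀ k, Continuous (u k) := fun k =>
      hφ.smooth.continuous.mul (hm.continuous.comp (continuous_const.mul continuous_id))
    have hui : ∀ k, Integrable (u k) := fun k =>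
      (huc k).integrable_of_hasCompactSupport hφ.hasCompactSupport.mul_right
    have hux : ∀ k, u k (Real.exp (-(k * η)) * x) = φ (Real.exp (-(k * η)) * x) * m x := by
      intro k
      simp only [hu]
      rw [← mul_assoc, ← Real.exp_add, add_neg_cancel, Real.exp_zero, one_mul]
    have hlim : Filter.Tendsto (fun n : ℕ => ∑ k ∈ Finset.Icc (-K : ℤ) K,
        χ (Real.exp (-(k * η)) * x) *
          (heatKernel (1 / (n + 1 : ℝ))).conv (u k) (Real.exp (-(k * η)) * x)) Filter.atTop
        (nhds (∑ k ∈ Finset.Icc (-K : ℤ) K, χ (Real.exp (-(k * η)) * x) *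
          u k (Real.exp (-(k * η)) * x))) :=
      tendsto_finsetSum _ fun k _ => (tendsto_heatKernel_conv (huc k) (hui k) _).const_mul _
    have hsub : ∀ (n : ℕ), K ≤ n → ∀ F : ℤ → ℂ, ∑ k ∈ Finset.Icc (-n : ℤ) n,
        χ (Real.exp (-(k * η)) * x) * F k =
        ∑ k ∈ Finset.Icc (-K : ℤ) K, χ (Real.exp (-(k * η)) * x) * F k := by
      intro n hn F
      refine (Finset.sum_subset (Finset.Icc_subset_Icc (by omega) (by omega)) fun k _ hk => ?_).symm
      have : χ (Real.exp (-(k * η)) * x) = 0 := by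
        by_contra h
        exact hk (hK k h)
      rw [this, zero_mul]
    have hval : ∑ k ∈ Finset.Icc (-K : ℤ) K, χ (Real.exp (-(k * η)) * x) *
        u k (Real.exp (-(k * η)) * x) = m x := by
      obtain ⟨n, hn, hn'⟩ := ((hφχ x hx).and (Filter.eventually_ge_atTop K)).exists
      rw [← hsub n hn' fun k => u k (Real.exp (-(k * η)) * x)]
      simp only [hux, ← mul_assoc]
      rw [← Finset.sum_mul, hn, one_mul]
    rw [hval] at hlim
    refine hlim.congr' ?_
    filter_upwards [Filter.eventually_ge_atTop K] with n hn
    exact (hsub n hn _).symm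

/-- Interpolation of multiplier estimates for a fixed operator on an arbitrary measure space. -/
theorem exists_multiplierEstimate_interpolation (L : Lp ℂ 2 μ →ₗ.[ℂ] Lp ℂ 2 μ)
    {φ : ℝ → ℂ} (hφ : IsSlocBump φ) {θ s₀ s₁ s : ℝ} (hθ₀ : 0 < θ) (hθ₁ : θ < 1) (hs₀ : 0 < s₀)
    (hs₁ : 0 < s₁) (hs : (1 - θ) * s₀ + θ * s₁ < s) (C₀ C₁ : ℝ≥0) :
    ∃ C : ℝ≥0, ∀ p₀ p₁ r₀ r₁ p r : ℝ≥0∞,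
      1 < p₀ → p₀ < ⊤ → 1 < p₁ → p₁ < ⊤ → 1 < r₀ → 1 < r₁ →
      1 < r₀ * ENNReal.ofReal s₀ → 1 < r₁ * ENNReal.ofReal s₁ →
      p⁻¹ = ENNReal.ofReal (1 - θ) * p₀⁻¹ + ENNReal.ofReal θ * p₁⁻¹ →
      r⁻¹ = ENNReal.ofReal (1 - θ) * r₀⁻¹ + ENNReal.ofReal θ * r₁⁻¹ →
      MultiplierEstimate L φ p₀ r₀ s₀ C₀ → MultiplierEstimate L φ p₁ r₁ s₁ C₁ →
      MultiplierEstimate L φ p r s C := by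
  obtain ⟨η, χ, hη, hχ, hχc, hχs, hφχ⟩ := hφ.exists_partition
  obtain ⟨C, hC0, hC⟩ := exists_norm_crossIntegral_multiplierSum_le (μ := μ) (L := L)
    hφ hχ hχc hχs hη hθ₀ hθ₁ hs₀ hs₁ C₀ C₁
  obtain ⟨D, hD0, hD⟩ := exists_norm_multiplierSum_le hχ.continuous hχc hχs hη
  have hθ' : 0 < 1 - θ := by linarith
  set sθ : ℝ := (1 - θ) * s₀ + θ * s₁ with hsθ
  have hsθ0 : 0 < sθ := by positivity
  have hs0 : 0 < s := hsθ0.trans hs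
  set ρ : ℝ → ℝ := fun t =>
    Real.exp (-t) * t ^ (-(sθ / 2)) + Real.exp (-t) * t ^ (-0 : ℝ) with hρ
  have hρi : IntegrableOn (fun t => t ^ (s / 2 - 1) * ρ t) (Ioi 0) := by
    simp only [hρ, mul_add]
    exact (integrableOn_rpow_mul_exp_neg_mul_rpow_neg (by linarith)).add
      (integrableOn_rpow_mul_exp_neg_mul_rpow_neg (by linarith))
  set K : ℝ := (Real.Gamma (s / 2))⁻¹ * (C * ∫ t in Ioi (0 : ℝ), t ^ (s / 2 - 1) * ρ t) with hK
  have hρ0 : 0 ≤ ∫ t in Ioi (0 : ℝ), t ^ (s / 2 - 1) * ρ t :=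
    setIntegral_nonneg measurableSet_Ioi fun t ht => by
      have : (0 : ℝ) < t := ht
      positivity
  have hΓ : 0 ≤ (Real.Gamma (s / 2))⁻¹ := inv_nonneg.2 (Real.Gamma_pos_of_pos (by positivity)).le
  have hK0 : 0 ≤ K := by positivity
  refine ⟨K.toNNReal, ?_⟩
  intro p₀ p₁ r₀ r₁ p r hp₀ hp₀t hp₁ hp₁t hr₀ hr₁ hrs₀ hrs₁ hp hr hE₀ hE₁ m hm hmn E hE
  have hsum : ENNReal.ofReal (1 - θ) + ENNReal.ofReal θ = 1 := by
    rw [← ENNReal.ofReal_add hθ'.le hθ₀.le, sub_add_cancel, ENNReal.ofReal_one]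
  have hconj : ∀ {x : ℝ≥0∞}, 1 < x → x⁻¹ + ((1 - x⁻¹)⁻¹)⁻¹ = 1 := by
    intro x hx
    rw [inv_inv]
    exact add_tsub_cancel_of_le (ENNReal.inv_le_one.2 hx.le)
  have hinv : ∀ {x x₀ x₁ : ℝ≥0∞}, 1 < x₀ → 1 < x₁ →
      x⁻¹ = ENNReal.ofReal (1 - θ) * x₀⁻¹ + ENNReal.ofReal θ * x₁⁻¹ → 1 < x := by
    intro x x₀ x₁ h0 h1 hx
    rw [← ENNReal.inv_lt_one, hx, ← hsum]
    have hθp : ENNReal.ofReal θ ≠ 0 := by simpa using hθ₀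
    have hθp' : ENNReal.ofReal (1 - θ) ≠ 0 := by simpa using hθ₁
    refine ENNReal.add_lt_add ?_ ?_
    · calc _ < ENNReal.ofReal (1 - θ) * 1 :=
          ENNReal.mul_lt_mul_right hθp' ENNReal.ofReal_ne_top (ENNReal.inv_lt_one.2 h0)
        _ = _ := mul_one _
    · calc _ < ENNReal.ofReal θ * 1 :=
          ENNReal.mul_lt_mul_right hθp ENNReal.ofReal_ne_top (ENNReal.inv_lt_one.2 h1)
        _ = _ := mul_one _
  have hp1 : 1 < p := hinv hp₀ hp₁ hp
  have hr1 : 1 < r := hinv hr₀ hr₁ hr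
  have hpt : p ≠ ⊤ := by
    rintro rfl
    rw [ENNReal.inv_top, eq_comm, add_eq_zero, mul_eq_zero, ENNReal.inv_eq_zero] at hp
    rcases hp.1 with h | h
    · rw [ENNReal.ofReal_eq_zero] at h; linarith
    · exact hp₀t.ne h
  have hrs : (r⁻¹).toReal < s := by
    have key : ∀ {x : ℝ≥0∞} {σ : ℝ}, 1 < x → 0 < σ → 1 < x * ENNReal.ofReal σ →
        (x⁻¹).toReal < σ := by
      intro x σ hx hσ h
      rw [← ENNReal.toReal_ofReal hσ.le]
      refine (ENNReal.toReal_lt_toReal (ENNReal.inv_ne_top.2 (zero_lt_one.trans hx).ne')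
        ENNReal.ofReal_ne_top).2 ?_
      rcases eq_or_ne x ⊤ with rfl | hxt
      · simpa using hσ
      · have hx0 : x ≠ 0 := (zero_lt_one.trans hx).ne'
        calc x⁻¹ = x⁻¹ * 1 := (mul_one _).symm
          _ < x⁻¹ * (x * ENNReal.ofReal σ) :=
            ENNReal.mul_lt_mul_right (ENNReal.inv_ne_zero.2 hxt) (ENNReal.inv_ne_top.2 hx0) h
          _ = ENNReal.ofReal σ := by rw [← mul_assoc, ENNReal.inv_mul_cancel hx0 hxt, one_mul]
    have h0 := key hr₀ hs₀ hrs₀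
    have h1 := key hr₁ hs₁ hrs₁
    have h2 : (r⁻¹).toReal = (1 - θ) * (r₀⁻¹).toReal + θ * (r₁⁻¹).toReal := by
      rw [hr, ENNReal.toReal_add, ENNReal.toReal_mul, ENNReal.toReal_mul,
        ENNReal.toReal_ofReal hθ'.le, ENNReal.toReal_ofReal hθ₀.le]
      · exact ENNReal.mul_ne_top ENNReal.ofReal_ne_top
          (ENNReal.inv_ne_top.2 (zero_lt_one.trans hr₀).ne')
      · exact ENNReal.mul_ne_top ENNReal.ofReal_ne_top
          (ENNReal.inv_ne_top.2 (zero_lt_one.trans hr₁).ne')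
    rw [h2]
    refine lt_of_lt_of_le ?_ hs.le
    rw [hsθ]
    gcongr
  set q₀ : ℝ≥0∞ := (1 - p₀⁻¹)⁻¹ with hq₀
  set q₁ : ℝ≥0∞ := (1 - p₁⁻¹)⁻¹ with hq₁
  set q : ℝ≥0∞ := (ENNReal.ofReal (1 - θ) * q₀⁻¹ + ENNReal.ofReal θ * q₁⁻¹)⁻¹ with hq
  have hq' : q⁻¹ = ENNReal.ofReal (1 - θ) * q₀⁻¹ + ENNReal.ofReal θ * q₁⁻¹ := by rw [hq, inv_inv]
  have hpq₀ : p₀⁻¹ + q₀⁻¹ = 1 := hconj hp₀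
  have hpq₁ : p₁⁻¹ + q₁⁻¹ = 1 := hconj hp₁
  have hpq : p⁻¹ + q⁻¹ = 1 := by
    rw [hp, hq']
    calc _ = ENNReal.ofReal (1 - θ) * (p₀⁻¹ + q₀⁻¹) + ENNReal.ofReal θ * (p₁⁻¹ + q₁⁻¹) := by ring
      _ = 1 := by rw [hpq₀, hpq₁, mul_one, mul_one, hsum]
  set u : ℤ → ℝ → ℂ := fun k y => φ y * m (Real.exp (k * η) * y) with hu
  set mn : ℕ → ℝ → ℂ := fun n => multiplierSum χ η (Finset.Icc (-n : ℤ) n)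
    (fun k => (heatKernel (1 / (n + 1 : ℝ))).conv (u k)) with hmndef
  have hui : ∀ k, Integrable (u k) := fun k =>
    (hφ.smooth.continuous.mul (hm.continuous.comp
      (continuous_const.mul continuous_id))).integrable_of_hasCompactSupport
      hφ.hasCompactSupport.mul_right
  have hmnm : ∀ n, Measurable (mn n) := fun n =>
    measurable_multiplierSum hχ.continuous.measurable _ _ fun k =>
      (SchwartzMap.contDiff_conv _ (hui k)).continuous.measurable
  have hlim : ∀ x, Filter.Tendsto (fun n => mn n x) Filter.atTop (nhds (m x)) :=
    tendsto_multiplierSum hφ hχs hφχ hχc hη hm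
  have hpieces : ∀ A : ℝ, slocNorm φ r s m < ENNReal.ofReal A → ∀ k, ∃ g : ℝ → ℂ, Measurable g ∧
      eLpNorm g r volume ≤ ENNReal.ofReal A ∧ IsBesselPotential s (u k) g := fun A hA k =>
    exists_isBesselPotential_of_sobolevNorm_lt (lt_of_le_of_lt
      (le_iSup₂_of_le (Real.exp (k * η)) (Real.exp_pos _) le_rfl) hA)
  have hbdd : ∃ B : ℝ, ∀ n x, ‖mn n x‖ ≤ B := by
    obtain ⟨A, hA0, hA⟩ : ∃ A : ℝ, 0 ≤ A ∧ slocNorm φ r s m < ENNReal.ofReal A := by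
      refine ⟨(slocNorm φ r s m).toReal + 1, by positivity, ?_⟩
      rw [ENNReal.ofReal_add (by positivity) zero_le_one, ENNReal.ofReal_toReal hmn.ne,
        ENNReal.ofReal_one]
      exact ENNReal.lt_add_right hmn.ne one_ne_zero
    obtain ⟨B, hB⟩ := exists_norm_conv_heatKernel_le_of_isBesselPotential hr1.le hs0 hrs hA0
    refine ⟨D * B, fun n x => hD _ _ _ (fun k y => ?_) x⟩
    obtain ⟨g, hg, hgA, hug⟩ := hpieces A hA k
    exact hB (u k) g hg hgA hug _ (by positivity) y
  obtain ⟨B, hB⟩ := hbdd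
  obtain ⟨T, hT⟩ := E.exists_isIntegral hm.continuous.measurable
    (fun x => le_of_tendsto' (hlim x).norm fun n => hB n x)
  refine ⟨T, hT, ?_⟩
  have hmain : ∀ A : ℝ, 0 < A → slocNorm φ r s m < ENNReal.ofReal A →
      lpOpNorm μ p T ≤ ENNReal.ofReal (K * A) := by
    intro A hA0 hA
    choose g hg hgA hug using hpieces A hA
    refine lpOpNorm_le_of_normalized_simpleFunc hp1 hpt hpq T (K * A).toNNReal
      fun h f hh hf hhq hfp => ?_
    rw [hT.inner_eq, ← ofReal_norm]
    refine ENNReal.ofReal_le_ofReal (le_of_tendsto'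
      (E.tendsto_crossIntegral hmnm hB hlim (hh.toLp h) (hf.toLp f)).norm fun n => ?_)
    have hτ : (0 : ℝ) < 1 / (n + 1 : ℝ) := by positivity
    have h1 := E.norm_crossIntegral_le_of_isBesselPotential hχ.continuous hχc hχs hη hr1.le hs0 hrs
      hA0.le hg hgA hug hτ (Finset.Icc (-n : ℤ) n) (hh.toLp h) (hf.toLp f)
      (w := fun t => C * A * ρ t) ?_ ?_
    · refine h1.trans (le_of_eq ?_)
      simp only [mul_left_comm _ (C * A)]
      rw [integral_const_mul, hK]
      ring
    · simp only [mul_left_comm _ (C * A)]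
      exact hρi.const_mul _
    · intro t ht
      refine (hC p₀ p₁ q₀ q₁ r₀ r₁ p q r hpq₀ hpq₁ hr₀.le hr₁.le hr1.le hp hq' hr hE₀ hE₁ E hE
        _ (by positivity) _ A hA0 g hg hgA h f hh hf hhq hfp).trans ?_
      have h2 := exp_neg_add_mul_min_rpow_neg_le (b := sθ / 2) ht hτ (by positivity)
      rw [neg_div]
      calc _ ≤ C * ρ t * A := by gcongr
        _ = _ := by ring
  set a : ℝ := (slocNorm φ r s m).toReal with ha
  have ha' : slocNorm φ r s m = ENNReal.ofReal a := (ENNReal.ofReal_toReal hmn.ne).symm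
  have ha0 : 0 ≤ a := ENNReal.toReal_nonneg
  have hfin : lpOpNorm μ p T ≤ ENNReal.ofReal (K * a) := by
    have hc : Filter.Tendsto (fun n : ℕ => ENNReal.ofReal (K * (a + 1 / ((n : ℝ) + 1))))
        Filter.atTop (nhds (ENNReal.ofReal (K * (a + 0)))) :=
      ENNReal.tendsto_ofReal ((tendsto_const_nhds.add
        tendsto_one_div_add_atTop_nhds_zero_nat).const_mul K)
    rw [add_zero] at hc
    refine ge_of_tendsto' hc fun n => hmain _ (by positivity) ?_
    rw [ha']
    exact (ENNReal.ofReal_lt_ofReal_iff (by positivity)).2 (lt_add_of_pos_right _ (by positivity))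
  rw [ha']
  refine hfin.trans (le_of_eq ?_)
  rw [ENNReal.ofReal_mul hK0]
  rfl

end Interpolation

theorem propositionA1
    {n : ℕ} {X : Type*} [TopologicalSpace X] [ChartedSpace (EuclideanSpace ℝ (Fin n)) X]
    [IsManifold 𝓘(ℝ, EuclideanSpace ℝ (Fin n)) ∞ X]
    [T2Space X] [CompactSpace X] [ConnectedSpace X] [MeasurableSpace X] [BorelSpace X]
    (μ : Measure X) (hμ : IsSmoothPositiveDensity n μ)
    {ν : ℕ} (W : Fin ν → VField n X) (hW : ∀ i, IsSmoothVField (W i)) (hH : HormanderCondition W)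
    (d : Fin ν → ℕ) (hd : ∀ i, 0 < d i)
    (κ : ℕ) (hκ : 0 < κ) (hdκ : ∀ i, d i ∣ κ)
    (A : OperatorData ν X) (hA : IsMaximallySubelliptic μ W d κ A)
    (L : Lp ℂ 2 μ →ₗ.[ℂ] Lp ℂ 2 μ) (hL : IsNonnegSelfAdjointExtension W A L)
    (φ : ℝ → ℂ) (hφ : IsSlocBump φ)
    (θ s₀ s₁ s : ℝ) (hθ₀ : 0 < θ) (hθ₁ : θ < 1) (hs₀ : 0 < s₀) (hs₁ : 0 < s₁)
    (hs : (1 - θ) * s₀ + θ * s₁ < s) (C₀ C₁ : ℝ≥0) :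
    ∃ C : ℝ≥0, ∀ p₀ p₁ r₀ r₁ p r : ℝ≥0∞,
      1 < p₀ → p₀ < ⊤ → 1 < p₁ → p₁ < ⊤ → 1 < r₀ → 1 < r₁ →
      1 < r₀ * ENNReal.ofReal s₀ → 1 < r₁ * ENNReal.ofReal s₁ →
      p⁻¹ = ENNReal.ofReal (1 - θ) * p₀⁻¹ + ENNReal.ofReal θ * p₁⁻¹ →
      r⁻¹ = ENNReal.ofReal (1 - θ) * r₀⁻¹ + ENNReal.ofReal θ * r₁⁻¹ →
      MultiplierEstimate L φ p₀ r₀ s₀ C₀ → MultiplierEstimate L φ p₁ r₁ s₁ C₁ →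
      MultiplierEstimate L φ p r s C :=
  exists_multiplierEstimate_interpolation L hφ hθ₀ hθ₁ hs₀ hs₁ hs C₀ C₁
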